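/- Consider auctions in which $m\ge 0$ indivisible goods, with publicly known nonnegative weights $w(1),\dots,w(m)$, are to be partitioned among $n\ge 1$ bidders (bundles may be empty); for a set $S$ of goods put $w(S)=\sum_{g\in S}w(g)$. Bidder $i$ has a private parameter $v_i\in\mathbb{R}_{\ge 0}$ and values $S$ at $v_i\,w(S)$. A mechanism consists of an allocation rule, which maps the bids $b\in\mathbb{R}_{\ge 0}^n$ to an ordered partition $(A_1(b),\dots,A_n(b))$ of the goods, and a payment rule, which charges bidder $i$ an amount $p_i(b)\ge 0$. It is DSIC if for every bidder $i$, every $v_i\ge 0$ and all bids $b_{-i}$ of the others, the utility $v_i\,w(A_i(b_i,b_{-i}))-p_i(b_i,b_{-i})$ is maximized over $b_i\ge 0$ by $b_i=v_i$, and is nonnegative there. The problem FA-NSW is to maximize $$\Big(\prod_{i=1}^n v_i\Big)^{1/n}\Big(\prod_{i=1}^n w(S_i)\Big)^{1/n}$$ over all ordered partitions $(S_1,\dots,S_n)$ of the goods; a solution is $(1+\varepsilon)$-approximate if its value is at least $\frac1{1+\varepsilon}$ times the maximum. Theorem. There is a DSIC mechanism which, for every fixed $\varepsilon>0$, finds a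 $(1+\varepsilon)$-approximate solution of FA-NSW in polynomial time. That is: there are mechanisms $M_\varepsilon$ ($\varepsilon>0$), each defined for all $n\ge1$, $m\ge 0$ and all nonnegative real weights, and a single program $P$ for a random access machine with logarithmic cost, such that for every real $\varepsilon>0$: 1. $M_\varepsilon$ is DSIC, and for all nonnegative real weights and bids its allocation is a $(1+\varepsilon)$-approximate solution of FA-NSW with the bids in the place of the $v_i$; 2. there is a polynomial $q_\varepsilon$ such that on all instances with nonnegative rational weights and bids (given by numerators and denominators in binary), $P$, supplied with $\lceil 1/\varepsilon\rceil$ and the instance, computes the allocation and the payments of $M_\varepsilon$ in time at most $q_\varepsilon$ of the encoding length of the instance. -/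

import Mathlib

open scoped NNReal

/-! ### Random access machine programs with logarithmic cost -/

namespace RAM

/-- Memory: natural-number registers, and arrays of natural numbers (array `a`, cell `k`). -/
structure State where
  reg : ℕ → ℕ
  arr : ℕ → ℕ → ℕ

/-- Write `v` into register `x`. -/
def State.setReg (s : State) (x v : ℕ) : State :=
  { s with reg := Function.update s.reg x v }

/-- Write `v` into cell `k` of array `a`. -/
def State.setArr (s : State) (a k v : ℕ) : State :=
  { s with arr := Function.update s.arr a (Function.update (s.arr a) k v) }

/-- Arithmetic terms. Subtraction is truncated, division is rounded down (and `x / 0 = 0`). -/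
inductive Term where
  | lit (c : ℕ)
  | reg (x : ℕ)
  | read (a : ℕ) (k : Term)
  | add (e₁ e₂ : Term)
  | sub (e₁ e₂ : Term)
  | mul (e₁ e₂ : Term)
  | div (e₁ e₂ : Term)

/-- The value of a term. -/
def Term.val (s : State) : Term → ℕ
  | lit c => c
  | reg x => s.reg x
  | read a k => s.arr a (k.val s)
  | add e₁ e₂ => e₁.val s + e₂.val s
  | sub e₁ e₂ => e₁.val s - e₂.val s
  | mul e₁ e₂ => e₁.val s * e₂.val s
  | div e₁ e₂ => e₁.val s / e₂.val s

/-- The cost of evaluating a term, by the logarithmic cost criterion: every access and every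
operation costs one plus the binary lengths of its operands (addresses and contents included). -/
def Term.cost (s : State) : Term → ℕ
  | lit c => 1 + c.size
  | reg x => 1 + (s.reg x).size
  | read a k => k.cost s + (1 + (k.val s).size + (s.arr a (k.val s)).size)
  | add e₁ e₂ => e₁.cost s + e₂.cost s + (1 + (e₁.val s).size + (e₂.val s).size)
  | sub e₁ e₂ => e₁.cost s + e₂.cost s + (1 + (e₁.val s).size + (e₂.val s).size)
  | mul e₁ e₂ => e₁.cost s + e₂.cost s + (1 + (e₁.val s).size + (e₂.val s).size)
  | div e₁ e₂ => e₁.cost s + e₂.cost s + (1 + (e₁.val s).size + (e₂.val s).size)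

/-- Programs. A program is a finite object and mentions finitely many registers and arrays. -/
inductive Prog where
  | skip
  | assign (x : ℕ) (e : Term)
  | write (a : ℕ) (k e : Term)
  | seq (p q : Prog)
  | ite (e : Term) (p q : Prog)
  | loop (e : Term) (p : Prog)

/-- `Exec p s t s'`: started in memory `s`, the program `p` halts in memory `s'` at total
cost `t`. A test succeeds if its value is not zero; `loop e p` repeats `p` while the test `e`
succeeds. -/
inductive Exec : Prog → State → ℕ → State → Prop where
  | skip (s : State) : Exec .skip s 1 s
  | assign (x : ℕ) (e : Term) (s : State) :
      Exec (.assign x e) s (1 + e.cost s) (s.setReg x (e.val s))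
  | write (a : ℕ) (k e : Term) (s : State) :
      Exec (.write a k e) s (1 + k.cost s + e.cost s) (s.setArr a (k.val s) (e.val s))
  | seq {p q : Prog} {s s₁ s₂ : State} {t₁ t₂ : ℕ} :
      Exec p s t₁ s₁ → Exec q s₁ t₂ s₂ → Exec (.seq p q) s (t₁ + t₂) s₂
  | ite_true {e : Term} {p q : Prog} {s s₁ : State} {t : ℕ} :
      e.val s ≠ 0 → Exec p s t s₁ → Exec (.ite e p q) s (1 + e.cost s + t) s₁
  | ite_false {e : Term} {p q : Prog} {s s₁ : State} {t : ℕ} :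
      e.val s = 0 → Exec q s t s₁ → Exec (.ite e p q) s (1 + e.cost s + t) s₁
  | loop_done {e : Term} {p : Prog} {s : State} :
      e.val s = 0 → Exec (.loop e p) s (1 + e.cost s) s
  | loop_step {e : Term} {p : Prog} {s s₁ s₂ : State} {t₁ t₂ : ℕ} :
      e.val s ≠ 0 → Exec p s t₁ s₁ → Exec (.loop e p) s₁ t₂ s₂ →
        Exec (.loop e p) s (1 + e.cost s + t₁ + t₂) s₂

end RAM

/-! ### Fair auctions in a single-parameter environment -/

namespace FairAuction

/-- An allocation of the goods `Fin m` among the agents `Fin n`, given by the agent who receives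
each good. These are the ordered partitions of the goods into `n` (possibly empty) bundles. -/
abbrev Allocation (n m : ℕ) : Type := Fin m → Fin n

/-- The bundle `S i` of agent `i`. -/
def Allocation.bundle {n m : ℕ} (S : Allocation n m) (i : Fin n) : Finset (Fin m) :=
  Finset.univ.filter fun g => S g = i

/-- The additive summarization function `w(T) = ∑ g ∈ T, w(g)`. -/
def weight {m : ℕ} (w : Fin m → ℝ≥0) (T : Finset (Fin m)) : ℝ≥0 := ∑ g ∈ T, w g

/-- The objective of FA-NSW: `(∏ i, v i) ^ (1 / n) * (∏ i, w (S i)) ^ (1 / n)`. -/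
noncomputable def nsw {n m : ℕ} (w : Fin m → ℝ≥0) (v : Fin n → ℝ≥0) (S : Allocation n m) : ℝ≥0 :=
  (∏ i, v i) ^ (1 / (n : ℝ)) * (∏ i, weight w (S.bundle i)) ^ (1 / (n : ℝ))

/-- A sealed-bid mechanism: an allocation rule and a payment rule, both functions of the bids. -/
structure Mechanism (n m : ℕ) where
  alloc : (Fin n → ℝ≥0) → Allocation n m
  pay : (Fin n → ℝ≥0) → Fin n → ℝ≥0

namespace Mechanism

variable {n m : ℕ}

/-- The quasilinear utility of agent `i` with true valuation parameter `v` at the bids `b`. -/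
noncomputable def utility (M : Mechanism n m) (w : Fin m → ℝ≥0) (i : Fin n) (v : ℝ≥0)
    (b : Fin n → ℝ≥0) : ℝ :=
  (v : ℝ) * (weight w ((M.alloc b).bundle i) : ℝ) - (M.pay b i : ℝ)

/-- Dominant strategy incentive compatibility: whatever the others bid, reporting the true
valuation parameter maximizes the utility of an agent, and never leads to negative utility. -/
def IsDSIC (M : Mechanism n m) (w : Fin m → ℝ≥0) : Prop :=
  ∀ (i : Fin n) (v : ℝ≥0) (b : Fin n → ℝ≥0),
    M.utility w i v b ≤ M.utility w i v (Function.update b i v) ∧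
      0 ≤ M.utility w i v (Function.update b i v)

/-- The allocation rule always returns an `α`-approximate solution of FA-NSW. -/
def IsApproxNSW (M : Mechanism n m) (w : Fin m → ℝ≥0) (α : ℝ) : Prop :=
  ∀ (b : Fin n → ℝ≥0) (T : Allocation n m),
    (nsw w b T : ℝ) ≤ α * (nsw w b (M.alloc b) : ℝ)

end Mechanism

/-- A mechanism for every fair-auction setting `⟨[m], [n], w⟩` with at least one agent. -/
abbrev MechanismFamily : Type := (n m : ℕ) → [NeZero n] → (Fin m → ℝ≥0) → Mechanism n m

/-- The array with entries `f 0, …, f (l - 1)`, followed by zeros. -/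
def toArray {l : ℕ} (f : Fin l → ℕ) (j : ℕ) : ℕ := if h : j < l then f ⟨j, h⟩ else 0

/-- The initial memory for accuracy parameter `k` and rational weights `w` and bids `b`:
registers 0, 1, 2 hold `k`, `n`, `m`; arrays 0, 1 hold the numerators and denominators of the
weights, arrays 2, 3 those of the bids. -/
def input {n m : ℕ} (k : ℕ) (w : Fin m → ℚ≥0) (b : Fin n → ℚ≥0) : RAM.State where
  reg x := match x with
    | 0 => k
    | 1 => n
    | 2 => m
    | _ => 0
  arr a := match a with
    | 0 => toArray fun g => (w g).num
    | 1 => toArray fun g => (w g).den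
    | 2 => toArray fun i => (b i).num
    | 3 => toArray fun i => (b i).den
    | _ => fun _ => 0

/-- The binary encoding length of a rational instance. -/
def inputSize {n m : ℕ} (w : Fin m → ℚ≥0) (b : Fin n → ℚ≥0) : ℕ :=
  n + m + (∑ g, ((w g).num.size + (w g).den.size)) + ∑ i, ((b i).num.size + (b i).den.size)

/-- The final memory `s` holds the allocation `S` (in array 0: the receiver of each good) and the
payments `p` (as fractions, with numerators in array 1 and nonzero denominators in array 2). -/
def IsOutput {n m : ℕ} (s : RAM.State) (S : Allocation n m) (p : Fin n → ℝ≥0) : Prop :=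
  (∀ g : Fin m, s.arr 0 g = (S g : ℕ)) ∧
    ∀ i : Fin n, s.arr 2 i ≠ 0 ∧ p i = (s.arr 1 i : ℝ≥0) / (s.arr 2 i : ℝ≥0)

/-- With accuracy parameter `k`, the program `P` computes the allocation and the payments of the
mechanism on all rational instances, in time polynomial in the encoding length of the instance
(the polynomial may depend on `k`). -/
def ComputesInPolyTime (P : RAM.Prog) (k : ℕ) (M : MechanismFamily) : Prop :=
  ∃ q : Polynomial ℕ, ∀ (n m : ℕ) [NeZero n] (w : Fin m → ℚ≥0) (b : Fin n → ℚ≥0),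
    ∃ (t : ℕ) (s : RAM.State),
      RAM.Exec P (input k w b) t s ∧ t ≤ q.eval (inputSize w b) ∧
        IsOutput s ((M n m fun g => (w g : ℝ≥0)).alloc fun i => (b i : ℝ≥0))
          ((M n m fun g => (w g : ℝ≥0)).pay fun i => (b i : ℝ≥0))

end FairAuction

namespace RAM

/-! ### Counting programs

A language of programs with bounded loops, translated into RAM programs, for which running time
and word length are bounded once and for all. -/

/-! The factor `(∏ v i) ^ (1 / n)` does not depend on the allocation. An allocation that depends on
the weights alone, with zero payments, is therefore DSIC: no bid changes the outcome, and utilities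
are nonnegative. What remains is an approximation scheme for the product of `n` loads under one
additive weight function, with error `(1 + 1 / k) ^ n` for `k = ⌈1 / ε⌉`; the `n`-th root turns this
into `1 + 1 / k ≤ 1 + ε`. Rational weights get the output of the program, other weights an exact
optimum.

Let `T` be optimal with positive value and least load `ℓ`. No single move improves `T`, so any
bundle of `T` without one of its goods of positive weight has load at most `ℓ`
(`IsOptimal.exchange`). Some `a = w(g) * (t + 1)` with `t < m` satisfies `a ≤ ℓ < 2 * a`
(`IsOptimal.exists_guess`), and all `m ^ 2` such units are tried. With `K = 33 * k`, weights are
rounded down to multiples of `a / K ^ 2`, those below about `a / K` ("small") to zero and those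
above about `4 * a` ("huge") to the common value `L + 1`, where `L = 4 * K ^ 2`. Two goods of
nonzero rounded size in one bundle force its load in `T` to be at most `2 * ℓ < 4 * a`, so every
rounded load of `T` is at most `L` or stems from one huge good (`IsOptimal.valid`).

A dynamic program over the goods stores one admissible allocation per code, which counts the agents
of each rounded load. Allocations of equal code have the same rounded loads up to a permutation of
the agents, so one representative suffices (`exists_extension`). There are at most `(n + 1) ^ (L +
2)` codes, polynomially many for fixed `k`.

The representative `X` of the code of `T` loses at most a factor `1 + 1 / K` on each load of large
goods without a huge one. The huge goods lie in bundles of their own, so the product over those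
bundles is the same (`Valid.prod_huge`). Small goods are given greedily to agents of least load; the
inequality of arithmetic and geometric means, applied to the ratios of the loads, bounds the loss by
`(1 + 16 / K) ^ n` (`prod_le_of_greedy`). Finally `(1 + 1 / K) * (1 + 16 / K) ≤ 1 + 1 / k`.

For the running time, the program is written with bounded loops and with products one factor of
which stays fixed. Words then grow by boundedly many bits per step, and `Cmd.exec` bounds the cost
of all such programs at once; `Cmd.rep_inv` serves for correctness. -/

@[simp] theorem State.setReg_reg (s : State) (x v y : ℕ) :
    (s.setReg x v).reg y = if y = x then v else s.reg y := by
  simp [State.setReg, Function.update_apply]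

@[simp] theorem State.setReg_arr (s : State) (x v : ℕ) : (s.setReg x v).arr = s.arr := rfl

@[simp] theorem State.setArr_reg (s : State) (a k v : ℕ) : (s.setArr a k v).reg = s.reg := rfl

@[simp] theorem State.setArr_arr (s : State) (a k v c j : ℕ) :
    (s.setArr a k v).arr c j = if c = a ∧ j = k then v else s.arr c j := by
  by_cases h : c = a
  · subst h; simp [State.setArr, Function.update_apply]
  · simp [State.setArr, h]

theorem State.setArr_arr_of_ne (s : State) {a c : ℕ} (k v : ℕ) (h : c ≠ a) :
    (s.setArr a k v).arr c = s.arr c := by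
  funext j; simp [h]

/-- Programs all of whose loops `rep x r p` run `p` with counter `x` from `0` to the content of
register `r`. -/
inductive Cmd where
  | skip
  | assign (x : ℕ) (e : Term)
  | write (a : ℕ) (k e : Term)
  | seq (p q : Cmd)
  | ite (e : Term) (p q : Cmd)
  | rep (x r : ℕ) (p : Cmd)

namespace Cmd

/-- Translation into RAM programs. -/
def toProg : Cmd → Prog
  | skip => .skip
  | assign x e => .assign x e
  | write a k e => .write a k e
  | seq p q => .seq p.toProg q.toProg
  | ite e p q => .ite e p.toProg q.toProg
  | rep x r p => .seq (.assign x (.lit 0))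
      (.loop (.sub (.reg r) (.reg x))
        (.seq p.toProg (.assign x (.add (.reg x) (.lit 1)))))

/-- The memory after `j` rounds of the loop with counter `x` and body `f`. -/
def rounds (x : ℕ) (f : State → State) (s : State) : ℕ → State
  | 0 => s.setReg x 0
  | j + 1 => (f (rounds x f s j)).setReg x (j + 1)

/-- The memory in which a program halts. -/
def eval : Cmd → State → State
  | skip, s => s
  | assign x e, s => s.setReg x (e.val s)
  | write a k e, s => s.setArr a (k.val s) (e.val s)
  | seq p q, s => q.eval (p.eval s)
  | ite e p q, s => if e.val s = 0 then q.eval s else p.eval s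
  | rep x r p, s => rounds x p.eval s (s.reg r)

/-- The registers that a program writes. -/
def wr : Cmd → List ℕ
  | skip => []
  | assign x _ => [x]
  | write _ _ _ => []
  | seq p q => p.wr ++ q.wr
  | ite _ p q => p.wr ++ q.wr
  | rep x _ p => x :: p.wr

/-- The arrays that a program writes. -/
def wa : Cmd → List ℕ
  | skip => []
  | assign _ _ => []
  | write a _ _ => [a]
  | seq p q => p.wa ++ q.wa
  | ite _ p q => p.wa ++ q.wa
  | rep _ _ p => p.wa

/-- The registers that hold loop bounds. -/
def bounds : Cmd → List ℕ
  | skip => []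
  | assign _ _ => []
  | write _ _ _ => []
  | seq p q => p.bounds ++ q.bounds
  | ite _ p q => p.bounds ++ q.bounds
  | rep _ r p => r :: p.bounds

end Cmd

/-- `Agree R A s s'`: the memories agree outside the registers `R` and the arrays `A`. -/
def Agree (R A : List ℕ) (s s' : State) : Prop :=
  (∀ x, x ∉ R → s'.reg x = s.reg x) ∧ ∀ a, a ∉ A → s'.arr a = s.arr a

theorem Agree.refl (R A : List ℕ) (s : State) : Agree R A s s := ⟨fun _ _ => rfl, fun _ _ => rfl⟩

theorem Agree.trans {R A : List ℕ} {s s' s'' : State} (h : Agree R A s s') (h' : Agree R A s' s'') :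
    Agree R A s s'' :=
  ⟨fun x hx => (h'.1 x hx).trans (h.1 x hx), fun a ha => (h'.2 a ha).trans (h.2 a ha)⟩

theorem Agree.mono {R A R' A' : List ℕ} {s s' : State} (h : Agree R A s s')
    (hR : ∀ x ∈ R, x ∈ R') (hA : ∀ x ∈ A, x ∈ A') : Agree R' A' s s' :=
  ⟨fun x hx => h.1 x fun h' => hx (hR x h'), fun a ha => h.2 a fun h' => ha (hA a h')⟩

theorem agree_setReg {R A : List ℕ} {x : ℕ} (hx : x ∈ R) (s : State) (v : ℕ) :
    Agree R A s (s.setReg x v) := by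
  refine ⟨fun y hy => ?_, fun _ _ => rfl⟩
  rw [State.setReg_reg, if_neg]
  rintro rfl
  exact hy hx

theorem agree_rounds {R A : List ℕ} {x : ℕ} (hx : x ∈ R) {f : State → State}
    (hf : ∀ s, Agree R A s (f s)) (s : State) (j : ℕ) : Agree R A s (Cmd.rounds x f s j) := by
  induction j with
  | zero => exact agree_setReg hx s 0
  | succ j ih => exact (ih.trans (hf _)).trans (agree_setReg hx _ _)

theorem Cmd.agree (c : Cmd) (s : State) : Agree c.wr c.wa s (c.eval s) := by
  induction c generalizing s with
  | skip => exact .refl _ _ _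
  | assign x e => exact agree_setReg (by simp [wr]) s _
  | write a k e =>
    refine ⟨fun _ _ => rfl, fun b hb => State.setArr_arr_of_ne _ _ _ ?_⟩
    simpa [wa] using hb
  | seq p q hp hq =>
    exact ((hp s).mono (by simp +contextual [wr]) (by simp +contextual [wa])).trans
      ((hq _).mono (by simp +contextual [wr]) (by simp +contextual [wa]))
  | ite e p q hp hq =>
    simp only [eval]
    split
    · exact (hq s).mono (by simp +contextual [wr]) (by simp +contextual [wa])
    · exact (hp s).mono (by simp +contextual [wr]) (by simp +contextual [wa])
  | rep x r p hp =>
    exact agree_rounds (by simp [wr])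
      (fun s => (hp s).mono (by simp +contextual [wr]) (by simp [wa])) s _

/-- Registers that are not written keep their content. -/
theorem Cmd.eval_reg (c : Cmd) (s : State) {x : ℕ} (hx : x ∉ c.wr) : (c.eval s).reg x = s.reg x :=
  (c.agree s).1 x hx

/-- Arrays that are not written keep their content. -/
theorem Cmd.eval_arr (c : Cmd) (s : State) {a : ℕ} (ha : a ∉ c.wa) : (c.eval s).arr a = s.arr a :=
  (c.agree s).2 a ha

theorem Cmd.rounds_counter (x : ℕ) (f : State → State) (s : State) (j : ℕ) :
    (rounds x f s j).reg x = j := by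
  cases j <;> simp [rounds]

theorem Cmd.agree_body (x r : ℕ) (p : Cmd) (s : State) :
    Agree (rep x r p).wr (rep x r p).wa s (p.eval s) :=
  (p.agree s).mono (by simp +contextual [wr]) (by simp [wa])

/-- The invariant rule for loops. -/
theorem Cmd.rep_inv {x r : ℕ} {p : Cmd} {s : State} (I : ℕ → State → Prop)
    (zero : I 0 (s.setReg x 0))
    (succ : ∀ j s', j < s.reg r → s'.reg x = j → Agree (rep x r p).wr (rep x r p).wa s s' →
      I j s' → I (j + 1) ((p.eval s').setReg x (j + 1))) :
    I (s.reg r) ((rep x r p).eval s) := by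
  suffices ∀ j, j ≤ s.reg r → I j (rounds x p.eval s j) from this _ le_rfl
  intro j
  induction j with
  | zero => intro _; exact zero
  | succ j ih =>
    intro hj
    exact succ j _ hj (rounds_counter x p.eval s j)
      (agree_rounds (by simp [wr]) (agree_body x r p) s j) (ih (by omega))

/-! ### Word length and running time -/

/-- Literals, and registers and arrays outside of `R` and `A`. -/
def Term.isConst (R A : List ℕ) : Term → Bool
  | lit _ => true
  | reg x => !R.elem x
  | read a _ => !A.elem a
  | _ => false

/-- One factor of every product is constant while only `R` and `A` are written. -/
def Term.ok (R A : List ℕ) : Term → Bool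
  | lit _ => true
  | reg _ => true
  | read _ k => k.ok R A
  | add e f => e.ok R A && f.ok R A
  | sub e f => e.ok R A && f.ok R A
  | mul e f => e.isConst R A && (e.ok R A && f.ok R A)
  | div e f => e.ok R A && f.ok R A

/-- The length of a term. -/
def Term.len : Term → ℕ
  | lit c => c.size + 1
  | reg _ => 1
  | read _ k => k.len + 1
  | add e f => e.len + f.len + 1
  | sub e f => e.len + f.len + 1
  | mul e f => e.len + f.len + 1
  | div e f => e.len + f.len + 1

/-- All words have at most `b` bits. -/
def State.Lt (s : State) (b : ℕ) : Prop := (∀ x, s.reg x < 2 ^ b) ∧ ∀ a k, s.arr a k < 2 ^ b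

/-- All words outside `R` and `A` have at most `b` bits. -/
def State.LtOn (R A : List ℕ) (s : State) (b : ℕ) : Prop :=
  (∀ x, x ∉ R → s.reg x < 2 ^ b) ∧ ∀ a, a ∉ A → ∀ k, s.arr a k < 2 ^ b

theorem State.Lt.mono {s : State} {b b' : ℕ} (h : s.Lt b) (hb : b ≤ b') : s.Lt b' :=
  have := Nat.pow_le_pow_right (n := 2) two_pos hb
  ⟨fun x => (h.1 x).trans_le this, fun a k => (h.2 a k).trans_le this⟩

theorem State.Lt.ltOn {s : State} {b : ℕ} (h : s.Lt b) (R A : List ℕ) : s.LtOn R A b :=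
  ⟨fun x _ => h.1 x, fun a _ k => h.2 a k⟩

theorem State.LtOn.agree {R A : List ℕ} {s s' : State} {b : ℕ} (h : s.LtOn R A b)
    (hs : Agree R A s s') : s'.LtOn R A b :=
  ⟨fun x hx => (hs.1 x hx).symm ▸ h.1 x hx, fun a ha k => (hs.2 a ha).symm ▸ h.2 a ha k⟩

theorem State.Lt.setReg {s : State} {b : ℕ} (h : s.Lt b) {v : ℕ} (x : ℕ) (hv : v < 2 ^ b) :
    (s.setReg x v).Lt b := by
  refine ⟨fun y => ?_, h.2⟩
  rw [State.setReg_reg]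
  split
  · exact hv
  · exact h.1 y

theorem State.Lt.setArr {s : State} {b : ℕ} (h : s.Lt b) {v : ℕ} (a k : ℕ) (hv : v < 2 ^ b) :
    (s.setArr a k v).Lt b := by
  refine ⟨h.1, fun c j => ?_⟩
  rw [State.setArr_arr]
  split
  · exact hv
  · exact h.2 c j

/-- A sum adds one bit, a difference or a quotient none, and a product only the length of its
constant factor. So the word length grows additively, whereas repeated squaring would double it. -/
theorem Term.val_lt {R A : List ℕ} {s : State} {b b₀ : ℕ} (hs : s.Lt b)
    (hs₀ : s.LtOn R A b₀) (e : Term) (he : e.ok R A = true) :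
    e.val s < 2 ^ (b + e.len * (b₀ + 1)) := by
  have mono : ∀ {v c d : ℕ}, v < 2 ^ c → c ≤ d → v < 2 ^ d := fun h h' =>
    h.trans_le (Nat.pow_le_pow_right two_pos h')
  induction e with
  | lit c => exact mono (Nat.lt_size_self c) (by simp only [len]; nlinarith)
  | reg x => exact mono (hs.1 x) (by omega)
  | read a k _ => exact mono (hs.2 a _) (by omega)
  | add e f ihe ihf =>
    simp only [ok, Bool.and_eq_true] at he
    have h1 := mono (ihe he.1) (d := b + (e.len + f.len) * (b₀ + 1)) (by nlinarith)
    have h2 := mono (ihf he.2) (d := b + (e.len + f.len) * (b₀ + 1)) (by nlinarith)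
    refine mono (c := b + (e.len + f.len) * (b₀ + 1) + 1) ?_ (by simp only [len]; nlinarith)
    rw [pow_succ]; simp only [val]; omega
  | sub e f ihe ihf =>
    simp only [ok, Bool.and_eq_true] at he
    exact mono ((Nat.sub_le _ _).trans_lt (ihe he.1)) (by simp only [len]; nlinarith)
  | div e f ihe ihf =>
    simp only [ok, Bool.and_eq_true] at he
    exact mono ((Nat.div_le_self _ _).trans_lt (ihe he.1)) (by simp only [len]; nlinarith)
  | mul e f ihe ihf =>
    simp only [ok, Bool.and_eq_true] at he
    have hc : e.val s < 2 ^ (b₀ + e.len) := by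
      obtain ⟨h, -, -⟩ := he
      cases e with
      | lit c => exact mono (Nat.lt_size_self c) (by simp only [len]; omega)
      | reg x => exact mono (hs₀.1 x (by simpa [isConst] using h)) (by omega)
      | read a k => exact mono (hs₀.2 a (by simpa [isConst] using h) _) (by omega)
      | _ => simp [isConst] at h
    have := Nat.mul_lt_mul'' hc (ihf he.2.2)
    rw [← pow_add] at this
    exact mono this (by simp only [len]; nlinarith)

theorem size_le_of_lt {v b : ℕ} (h : v < 2 ^ b) : v.size ≤ b := Nat.size_le.2 h

theorem Term.cost_le {R A : List ℕ} {s : State} {b b₀ c : ℕ} (hs : s.Lt b)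
    (hs₀ : s.LtOn R A b₀) (e : Term) (he : e.ok R A = true) (hc : b + e.len * (b₀ + 1) ≤ c) :
    e.cost s ≤ e.len * (2 * c + 1) := by
  have size : ∀ f : Term, f.ok R A = true → f.len ≤ e.len → (f.val s).size ≤ c := fun f hf hl =>
    (size_le_of_lt (val_lt hs hs₀ f hf)).trans
      ((Nat.add_le_add_left (Nat.mul_le_mul_right _ hl) _).trans hc)
  have hbc : b ≤ c := by nlinarith
  induction e with
  | lit v => simp only [cost, len]; nlinarith
  | reg x => have := size_le_of_lt (hs.1 x); simp only [cost, len]; omega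
  | read a k ih =>
    have h1 := size_le_of_lt (hs.2 a (k.val s))
    have h2 := size k he (by simp [len])
    have h3 := ih he (by simp only [len] at hc; nlinarith)
      (fun f hf hl => size f hf (hl.trans (by simp [len])))
    simp only [cost, len]; nlinarith
  | add e f ihe ihf | sub e f ihe ihf | div e f ihe ihf =>
    simp only [ok, Bool.and_eq_true] at he
    have h1 := size e he.1 (by simp only [len]; omega)
    have h2 := size f he.2 (by simp only [len]; omega)
    have h3 := ihe he.1 (by simp only [len] at hc; nlinarith)
      (fun g hf hl => size g hf (hl.trans (by simp only [len]; omega)))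
    have h4 := ihf he.2 (by simp only [len] at hc; nlinarith)
      (fun g hf hl => size g hf (hl.trans (by simp only [len]; omega)))
    simp only [cost, len]; nlinarith
  | mul e f ihe ihf =>
    simp only [ok, Bool.and_eq_true] at he
    have h1 := size e he.2.1 (by simp only [len]; omega)
    have h2 := size f he.2.2 (by simp only [len]; omega)
    have h3 := ihe he.2.1 (by simp only [len] at hc; nlinarith)
      (fun g hf hl => size g hf (hl.trans (by simp only [len]; omega)))
    have h4 := ihf he.2.2 (by simp only [len] at hc; nlinarith)
      (fun g hf hl => size g hf (hl.trans (by simp only [len]; omega)))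
    simp only [cost, len]; nlinarith

/-- Products have a constant factor, loop bounds are constant, and no loop body writes the counter
of the loop. -/
def Cmd.ok (R A : List ℕ) : Cmd → Bool
  | skip => true
  | assign _ e => e.ok R A
  | write _ k e => k.ok R A && e.ok R A
  | seq p q => p.ok R A && q.ok R A
  | ite e p q => e.ok R A && (p.ok R A && q.ok R A)
  | rep x r p => !R.elem r && (!p.wr.elem x && p.ok R A)

/-- A bound on the number of steps when all loop bounds are at most the argument. -/
noncomputable def Cmd.steps : Cmd → Polynomial ℕ
  | skip => 1
  | assign _ e => (e.len + 1 : ℕ)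
  | write _ k e => (k.len + e.len + 1 : ℕ)
  | seq p q => p.steps + q.steps
  | ite e p q => (e.len + 1 : ℕ) + (p.steps + q.steps)
  | rep _ _ p => Polynomial.X * (p.steps + 5) + 5

/-- The word length after `t` steps that start with words of `b` bits, of which the constant ones
have `b₀` bits. -/
abbrev bits (b b₀ t : ℕ) : ℕ := b + t * (b₀ + 1)

theorem bits_mono {b b₀ t t' : ℕ} (h : t ≤ t') : bits b b₀ t ≤ bits b b₀ t' :=
  Nat.add_le_add_left (Nat.mul_le_mul_right _ h) _

/-- Hence a bound on these registers at the start still holds whenever an inner loop is reached. -/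
theorem Cmd.bounds_const {R A : List ℕ} (c : Cmd) (hok : c.ok R A = true) {r : ℕ}
    (hr : r ∈ c.bounds) : r ∉ R := by
  induction c with
  | skip | assign | write => simp [bounds] at hr
  | seq p q hp hq =>
    simp only [ok, Bool.and_eq_true] at hok
    exact (List.mem_append.1 hr).elim (hp hok.1) (hq hok.2)
  | ite e p q hp hq =>
    simp only [ok, Bool.and_eq_true] at hok
    exact (List.mem_append.1 hr).elim (hp hok.2.1) (hq hok.2.2)
  | rep x r' p hp =>
    simp only [ok, Bool.and_eq_true] at hok
    rcases List.mem_cons.1 hr with rfl | h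
    · simpa using hok.1
    · exact hp hok.2.2 h

theorem exec_loop {e : Term} {p : Prog} (f : ℕ → State) (N T C : ℕ) (hN : e.val (f N) = 0)
    (hC : 1 + e.cost (f N) ≤ C)
    (h : ∀ j < N, e.val (f j) ≠ 0 ∧ ∃ t, Exec p (f j) t (f (j + 1)) ∧ 1 + e.cost (f j) + t ≤ T) :
    ∃ t, Exec (.loop e p) (f 0) t (f N) ∧ t ≤ N * T + C := by
  induction N generalizing f with
  | zero => exact ⟨_, .loop_done hN, by omega⟩
  | succ N ih =>
    obtain ⟨h0, t, ht, hT⟩ := h 0 (Nat.succ_pos N)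
    obtain ⟨t', ht', hT'⟩ := ih (fun j => f (j + 1)) hN hC fun j hj => h (j + 1) (by omega)
    exact ⟨_, .loop_step h0 ht ht', by nlinarith⟩

/-- The running time of counting programs. -/
theorem Cmd.exec {R A : List ℕ} {V b₀ : ℕ} (c : Cmd) (hwr : ∀ x ∈ c.wr, x ∈ R)
    (hwa : ∀ x ∈ c.wa, x ∈ A) (hok : c.ok R A = true) {s : State} {b : ℕ} (hb : b₀ ≤ b)
    (hs : s.Lt b) (hs₀ : s.LtOn R A b₀) (hV : ∀ r ∈ c.bounds, s.reg r ≤ V) :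
    (c.eval s).Lt (bits b b₀ (c.steps.eval V)) ∧
    ∃ t, Exec c.toProg s t (c.eval s) ∧
      t ≤ c.steps.eval V * (2 * bits b b₀ (c.steps.eval V) + 2) := by
  induction c generalizing s b with
  | skip =>
    refine ⟨hs.mono (by simp [bits]), _, .skip s, ?_⟩
    simp [steps]
  | assign x e =>
    have hst : (assign x e).steps.eval V = e.len + 1 := by
      simp only [steps, Polynomial.eval_natCast, Nat.cast_id]
    rw [hst]
    have hm := bits_mono (b := b) (b₀ := b₀) (Nat.le_succ e.len)
    refine ⟨(hs.mono (by simp [bits])).setReg x ?_, _, .assign x e s, ?_⟩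
    · exact (e.val_lt hs hs₀ hok).trans_le (Nat.pow_le_pow_right two_pos hm)
    · have := e.cost_le hs hs₀ hok hm
      simp only [Nat.succ_eq_add_one] at this ⊢
      nlinarith
  | write a k e =>
    simp only [ok, Bool.and_eq_true] at hok
    have hst : (write a k e).steps.eval V = k.len + e.len + 1 := by
      simp only [steps, Polynomial.eval_natCast, Nat.cast_id]
    rw [hst]
    have hm := bits_mono (b := b) (b₀ := b₀) (show e.len ≤ k.len + e.len + 1 by omega)
    have hm' := bits_mono (b := b) (b₀ := b₀) (show k.len ≤ k.len + e.len + 1 by omega)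
    refine ⟨(hs.mono (by simp [bits])).setArr a _ ?_, _, .write a k e s, ?_⟩
    · exact (e.val_lt hs hs₀ hok.2).trans_le (Nat.pow_le_pow_right two_pos hm)
    · have h1 := e.cost_le hs hs₀ hok.2 hm
      have h2 := k.cost_le hs hs₀ hok.1 hm'
      nlinarith
  | seq p q hp hq =>
    simp only [ok, Bool.and_eq_true] at hok
    simp only [steps, Polynomial.eval_add]
    simp only [bounds, wr, wa, List.mem_append] at hV hwr hwa
    -- `R` and `A` stay fixed in the induction, so that what is constant for the whole program keeps
    -- its `b₀` bits after `p`.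
    have hA : Agree R A s (p.eval s) :=
      (p.agree s).mono (fun x h => hwr x (.inl h)) (fun x h => hwa x (.inl h))
    obtain ⟨h1, t, ht, htt⟩ := hp (fun x h => hwr x (.inl h)) (fun x h => hwa x (.inl h)) hok.1
      hb hs hs₀ fun r hr => hV r (.inl hr)
    obtain ⟨h2, t', ht', htt'⟩ := hq (fun x h => hwr x (.inr h)) (fun x h => hwa x (.inr h)) hok.2
      (b := bits b b₀ (p.steps.eval V)) (by simp only [bits]; omega) h1 (hs₀.agree hA)
      fun r hr => (hA.1 r (q.bounds_const hok.2 hr)).trans_le (hV r (.inr hr))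
    have hbb : bits (bits b b₀ (p.steps.eval V)) b₀ (q.steps.eval V) =
      bits b b₀ (p.steps.eval V + q.steps.eval V) := by simp only [bits]; ring
    rw [hbb] at h2 htt'
    refine ⟨h2, _, .seq ht ht', ?_⟩
    have := bits_mono (b := b) (b₀ := b₀) (Nat.le_add_right (p.steps.eval V) (q.steps.eval V))
    nlinarith
  | ite e p q hp hq =>
    simp only [ok, Bool.and_eq_true] at hok
    simp only [steps, Polynomial.eval_add, Polynomial.eval_natCast, Nat.cast_id]
    simp only [bounds, wr, wa, List.mem_append] at hV hwr hwa
    have hm := bits_mono (b := b) (b₀ := b₀)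
      (show e.len ≤ e.len + 1 + (p.steps.eval V + q.steps.eval V) by omega)
    have hc := e.cost_le hs hs₀ hok.1 hm
    by_cases he : e.val s = 0
    · obtain ⟨h1, t, ht, htt⟩ := hq (fun x h => hwr x (.inr h)) (fun x h => hwa x (.inr h))
        hok.2.2 hb hs hs₀ fun r hr => hV r (.inr hr)
      have hm' := bits_mono (b := b) (b₀ := b₀)
        (show q.steps.eval V ≤ e.len + 1 + (p.steps.eval V + q.steps.eval V) by omega)
      have hev : (ite e p q).eval s = q.eval s := if_pos he
      rw [hev]
      refine ⟨h1.mono hm', _, .ite_false he ht, ?_⟩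
      have htt' := htt.trans (Nat.mul_le_mul_left _ (Nat.add_le_add_right (Nat.mul_le_mul_left 2 hm') 2))
      revert hc htt'
      generalize bits b b₀ (e.len + 1 + (p.steps.eval V + q.steps.eval V)) = β
      intro hc htt'
      nlinarith [Nat.zero_le (p.steps.eval V * (2 * β + 2))]
    · obtain ⟨h1, t, ht, htt⟩ := hp (fun x h => hwr x (.inl h)) (fun x h => hwa x (.inl h))
        hok.2.1 hb hs hs₀ fun r hr => hV r (.inl hr)
      have hm' := bits_mono (b := b) (b₀ := b₀)
        (show p.steps.eval V ≤ e.len + 1 + (p.steps.eval V + q.steps.eval V) by omega)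
      have hev : (ite e p q).eval s = p.eval s := if_neg he
      rw [hev]
      refine ⟨h1.mono hm', _, .ite_true he ht, ?_⟩
      have htt' := htt.trans (Nat.mul_le_mul_left _ (Nat.add_le_add_right (Nat.mul_le_mul_left 2 hm') 2))
      revert hc htt'
      generalize bits b b₀ (e.len + 1 + (p.steps.eval V + q.steps.eval V)) = β
      intro hc htt'
      nlinarith [Nat.zero_le (q.steps.eval V * (2 * β + 2))]
  | rep x r p hp =>
    simp only [ok, Bool.and_eq_true] at hok
    obtain ⟨hr, hx, hok⟩ := hok
    replace hr : r ∉ R := by simpa using hr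
    replace hx : x ∉ p.wr := by simpa using hx
    have hst : (rep x r p).steps.eval V = V * (p.steps.eval V + 5) + 5 := by
      simp [steps]
    rw [hst]
    set S := p.steps.eval V with hS
    have hN : s.reg r ≤ V := hV r (by simp [bounds])
    have hbody : ∀ s', Agree R A s' (p.eval s') := fun s' =>
      (p.agree s').mono (fun y h => hwr y (by simp [wr, h])) (fun y h => hwa y h)
    have hxR : x ∈ R := hwr x (by simp [wr])
    set f := rounds x p.eval s with hf
    have hA : ∀ j, Agree R A s (f j) := agree_rounds hxR hbody s
    have hfr : ∀ j, (f j).reg r = s.reg r := fun j => (hA j).1 r hr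
    have hfx : ∀ j, (f j).reg x = j := rounds_counter x p.eval s
    have key : ∀ j, (f j).Lt (bits b b₀ (j * (S + 5))) →
        (p.eval (f j)).Lt (bits b b₀ (j * (S + 5) + S)) ∧ ∃ t, Exec p.toProg (f j) t (p.eval (f j)) ∧
          t ≤ S * (2 * bits b b₀ (j * (S + 5) + S) + 2) := by
      intro j hj
      have := hp (fun y h => hwr y (by simp [wr, h])) (fun y h => hwa y h) hok
        (b := bits b b₀ (j * (S + 5))) (by simp only [bits]; omega) hj (hs₀.agree (hA j))
        fun r' hr' => ((hA j).1 r' (p.bounds_const hok hr')).trans_le (hV r' (by simp [bounds, hr']))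
      have hbb : bits (bits b b₀ (j * (S + 5))) b₀ S = bits b b₀ (j * (S + 5) + S) := by
        simp only [bits]; ring
      rwa [hbb] at this
    -- Each round is charged the `S` steps of the body and 5 more, which leave room for the test and
    -- the increment of the counter.
    have hLt : ∀ j, (f j).Lt (bits b b₀ (j * (S + 5))) := by
      intro j
      induction j with
      | zero =>
        refine (hs.mono (by simp [bits])).setReg x (Nat.two_pow_pos _)
      | succ j ih =>
        have h1 := (key j ih).1
        have h2 : bits b b₀ (j * (S + 5) + S) + 1 ≤ bits b b₀ ((j + 1) * (S + 5)) := by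
          simp only [bits]; nlinarith
        refine (h1.mono (by omega)).setReg x ?_
        have h3 := ih.1 x
        rw [hfx] at h3
        have h4 : bits b b₀ (j * (S + 5)) + 1 ≤ bits b b₀ ((j + 1) * (S + 5)) := by
          simp only [bits]; nlinarith
        refine lt_of_lt_of_le ?_ (Nat.pow_le_pow_right two_pos h4)
        rw [pow_succ]
        have := Nat.one_le_two_pow (n := bits b b₀ (j * (S + 5)))
        omega
    set β := bits b b₀ (V * (S + 5) + 5) with hβ
    have hle : ∀ j ≤ s.reg r, bits b b₀ (j * (S + 5)) ≤ β := fun j hj =>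
      bits_mono ((Nat.mul_le_mul_right _ (hj.trans hN)).trans (by omega))
    have hcost : ∀ j ≤ s.reg r,
        (Term.sub (.reg r) (.reg x)).cost (f j) ≤ 3 + 4 * β ∧ ((f j).reg x).size ≤ β := by
      intro j hj
      have h1 := size_le_of_lt (((hLt j).mono (hle j hj)).1 x)
      have h2 := size_le_of_lt (((hLt j).mono (hle j hj)).1 r)
      simp only [Term.cost, Term.val]
      omega
    obtain ⟨t, ht, htt⟩ := exec_loop (e := .sub (.reg r) (.reg x))
      (p := .seq p.toProg (.assign x (.add (.reg x) (.lit 1)))) f (s.reg r)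
      ((S + 5) * (2 * β + 2)) (4 + 4 * β) (by simp [Term.val, hfr, hfx])
      (by have := (hcost _ le_rfl).1; omega) (by
        intro j hj
        refine ⟨by simp only [Term.val, hfr, hfx]; omega, ?_⟩
        obtain ⟨-, t, ht, htt⟩ := key j (hLt j)
        have hx' : (p.eval (f j)).reg x = j := by rw [p.eval_reg _ hx, hfx]
        have hstep : f (j + 1) = (p.eval (f j)).setReg x
            ((Term.add (.reg x) (.lit 1)).val (p.eval (f j))) := by
          simp only [Term.val, hx']; rfl
        refine ⟨_, hstep ▸ Exec.seq ht (.assign x _ _), ?_⟩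
        obtain ⟨h1, h2⟩ := hcost j hj.le
        rw [hfx] at h2
        have h3 : bits b b₀ (j * (S + 5) + S) ≤ β := by
          refine bits_mono ?_
          have := Nat.mul_le_mul_right (S + 5) (show j + 1 ≤ V by omega)
          nlinarith
        have h4 : t ≤ S * (2 * β + 2) := htt.trans (Nat.mul_le_mul_left _ (by omega))
        have h5 : Nat.size 1 = 1 := Nat.size_one
        simp only [Term.cost, Term.val, hx'] at h1 ⊢
        nlinarith)
    refine ⟨(hLt _).mono (hle _ le_rfl), _, .seq (.assign x (.lit 0) s) ht, ?_⟩
    have h6 := Nat.mul_le_mul_right ((S + 5) * (2 * β + 2)) hN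
    have h7 : Nat.size 0 = 0 := Nat.size_zero
    simp only [Term.cost]
    nlinarith

/-- The running time of a counting program on its own. -/
theorem Cmd.exec_self (c : Cmd) (hok : c.ok c.wr c.wa = true) {s : State} {b V : ℕ} (hs : s.Lt b)
    (hV : ∀ r ∈ c.bounds, s.reg r ≤ V) :
    (c.eval s).Lt (bits b b (c.steps.eval V)) ∧
    ∃ t, Exec c.toProg s t (c.eval s) ∧
      t ≤ c.steps.eval V * (2 * bits b b (c.steps.eval V) + 2) :=
  c.exec (fun _ h => h) (fun _ h => h) hok le_rfl hs (hs.ltOn _ _) hV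

end RAM

namespace FairAuction

open Finset

/-! ### Loads and their rounding -/

/-- The total size of those goods `h < m` that `X` gives to agent `i`. -/
def load (W : ℕ → ℕ) (m : ℕ) (X : ℕ → ℕ) (i : ℕ) : ℕ := ∑ h ∈ range m, if X h = i then W h else 0

theorem load_succ (W : ℕ → ℕ) (m : ℕ) (X : ℕ → ℕ) (i : ℕ) :
    load W (m + 1) X i = load W m X i + if X m = i then W m else 0 := sum_range_succ _ _

theorem load_congr {W W' X X' : ℕ → ℕ} {m : ℕ} (i : ℕ) (hX : ∀ h < m, X h = X' h)
    (hW : ∀ h < m, X h = i → W h = W' h) : load W m X i = load W' m X' i := by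
  refine sum_congr rfl fun h hh => ?_
  rw [mem_range] at hh
  rw [← hX h hh]
  split
  · exact hW h hh ‹_›
  · rfl

theorem load_mono {W W' X : ℕ → ℕ} {m i : ℕ} (hW : ∀ h < m, X h = i → W h ≤ W' h) :
    load W m X i ≤ load W' m X i := by
  refine sum_le_sum fun h hh => ?_
  split
  · exact hW h (mem_range.1 hh) ‹_›
  · rfl

theorem load_mul (c : ℕ) (W X : ℕ → ℕ) (m i : ℕ) :
    load (fun h => c * W h) m X i = c * load W m X i := by
  simp [load, mul_sum]

theorem load_add (W W' X : ℕ → ℕ) (m i : ℕ) :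
    load (fun h => W h + W' h) m X i = load W m X i + load W' m X i := by
  rw [load, load, load, ← sum_add_distrib]
  exact sum_congr rfl fun h _ => by split <;> simp

theorem load_le_succ (W X : ℕ → ℕ) {m m' : ℕ} (h : m ≤ m') (i : ℕ) :
    load W m X i ≤ load W m' X i :=
  sum_le_sum_of_subset (range_mono h)

theorem le_load {W X : ℕ → ℕ} {m h : ℕ} (hh : h < m) : W h ≤ load W m X (X h) := by
  have := single_le_sum (f := fun g => if X g = X h then W g else 0) (fun _ _ => Nat.zero_le _)
    (mem_range.2 hh)
  simpa [load] using this

theorem load_eq_zero {W X : ℕ → ℕ} {m i : ℕ} :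
    load W m X i = 0 ↔ ∀ h < m, X h = i → W h = 0 := by
  simp [load]

theorem sum_load {W X : ℕ → ℕ} {m n : ℕ} (hX : ∀ h < m, X h < n) :
    ∑ i ∈ range n, load W m X i = ∑ h ∈ range m, W h := by
  simp only [load]
  rw [sum_comm]
  refine sum_congr rfl fun h hh => ?_
  rw [sum_ite_eq, if_pos (mem_range.2 (hX h (mem_range.1 hh)))]

/-- Weights in units of `a / K ^ 2`, with `0` for weights below `a / K` and a common value for
weights above `4 * a`. -/
def rounded (K a w : ℕ) : ℕ :=
  if w * (K * K) / a < K then 0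
  else if 4 * (K * K) < w * (K * K) / a then 4 * (K * K) + 1 else w * (K * K) / a

theorem rounded_le (K a w : ℕ) : rounded K a w ≤ 4 * (K * K) + 1 := by
  unfold rounded; split_ifs <;> omega

theorem mul_rounded_le (K a w : ℕ) : a * rounded K a w ≤ K * K * w := by
  have h := Nat.mul_div_le (w * (K * K)) a
  rw [mul_comm w] at h
  unfold rounded
  rw [mul_comm w]
  split_ifs with h1 h2
  · simp
  · exact (Nat.mul_le_mul_left a h2).trans h
  · exact h

theorem mul_lt_of_rounded_eq_zero {K a w : ℕ} (ha : 0 < a) (hK : 0 < K)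
    (h : rounded K a w = 0) : K * w < a := by
  unfold rounded at h
  split_ifs at h with h1 h2
  · rw [Nat.div_lt_iff_lt_mul ha] at h1
    nlinarith
  · omega

/-- Rounding down loses less than one unit, and a weight of nonzero rounded size has at least `K`
units; the relative loss is at most `1 / K`. -/
theorem mul_le_of_rounded {K a w : ℕ} (ha : 0 < a) (h0 : rounded K a w ≠ 0)
    (h : rounded K a w ≤ 4 * (K * K)) :
    K * (K * K) * w ≤ (K + 1) * (a * rounded K a w) := by
  unfold rounded at h0 h ⊢
  split_ifs at h0 h ⊢ with h1 h2
  · simp at h0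
  · omega
  · have := Nat.lt_mul_div_succ (w * (K * K)) ha
    set q := w * (K * K) / a
    have h3 : K * (w * (K * K)) ≤ K * (a * (q + 1)) := Nat.mul_le_mul_left _ this.le
    have h4 : a * K ≤ a * q := Nat.mul_le_mul_left _ (by omega)
    nlinarith

theorem lt_of_rounded {K a w : ℕ} (hK : 0 < K) (h : rounded K a w = 4 * (K * K) + 1) :
    4 * a ≤ w := by
  have := mul_rounded_le K a w
  rw [h] at this
  have h2 : 0 < K * K := by positivity
  by_contra hlt
  have : K * K * w ≤ K * K * (4 * a) := Nat.mul_le_mul_left _ (by omega)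
  have h3 : 0 < a := by omega
  nlinarith

/-! ### Admissible allocations and their codes -/

/-- Good `g` may be added to the goods `h < g`: its rounded size is zero, or it is the first one of
its bundle, or the rounded load stays within `L`. -/
def Fits (ρ : ℕ → ℕ) (L : ℕ) (X : ℕ → ℕ) (g : ℕ) : Prop :=
  load ρ g X (X g) = 0 ∨ ρ g = 0 ∨ load ρ g X (X g) + ρ g ≤ L

/-- The goods `h < g` can be allocated one by one according to `X`. -/
def Valid (ρ : ℕ → ℕ) (L n : ℕ) (X : ℕ → ℕ) (g : ℕ) : Prop := ∀ h < g, X h < n ∧ Fits ρ L X h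

/-- The number whose digits in base `n + 1` are the numbers of agents of each rounded load. -/
def code (ρ : ℕ → ℕ) (n : ℕ) (X : ℕ → ℕ) (g : ℕ) : ℕ := ∑ i ∈ range n, (n + 1) ^ load ρ g X i

theorem Valid.succ {ρ : ℕ → ℕ} {L n g : ℕ} {X : ℕ → ℕ} :
    Valid ρ L n X (g + 1) ↔ Valid ρ L n X g ∧ X g < n ∧ Fits ρ L X g := by
  simp only [Valid, Nat.lt_succ_iff_lt_or_eq]
  constructor
  · exact fun h => ⟨fun k hk => h k (.inl hk), h g (.inr rfl)⟩
  · rintro ⟨h, h'⟩ k (hk | rfl)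
    · exact h k hk
    · exact h'

theorem Valid.congr {ρ : ℕ → ℕ} {L n g : ℕ} {X X' : ℕ → ℕ} (h : Valid ρ L n X g)
    (hX : ∀ h < g, X h = X' h) : Valid ρ L n X' g := by
  intro k hk
  obtain ⟨h1, h2⟩ := h k hk
  rw [← hX k hk]
  refine ⟨h1, ?_⟩
  unfold Fits at h2 ⊢
  rwa [← hX k hk, ← load_congr (X := X) _ (fun h hh => hX h (hh.trans hk)) fun _ _ _ => rfl]

theorem code_congr {ρ : ℕ → ℕ} {n g : ℕ} {X X' : ℕ → ℕ} (hX : ∀ h < g, X h = X' h) :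
    code ρ n X g = code ρ n X' g :=
  sum_congr rfl fun i _ => by rw [load_congr i hX fun _ _ _ => rfl]

/-- In an admissible allocation, a rounded load above `L` comes from a single good. -/
theorem Valid.load_le_or {ρ : ℕ → ℕ} {L n g : ℕ} {X : ℕ → ℕ} (hρ : ∀ h < g, ρ h ≤ L + 1)
    (hX : Valid ρ L n X g) (i : ℕ) :
    load ρ g X i ≤ L ∨ load ρ g X i = L + 1 ∧ ∃ h < g, X h = i ∧ ρ h = L + 1 ∧
      ∀ h' < g, X h' = i → h' ≠ h → ρ h' = 0 := by
  induction g with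
  | zero => simp [load]
  | succ g ih =>
    obtain ⟨hV, -, hF⟩ := Valid.succ.1 hX
    replace ih := ih fun h hh => hρ h (Nat.lt_succ_of_lt hh)
    rw [load_succ]
    rcases eq_or_ne (X g) i with hgi | hgi
    · subst hgi
      rw [if_pos rfl]
      rcases Nat.eq_zero_or_pos (load ρ g X (X g)) with h0 | h0
      · rw [h0, zero_add]
        rcases (hρ g (Nat.lt_succ_self g)).lt_or_eq with h1 | h1
        · left; omega
        · refine .inr ⟨h1, g, Nat.lt_succ_self g, rfl, h1, fun h' hh' hX' hne => ?_⟩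
          exact load_eq_zero.1 h0 h' (by omega) hX'
      rcases hF with hF | hF | hF
      · omega
      · rw [hF, add_zero]
        refine (ih hV).imp id ?_
        rintro ⟨h1, h, hh, hXh, hρh, hall⟩
        refine ⟨h1, h, by omega, hXh, hρh, fun h' hh' hX' hne => ?_⟩
        rcases Nat.lt_succ_iff_lt_or_eq.1 hh' with h2 | rfl
        · exact hall h' h2 hX' hne
        · exact hF
      · left; exact hF
    · rw [if_neg hgi, add_zero]
      refine (ih hV).imp id ?_
      rintro ⟨h1, h, hh, hXh, hρh, hall⟩
      refine ⟨h1, h, by omega, hXh, hρh, fun h' hh' hX' hne => ?_⟩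
      rcases Nat.lt_succ_iff_lt_or_eq.1 hh' with h2 | rfl
      · exact hall h' h2 hX' hne
      · exact absurd hX' hgi

theorem Valid.load_le {ρ : ℕ → ℕ} {L n g : ℕ} {X : ℕ → ℕ} (hρ : ∀ h < g, ρ h ≤ L + 1)
    (hX : Valid ρ L n X g) (i : ℕ) : load ρ g X i ≤ L + 1 := by
  rcases hX.load_le_or hρ i with h | h <;> omega

/-- This is the length of the table: each of the `n` agents contributes at most `(n + 1) ^ (L + 1)`.
-/
theorem Valid.code_lt {ρ : ℕ → ℕ} {L n g : ℕ} {X : ℕ → ℕ} (hρ : ∀ h < g, ρ h ≤ L + 1)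
    (hX : Valid ρ L n X g) : code ρ n X g < (n + 1) ^ (L + 2) := by
  calc code ρ n X g ≤ ∑ i ∈ range n, (n + 1) ^ (L + 1) :=
        sum_le_sum fun i _ => Nat.pow_le_pow_right (Nat.succ_pos n) (hX.load_le hρ i)
    _ = n * (n + 1) ^ (L + 1) := by simp
    _ < (n + 1) ^ (L + 2) := by
        rw [pow_succ (n + 1) (L + 1), mul_comm n]
        exact Nat.mul_lt_mul_of_pos_left (Nat.lt_succ_self n) (by positivity)

/-- Only the summand of the receiver changes. The additive form avoids truncated subtraction. -/
theorem code_succ {ρ : ℕ → ℕ} {n g : ℕ} {X : ℕ → ℕ} (hX : X g < n) :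
    code ρ n X (g + 1) + (n + 1) ^ load ρ g X (X g) =
      code ρ n X g + (n + 1) ^ (load ρ g X (X g) + ρ g) := by
  unfold code
  have hm := mem_range.2 hX
  rw [← add_sum_erase _ _ hm, ← add_sum_erase _ (fun i => (n + 1) ^ load ρ g X i) hm, load_succ,
    if_pos rfl]
  have : ∑ x ∈ (range n).erase (X g), (n + 1) ^ load ρ (g + 1) X x =
      ∑ x ∈ (range n).erase (X g), (n + 1) ^ load ρ g X x :=
    sum_congr rfl fun i hi => by rw [load_succ, if_neg (ne_of_mem_erase hi).symm, add_zero]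
  rw [this]
  ring

theorem digits_unique {B : ℕ} (c d : ℕ → ℕ) (hc : ∀ k, c k < B) (hd : ∀ k, d k < B) (M : ℕ)
    (h : ∑ k ∈ range M, c k * B ^ k = ∑ k ∈ range M, d k * B ^ k) : ∀ k < M, c k = d k := by
  induction M generalizing c d with
  | zero => simp
  | succ M ih =>
    have expand : ∀ f : ℕ → ℕ, ∑ k ∈ range (M + 1), f k * B ^ k =
        f 0 + B * ∑ k ∈ range M, f (k + 1) * B ^ k := by
      intro f
      rw [sum_range_succ', mul_sum, pow_zero, mul_one, add_comm]
      congr 1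
      exact sum_congr rfl fun k _ => by ring
    rw [expand c, expand d] at h
    have h0 : c 0 = d 0 := by
      have := congrArg (· % B) h
      simpa [Nat.add_mul_mod_self_left, Nat.mod_eq_of_lt (hc 0), Nat.mod_eq_of_lt (hd 0)] using this
    have hB : 0 < B := (Nat.zero_le _).trans_lt (hc 0)
    have h1 := ih (fun k => c (k + 1)) (fun k => d (k + 1)) (fun k => hc _) (fun k => hd _)
      (Nat.eq_of_mul_eq_mul_left hB (by omega))
    rintro (_ | k) hk
    · exact h0
    · exact h1 k (by omega)

/-- Sums of powers determine the exponents up to a permutation. -/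
theorem exists_perm_of_sum_pow_eq {n : ℕ} (r r' : Fin n → ℕ)
    (h : ∑ i, (n + 1) ^ r i = ∑ i, (n + 1) ^ r' i) : ∃ σ : Equiv.Perm (Fin n), ∀ i, r' (σ i) = r i := by
  classical
  obtain ⟨M, hM⟩ : ∃ M, ∀ i, r i < M ∧ r' i < M :=
    ⟨∑ i, (r i + r' i) + 1, fun i => by
      have := single_le_sum (f := fun i => r i + r' i) (fun _ _ => Nat.zero_le _) (mem_univ i)
      omega⟩
  -- Grouping equal exponents writes the sum in base `n + 1`; the multiplicities are at most `n` and
  -- hence digits.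
  have count : ∀ f : Fin n → ℕ, (∀ i, f i < M) →
      ∑ i, (n + 1) ^ f i = ∑ k ∈ range M, #{i | f i = k} * (n + 1) ^ k := by
    intro f hf
    rw [← sum_fiberwise_of_maps_to (t := range M) (g := f) fun i _ => mem_range.2 (hf i)]
    refine sum_congr rfl fun k _ => ?_
    rw [← smul_eq_mul, ← sum_const]
    exact sum_congr rfl fun i hi => by rw [(mem_filter.1 hi).2]
  rw [count r fun i => (hM i).1, count r' fun i => (hM i).2] at h
  have hlt : ∀ f : Fin n → ℕ, ∀ k, #{i | f i = k} < n + 1 := fun f k =>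
    Nat.lt_succ_of_le ((card_le_univ _).trans_eq (Fintype.card_fin n))
  have hk := digits_unique _ _ (hlt r) (hlt r') M h
  have hcard : ∀ k, #{i | r i = k} = #{i | r' i = k} := by
    intro k
    by_cases hkM : k < M
    · exact hk k hkM
    · rw [filter_false_of_mem, filter_false_of_mem]
      · rintro i - rfl; exact hkM (hM i).2
      · rintro i - rfl; exact hkM (hM i).1
  have e : ∀ k, Nonempty ({i // r i = k} ≃ {i // r' i = k}) := fun k =>
    Fintype.card_eq.1 (by rw [Fintype.card_subtype, Fintype.card_subtype]; exact hcard k)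
  have e := fun k => (e k).some
  refine ⟨(Equiv.sigmaFiberEquiv r).symm.trans
    ((Equiv.sigmaCongrRight e).trans (Equiv.sigmaFiberEquiv r')), fun i => ?_⟩
  exact (e (r i) ⟨i, rfl⟩).2

theorem exists_perm_of_code_eq {ρ : ℕ → ℕ} {n g : ℕ} {T X : ℕ → ℕ}
    (h : code ρ n X g = code ρ n T g) :
    ∃ σ : Equiv.Perm (Fin n), ∀ i, load ρ g X (σ i) = load ρ g T i := by
  refine exists_perm_of_sum_pow_eq (fun i => load ρ g T i) (fun i => load ρ g X i) ?_
  rw [Fin.sum_univ_eq_sum_range fun i => (n + 1) ^ load ρ g T i,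
    Fin.sum_univ_eq_sum_range fun i => (n + 1) ^ load ρ g X i]
  exact h.symm

/-- Allocations of the same code have extensions of the same code. -/
theorem exists_extension {ρ : ℕ → ℕ} {L n g : ℕ} {T X : ℕ → ℕ}
    (hT : Valid ρ L n T (g + 1)) (h : code ρ n X g = code ρ n T g) :
    ∃ i < n, (load ρ g X i = 0 ∨ ρ g = 0 ∨ load ρ g X i + ρ g ≤ L) ∧
      code ρ n X g + (n + 1) ^ (load ρ g X i + ρ g) - (n + 1) ^ load ρ g X i =
        code ρ n T (g + 1) := by
  obtain ⟨-, hlt, hF⟩ := Valid.succ.1 hT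
  obtain ⟨σ, hσ⟩ := exists_perm_of_code_eq h
  have : load ρ g X (σ ⟨T g, hlt⟩) = load ρ g T (T g) := hσ ⟨T g, hlt⟩
  -- The agent that the permutation matches with the receiver of `g` in `T` has the same rounded
  -- load, so it can take `g` with the same effect on the code.
  refine ⟨σ ⟨T g, hlt⟩, (σ ⟨T g, hlt⟩).2, ?_, ?_⟩
  · rw [this]; exact hF
  · rw [this, h]
    have := code_succ (ρ := ρ) hlt
    omega

/-- Adding good `g` to the bundle of agent `i`. -/
theorem extension_spec {ρ : ℕ → ℕ} {L n g i : ℕ} {X X' : ℕ → ℕ} (hX : Valid ρ L n X g)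
    (hi : i < n) (hF : load ρ g X i = 0 ∨ ρ g = 0 ∨ load ρ g X i + ρ g ≤ L)
    (hX' : ∀ h < g, X h = X' h) (hg : X' g = i) :
    Valid ρ L n X' (g + 1) ∧
      code ρ n X g + (n + 1) ^ (load ρ g X i + ρ g) - (n + 1) ^ load ρ g X i =
        code ρ n X' (g + 1) := by
  have hl := load_congr (W := ρ) i hX' fun _ _ _ => rfl
  subst hg
  refine ⟨Valid.succ.2 ⟨hX.congr hX', hi, ?_⟩, ?_⟩
  · unfold Fits; rwa [← hl]
  · have := code_succ (ρ := ρ) hi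
    rw [hl, code_congr hX']
    omega

end FairAuction

namespace FairAuction

open Finset

/-! ### The approximation guarantee -/

/-- The product of the loads. -/
def value (W : ℕ → ℕ) (n m : ℕ) (X : ℕ → ℕ) : ℕ := ∏ i ∈ range n, load W m X i

/-- The weights of the goods of nonzero rounded size. -/
def large (ρ W : ℕ → ℕ) (h : ℕ) : ℕ := if ρ h = 0 then 0 else W h

/-- The weights of the goods of rounded size zero. -/
def small (ρ W : ℕ → ℕ) (h : ℕ) : ℕ := if ρ h = 0 then W h else 0

theorem load_large_add_small (ρ W : ℕ → ℕ) (m : ℕ) (X : ℕ → ℕ) (i : ℕ) :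
    load (large ρ W) m X i + load (small ρ W) m X i = load W m X i := by
  rw [← load_add]
  congr 1
  funext h
  unfold large small
  split <;> simp

/-- `Y` arises from `X` by greedily reallocating the goods of rounded size zero, each of which has
weight at most `a / K`: the bundles that receive such goods are hardly larger than any other. -/
structure Completes (K a : ℕ) (ρ W : ℕ → ℕ) (n m : ℕ) (X Y : ℕ → ℕ) : Prop where
  lt : ∀ h < m, Y h < n
  eq_large : ∀ h < m, ρ h ≠ 0 → Y h = X h
  greedy : ∀ i < n, load (small ρ W) m Y i = 0 ∨ ∀ j < n,
    K * load W m Y i ≤ K * load W m Y j + a ∧ load (large ρ W) m X i ≤ load W m Y j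

theorem Completes.load_large {K a : ℕ} {ρ W : ℕ → ℕ} {n m : ℕ} {X Y : ℕ → ℕ}
    (h : Completes K a ρ W n m X Y) (i : ℕ) :
    load (large ρ W) m Y i = load (large ρ W) m X i := by
  refine sum_congr rfl fun g hg => ?_
  by_cases hρ : ρ g = 0
  · simp [large, hρ]
  · rw [h.eq_large g (mem_range.1 hg) hρ]

/-- Here `p` are the loads of large goods, `s` the small loads to compare with, and `s'` those of
the greedy completion. Greedy recipients end within `a / K` of the least load `lam`, so the two
distributions of the same total `S` contribute to the sum of ratios at most `S / lam - S / (lam + a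
/ K)` beyond `n`. This is small once `lam` is bounded below by a multiple of `a`. -/
theorem prod_le_of_greedy {n : ℕ} {K a ℓ : ℝ} (p s s' : Fin n → ℝ) (hK : 4 ≤ K) (ha : 0 < a)
    (hℓ : a ≤ ℓ) (hp : ∀ i, 0 ≤ p i) (hs : ∀ i, 0 ≤ s i) (hs' : ∀ i, 0 ≤ s' i)
    (hlow : ∀ i, K * ℓ ≤ (K + 1) * (p i + s i)) (hsum : ∑ i, s i = ∑ i, s' i)
    (hsa : ∀ i, s i ≤ 4 * a)
    (hgreedy : ∀ i, s' i = 0 ∨ ∀ j, K * (p i + s' i) ≤ K * (p j + s' j) + a ∧ p i ≤ p j + s' j) :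
    ∏ i, (p i + s i) ≤ (1 + 16 / K) ^ n * ∏ i, (p i + s' i) := by
  rcases Nat.eq_zero_or_pos n with rfl | hn
  · simp
  have : Nonempty (Fin n) := ⟨⟨0, hn⟩⟩
  have hK0 : 0 < K := by linarith
  obtain ⟨i₀, hi₀⟩ := Finite.exists_min fun i => p i + s' i
  set lam := p i₀ + s' i₀ with hlam
  -- `J` contains all agents who receive small goods greedily, since such agents have `p i` at most
  -- every final load.
  set J : Finset (Fin n) := {i | p i ≤ lam}
  have hi₀J : i₀ ∈ J := by simp [J, hlam, hs' i₀]
  have hx : ∀ i ∈ J, p i + s' i ≤ lam + a / K := by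
    intro i hi
    rcases hgreedy i with h | h
    · rw [h, add_zero]
      exact (mem_filter.1 hi).2.trans (by have := div_pos ha hK0; linarith)
    · have := (h i₀).1
      rw [← sub_nonneg] at this ⊢
      have h2 : lam + a / K - (p i + s' i) = (K * lam + a - K * (p i + s' i)) / K := by
        field_simp
      rw [h2]
      exact div_nonneg this hK0.le
  have hJsum : ∑ i ∈ J, (p i + s i) ≤ ∑ i ∈ J, (lam + a / K) := by
    have h1 : ∑ i ∈ J, s i ≤ ∑ i, s i :=
      sum_le_sum_of_subset_of_nonneg (subset_univ _) fun i _ _ => hs i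
    have h2 : ∑ i, s' i = ∑ i ∈ J, s' i := by
      symm
      refine sum_subset (subset_univ _) fun i _ hi => ?_
      rcases hgreedy i with h | h
      · exact h
      · exact absurd (h i₀).2 (by simpa [J] using hi)
    have h3 : ∑ i ∈ J, (p i + s' i) ≤ ∑ i ∈ J, (lam + a / K) := sum_le_sum hx
    rw [sum_add_distrib] at h3 ⊢
    linarith
  -- On `J` the greedy completion has at least the total load of its competitor, so some competing
  -- load is at most `lam + a / K`. As competing loads are nearly at least `ℓ ≥ a`, this gives `lam
  -- ≥ a / 2`.
  obtain ⟨i₁, -, hi₁⟩ := exists_le_of_sum_le ⟨i₀, hi₀J⟩ hJsum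
  have hhalf : a / 2 ≤ lam := by
    have h1 := hlow i₁
    have h2 : K * a ≤ (K + 1) * (lam + a / K) :=
      (mul_le_mul_of_nonneg_left hℓ hK0.le).trans
        (h1.trans (mul_le_mul_of_nonneg_left hi₁ (by linarith)))
    have h3 : a / K ≤ a / 4 := div_le_div_of_nonneg_left ha.le (by norm_num) hK
    have h4 : (K + 1) * (a / K) ≤ a + a / 4 := by
      have : (K + 1) * (a / K) = a + a / K := by field_simp
      linarith
    by_contra hlt
    push Not at hlt
    nlinarith
  have hlam0 : 0 < lam := by linarith
  have hpos : ∀ i, 0 < p i + s' i := fun i => hlam0.trans_le (hi₀ i)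
  have hratio : ∑ i, (p i + s i) / (p i + s' i) ≤ n * (1 + 16 / K) := by
    -- Denominators are bounded below by `lam` for the gain `s i`, and above by `lam + a / K` for
    -- the loss `s' i`, which vanishes unless `i` is a greedy recipient.
    have h1 : ∀ i, (p i + s i) / (p i + s' i) ≤ 1 + (s i / lam - s' i / (lam + a / K)) := by
      intro i
      have e : (p i + s i) / (p i + s' i) = 1 + (s i / (p i + s' i) - s' i / (p i + s' i)) := by
        have := (hpos i).ne'
        field_simp
        ring
      rw [e]
      have h2 : s i / (p i + s' i) ≤ s i / lam := div_le_div_of_nonneg_left (hs i) hlam0 (hi₀ i)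
      have h3 : s' i / (lam + a / K) ≤ s' i / (p i + s' i) := by
        rcases hgreedy i with h | h
        · simp [h]
        · exact div_le_div_of_nonneg_left (hs' i) (hpos i)
            (hx i (mem_filter.2 ⟨mem_univ i, (h i₀).2⟩))
      linarith
    refine (sum_le_sum fun i _ => h1 i).trans ?_
    rw [sum_add_distrib, sum_sub_distrib, ← sum_div, ← sum_div, ← hsum]
    have hS : ∑ i, s i ≤ n * (4 * a) := by
      simpa using sum_le_sum fun i (_ : i ∈ univ) => hsa i
    have hS0 : 0 ≤ ∑ i, s i := sum_nonneg fun i _ => hs i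
    set S := ∑ i, s i
    have h5 : S / lam - S / (lam + a / K) ≤ n * (16 / K) := by
      have hak : 0 < a / K := div_pos ha hK0
      have e : S / lam - S / (lam + a / K) = S * (a / K) / (lam * (lam + a / K)) := by
        field_simp
        ring
      rw [e, div_le_iff₀ (by positivity)]
      -- The constant 16 is `4` from `s i ≤ 4 * a`, divided by `(1 / 2) ^ 2` from `a / 2 ≤ lam`.
      calc S * (a / K) ≤ n * (4 * a) * (a / K) := by gcongr
        _ = n * (16 / K) * (a / 2 * (a / 2)) := by field_simp; ring
        _ ≤ n * (16 / K) * (lam * (lam + a / K)) := by gcongr; linarith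
    simp only [sum_const, card_univ, Fintype.card_fin, nsmul_eq_mul]
    linarith
  have hprod : ∏ i, ((p i + s i) / (p i + s' i)) ≤ (1 + 16 / K) ^ n := by
    have hn0 : (0 : ℝ) < n := by exact_mod_cast hn
    -- The bound on the mean of the ratios becomes a bound on their product.
    have := Real.geom_mean_le_arith_mean_weighted univ (fun _ => 1 / (n : ℝ))
      (fun i => (p i + s i) / (p i + s' i)) (fun _ _ => by positivity) (by simp [hn0.ne'])
      (fun i _ => div_nonneg (add_nonneg (hp i) (hs i)) (hpos i).le)
    rw [← mul_sum] at this
    have h6 : 1 / (n : ℝ) * ∑ i, (p i + s i) / (p i + s' i) ≤ 1 + 16 / K := by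
      rw [one_div, inv_mul_le_iff₀ hn0]; exact hratio
    have h7 := this.trans h6
    have h0 : ∀ i ∈ univ, 0 ≤ (p i + s i) / (p i + s' i) :=
      fun i _ => div_nonneg (add_nonneg (hp i) (hs i)) (hpos i).le
    rw [Real.finsetProd_rpow _ _ h0] at h7
    have h8 := pow_le_pow_left₀ (Real.rpow_nonneg (prod_nonneg h0) _) h7 n
    rwa [one_div, Real.rpow_inv_natCast_pow (prod_nonneg h0) hn.ne'] at h8
  rw [prod_div_distrib, div_le_iff₀ (prod_pos fun i _ => hpos i)] at hprod
  exact hprod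

section Optimal

variable {W : ℕ → ℕ} {n m : ℕ} {T : ℕ → ℕ}

/-- `T` maximizes the product of the loads. -/
def IsOptimal (W : ℕ → ℕ) (n m : ℕ) (T : ℕ → ℕ) : Prop :=
  (∀ h < m, T h < n) ∧ ∀ T', (∀ h < m, T' h < n) → value W n m T' ≤ value W n m T

theorem load_update_self {g j : ℕ} (hg : g < m) (hj : j ≠ T g) :
    load W m (Function.update T g j) j = load W m T j + W g := by
  unfold load
  rw [← add_sum_erase _ _ (mem_range.2 hg),
    ← add_sum_erase (range m) (fun h => if T h = j then W h else 0) (mem_range.2 hg)]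
  rw [if_neg hj.symm, Function.update_self, if_pos rfl, zero_add, add_comm]
  congr 1
  exact sum_congr rfl fun h hh => by rw [Function.update_of_ne (ne_of_mem_erase hh)]

theorem load_update_old {g j : ℕ} (hg : g < m) (hj : j ≠ T g) :
    load W m (Function.update T g j) (T g) + W g = load W m T (T g) := by
  unfold load
  rw [← add_sum_erase _ _ (mem_range.2 hg),
    ← add_sum_erase (range m) (fun h => if T h = T g then W h else 0) (mem_range.2 hg)]
  rw [if_pos rfl, Function.update_self, if_neg hj, zero_add, add_comm]
  congr 1
  exact sum_congr rfl fun h hh => by rw [Function.update_of_ne (ne_of_mem_erase hh)]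

theorem load_update_other {g i j : ℕ} (hij : i ≠ j) (hi : i ≠ T g) :
    load W m (Function.update T g j) i = load W m T i := by
  refine sum_congr rfl fun h _ => ?_
  rcases eq_or_ne h g with rfl | hh
  · rw [Function.update_self, if_neg hij.symm, if_neg hi.symm]
  · rw [Function.update_of_ne hh]

/-- Removing any good from a bundle of an optimal allocation leaves it no larger than any other. -/
theorem IsOptimal.exchange (hT : IsOptimal W n m T) (hpos : 0 < value W n m T) {g j : ℕ}
    (hg : g < m) (hj : j < n) (hW : 0 < W g) : load W m T (T g) ≤ load W m T j + W g := by
  rcases eq_or_ne j (T g) with rfl | hjg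
  · exact Nat.le_add_right _ _
  have hlt : ∀ h < m, Function.update T g j h < n := by
    intro h hh
    rcases eq_or_ne h g with rfl | hne
    · rwa [Function.update_self]
    · rw [Function.update_of_ne hne]; exact hT.1 h hh
  have hopt := hT.2 _ hlt
  have hi := mem_range.2 (hT.1 g hg)
  have hj' : j ∈ (range n).erase (T g) := mem_erase.2 ⟨hjg, mem_range.2 hj⟩
  unfold value at hopt hpos
  rw [← mul_prod_erase _ _ hi, ← mul_prod_erase _ _ hj'] at hopt hpos
  rw [← mul_prod_erase (range n) (fun i => load W m T i) hi,
    ← mul_prod_erase _ (fun i => load W m T i) hj'] at hopt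
  have hrest : ∏ x ∈ ((range n).erase (T g)).erase j, load W m (Function.update T g j) x =
      ∏ x ∈ ((range n).erase (T g)).erase j, load W m T x :=
    prod_congr rfl fun x hx => load_update_other (ne_of_mem_erase hx)
      (ne_of_mem_erase (mem_of_mem_erase hx))
  rw [hrest, load_update_self hg hjg, ← mul_assoc, ← mul_assoc] at hopt
  have hold := load_update_old (W := W) hg hjg
  rw [← mul_assoc] at hpos
  -- All other loads are positive and cancel. With `A` the load of `T g` without `g`, `B` the load
  -- of `j` and `w = W g`, optimality reads `A * (B + w) ≤ (A + w) * B`, that is, `A ≤ B`.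
  have h1 := Nat.le_of_mul_le_mul_right hopt (Nat.pos_of_mul_pos_left hpos)
  rw [← hold] at h1 ⊢
  nlinarith

theorem add_le_load {X : ℕ → ℕ} {g h : ℕ} (hg : g < m) (hh : h < m) (hne : g ≠ h)
    (hX : X g = X h) : W g + W h ≤ load W m X (X h) := by
  have := sum_le_sum_of_subset (f := fun k => if X k = X h then W k else 0)
    (show {g, h} ⊆ range m by
      intro k hk
      rcases mem_insert.1 hk with rfl | hk
      · exact mem_range.2 hg
      · rw [mem_singleton.1 hk]; exact mem_range.2 hh)
  simpa [load, sum_pair hne, hX] using this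

/-- The sum of the exchange inequalities for `g` and `h`, whose weights together are at most the
load. -/
theorem IsOptimal.load_le_two_mul (hT : IsOptimal W n m T) (hpos : 0 < value W n m T) {g h j : ℕ}
    (hg : g < m) (hh : h < m) (hne : g ≠ h) (hTT : T g = T h) (hWg : 0 < W g) (hWh : 0 < W h)
    (hj : j < n) : load W m T (T h) ≤ 2 * load W m T j := by
  have h1 := hT.exchange hpos hg hj hWg
  have h2 := hT.exchange hpos hh hj hWh
  have h3 := add_le_load (W := W) hg hh hne hTT
  rw [hTT] at h1
  omega

/-- The smallest load is approximated by a small multiple of some weight. -/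
theorem IsOptimal.exists_guess (hT : IsOptimal W n m T) (hpos : 0 < value W n m T) (hn : 0 < n) :
    ∃ g < m, ∃ t < m, ∃ j < n, (∀ i < n, load W m T j ≤ load W m T i) ∧ 0 < W g * (t + 1) ∧
      W g * (t + 1) ≤ load W m T j ∧ load W m T j < 2 * (W g * (t + 1)) := by
  obtain ⟨j, hj, hmin⟩ := exists_min_image (range n) (load W m T) ⟨0, mem_range.2 hn⟩
  have hℓ : 0 < load W m T j :=
    Nat.pos_of_ne_zero (prod_ne_zero_iff.1 hpos.ne' j hj)
  have hm : (range m).Nonempty := by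
    rw [nonempty_range_iff]
    rintro rfl
    simp [load] at hℓ
  obtain ⟨g, hg, hmax⟩ := exists_max_image (range m) (fun h => if T h = j then W h else 0) hm
  have hle : load W m T j ≤ m * (if T g = j then W g else 0) := by
    simpa [load] using sum_le_card_nsmul (range m) _ _ hmax
  have hTg : T g = j := by
    by_contra h
    rw [if_neg h] at hle
    omega
  rw [if_pos hTg] at hle
  have hWg : 0 < W g := Nat.pos_of_ne_zero fun h => by rw [h] at hle; omega
  have hWle : W g ≤ load W m T j := hTg ▸ le_load (mem_range.1 hg)
  have hq : 0 < load W m T j / W g := Nat.div_pos hWle hWg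
  have hqm : load W m T j / W g ≤ m := Nat.div_le_of_le_mul (by rwa [mul_comm] at hle)
  -- With `g` heaviest in the smallest bundle, `t + 1` is the quotient of the least load by `W g`.
  -- It is between 1 and `m`, because the bundle has at most `m` goods.
  refine ⟨g, mem_range.1 hg, load W m T j / W g - 1, by omega, j, mem_range.1 hj,
    fun i hi => hmin i (mem_range.2 hi), ?_⟩
  rw [Nat.sub_add_cancel hq]
  have h1 := Nat.mul_div_le (load W m T j) (W g)
  have h2 := Nat.lt_mul_div_succ (load W m T j) hWg
  have h3 := Nat.mul_le_mul_left (W g) hq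
  refine ⟨by positivity, h1, ?_⟩
  rw [mul_add] at h2
  omega

variable {K a j : ℕ}

theorem pos_of_rounded_ne_zero {w : ℕ} (h : rounded K a w ≠ 0) : 0 < w := by
  rcases Nat.eq_zero_or_pos w with rfl | hw
  · exact absurd (by unfold rounded; simp) h
  · exact hw

/-- A violation means two goods of nonzero rounded size in one bundle, hence a load of at most `2 *
load W m T j < 4 * a`; but a rounded load above `4 * K ^ 2` units requires more than `4 * a`. -/
theorem IsOptimal.valid (hT : IsOptimal W n m T) (hpos : 0 < value W n m T)
    (hj : j < n) (hlt : load W m T j < 2 * a) :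
    Valid (fun h => rounded K a (W h)) (4 * (K * K)) n T m := by
  intro g hg
  refine ⟨hT.1 g hg, ?_⟩
  by_contra hF
  simp only [Fits, not_or, not_le] at hF
  obtain ⟨h1, h2, h3⟩ := hF
  obtain ⟨h, hh, hhT, hρ⟩ : ∃ h < g, T h = T g ∧ rounded K a (W h) ≠ 0 := by
    rw [load_eq_zero.not] at h1
    push Not at h1
    exact h1
  have h4 := hT.load_le_two_mul hpos (hh.trans hg) hg hh.ne hhT (pos_of_rounded_ne_zero hρ)
    (pos_of_rounded_ne_zero h2) hj
  have h5 : load (fun h => rounded K a (W h)) g T (T g) + rounded K a (W g) ≤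
      load (fun h => rounded K a (W h)) m T (T g) := by
    have := load_le_succ (fun h => rounded K a (W h)) T (show g + 1 ≤ m from hg) (T g)
    rwa [load_succ, if_pos rfl] at this
  have h6 : a * load (fun h => rounded K a (W h)) m T (T g) ≤ K * K * load W m T (T g) := by
    rw [← load_mul, ← load_mul]
    exact load_mono fun h _ _ => mul_rounded_le K a (W h)
  have h7 : a * (4 * (K * K) + 1) ≤ K * K * (4 * a) :=
    (Nat.mul_le_mul_left a (h3.trans_le h5)).trans
      (h6.trans (Nat.mul_le_mul_left _ (by omega)))
  have ha : 0 < a := by omega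
  nlinarith

theorem load_large_eq {ρ X : ℕ → ℕ} {g : ℕ} (hg : g < m) (hρ : ρ g ≠ 0)
    (h0 : ∀ h < m, X h = X g → h ≠ g → ρ h = 0) : load (large ρ W) m X (X g) = W g := by
  unfold load
  rw [sum_eq_single_of_mem g (mem_range.2 hg)]
  · simp [large, hρ]
  · intro h hh hne
    split
    · simp [large, h0 h (mem_range.1 hh) ‹_› hne]
    · rfl

/-- The bundles of rounded load above `L` hold the goods of rounded size above `L`, one each. -/
theorem Valid.prod_huge {ρ X : ℕ → ℕ} {L : ℕ} (hρ : ∀ h < m, ρ h ≤ L + 1)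
    (hX : Valid ρ L n X m) :
    ∏ i : Fin n, (if load ρ m X i = L + 1 then load (large ρ W) m X i else 1) =
      ∏ h ∈ range m, if ρ h = L + 1 then W h else 1 := by
  rw [Fin.prod_univ_eq_prod_range
    (fun i => if load ρ m X i = L + 1 then load (large ρ W) m X i else 1),
    ← prod_fiberwise_of_maps_to (s := range m) (t := range n) (g := X)
      fun h hh => mem_range.2 (hX h (mem_range.1 hh)).1]
  refine prod_congr rfl fun i _ => ?_
  rcases hX.load_le_or hρ i with h | ⟨h, g, hg, rfl, hρg, hall⟩
  · rw [if_neg (by omega), prod_eq_one]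
    intro k hk
    obtain ⟨hkm, rfl⟩ := mem_filter.1 hk
    have := le_load (W := ρ) (X := X) (mem_range.1 hkm)
    rw [if_neg (by omega)]
  · have hmem : g ∈ (range m).filter fun k => X k = X g := by simp [hg]
    rw [if_pos h, load_large_eq hg (by omega) hall, prod_eq_single_of_mem g hmem, if_pos hρg]
    intro k hk hne
    obtain ⟨hkm, hkX⟩ := mem_filter.1 hk
    rw [if_neg (by rw [hall k (mem_range.1 hkm) hkX hne]; omega)]

/-- Completing a candidate of the same code as an optimal allocation is nearly optimal. -/
theorem IsOptimal.value_le {X Y : ℕ → ℕ} {k : ℕ} (hT : IsOptimal W n m T)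
    (hpos : 0 < value W n m T) (hk : 0 < k) (hK : K = 33 * k) (hj : j < n)
    (hmin : ∀ i < n, load W m T j ≤ load W m T i) (ha : 0 < a) (hle : a ≤ load W m T j)
    (hlt : load W m T j < 2 * a)
    (hX : Valid (fun h => rounded K a (W h)) (4 * (K * K)) n X m)
    (hcode : code (fun h => rounded K a (W h)) n X m = code (fun h => rounded K a (W h)) n T m)
    (hY : Completes K a (fun h => rounded K a (W h)) W n m X Y) :
    (value W n m T : ℝ) ≤ (1 + 1 / k) ^ n * value W n m Y := by
  set ρ : ℕ → ℕ := fun h => rounded K a (W h) with hρdef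
  set L := 4 * (K * K) with hL
  have hρ : ∀ h < m, ρ h ≤ L + 1 := fun h _ => rounded_le K a (W h)
  have hTV : Valid ρ L n T m := hT.valid hpos hj hlt
  have hK0 : 0 < K := by omega
  obtain ⟨σ, hσ⟩ := exists_perm_of_code_eq hcode
  set ℓ := load W m T j with hℓ
  have hsplitT := load_large_add_small ρ W m T
  have hsplitY : ∀ i, load (large ρ W) m X i + load (small ρ W) m Y i = load W m Y i := fun i => by
    rw [← load_large_add_small ρ W m Y i, hY.load_large]
  -- small goods are light
  have hsmall : ∀ h, ρ h = 0 → W h ≤ a := fun h hh => by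
    have := mul_lt_of_rounded_eq_zero ha hK0 hh
    nlinarith
  -- Removing a small good leaves at most the least load, so the bundle has load below `2 * a + a`.
  have hsmallT : ∀ i < n, load (small ρ W) m T i ≠ 0 → load W m T i < 4 * a := by
    intro i hi h0
    obtain ⟨h, hh, rfl, hWh⟩ : ∃ h < m, T h = i ∧ small ρ W h ≠ 0 := by
      rw [ne_eq, load_eq_zero] at h0
      push Not at h0
      exact h0
    have hρh : ρ h = 0 := by by_contra hne; simp [small, hne] at hWh
    have hWpos : 0 < W h := Nat.pos_of_ne_zero (by simpa [small, hρh] using hWh)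
    have := hT.exchange hpos hh hj hWpos
    have := hsmall h hρh
    omega
  have hhuge : ∀ {Z : ℕ → ℕ}, Valid ρ L n Z m → ∀ i, load ρ m Z i = L + 1 →
      4 * a ≤ load (large ρ W) m Z i := by
    intro Z hZ i hi
    rcases hZ.load_le_or hρ i with h | ⟨-, g, hg, rfl, hρg, hall⟩
    · omega
    · rw [load_large_eq hg (by omega) hall]
      exact lt_of_rounded hK0 hρg
  have hhugeT : ∀ i : Fin n, load ρ m T i = L + 1 → load (small ρ W) m T i = 0 := by
    intro i hi
    by_contra h0
    have h1 := hsmallT i i.2 h0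
    have h2 := hhuge hTV i hi
    have h3 := hsplitT i
    omega
  -- Both loads are compared with their common rounded load; only the upper bound for `T` costs a
  -- factor `1 + 1 / K`.
  have hnonhuge : ∀ i : Fin n, load ρ m T i ≠ L + 1 →
      K * load (large ρ W) m T i ≤ (K + 1) * load (large ρ W) m X (σ i) := by
    intro i hi
    have hi' : load ρ m T i ≤ L := by have := hTV.load_le hρ i; omega
    have h1 : K * (K * K) * load (large ρ W) m T i ≤ (K + 1) * (a * load ρ m T i) := by
      rw [← load_mul, ← load_mul a, ← load_mul (K + 1)]
      refine load_mono fun h hh hTi => ?_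
      by_cases h0 : ρ h = 0
      · simp [large, h0]
      · simp only [large, if_neg h0]
        exact mul_le_of_rounded ha h0 ((le_load (W := ρ) hh).trans (hTi ▸ hi'))
    have h2 : a * load ρ m X (σ i) ≤ K * K * load (large ρ W) m X (σ i) := by
      rw [← load_mul, ← load_mul]
      refine load_mono fun h _ _ => ?_
      by_cases h0 : ρ h = 0
      · simp [h0]
      · simp only [large, if_neg h0]
        exact mul_rounded_le K a (W h)
    rw [hσ] at h2
    have h3 := Nat.mul_le_mul_left (K + 1) h2
    have hKK : 0 < K * K := by positivity
    refine Nat.le_of_mul_le_mul_left ?_ hKK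
    nlinarith
  -- Huge goods have the same rounded size whatever their weights, so the permutation need not
  -- preserve these loads individually. Their product is that of all huge weights on both sides.
  have hprodhuge : ∏ i : Fin n, (if load ρ m T i = L + 1 then load (large ρ W) m T i else 1) =
      ∏ i : Fin n, (if load ρ m T i = L + 1 then load (large ρ W) m X (σ i) else 1) := by
    rw [hTV.prod_huge hρ, ← hX.prod_huge (W := W) hρ,
      ← Equiv.prod_comp σ fun i : Fin n =>
        if load ρ m X i = L + 1 then load (large ρ W) m X i else 1]
    simp only [hσ]
  have hprodT : K ^ n * value W n m T ≤
      (K + 1) ^ n * ∏ i : Fin n, (load (large ρ W) m X (σ i) + load (small ρ W) m T i) := by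
    have e1 : value W n m T = (∏ i : Fin n,
        if load ρ m T i = L + 1 then load (large ρ W) m T i else 1) *
        ∏ i : Fin n, if load ρ m T i = L + 1 then 1 else load W m T i := by
      rw [← prod_mul_distrib, value, ← Fin.prod_univ_eq_prod_range (fun i => load W m T i)]
      refine prod_congr rfl fun i _ => ?_
      split
      · rw [mul_one, ← hsplitT, hhugeT i ‹_›, add_zero]
      · rw [one_mul]
    rw [e1, hprodhuge, ← prod_mul_distrib]
    have e2 : ∀ c : ℕ, c ^ n = ∏ _i : Fin n, c := fun c => by simp
    rw [e2 K, e2 (K + 1), ← prod_mul_distrib, ← prod_mul_distrib]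
    refine prod_le_prod' fun i _ => ?_
    split
    · rw [hhugeT i ‹_›, add_zero, mul_one]
      exact Nat.mul_le_mul_right _ (Nat.le_succ K)
    · have := hnonhuge i ‹_›
      rw [one_mul, ← hsplitT]
      nlinarith
  have hgreedy : (∏ i : Fin n, ((load (large ρ W) m X (σ i) : ℝ) + load (small ρ W) m T i)) ≤
      (1 + 16 / K) ^ n * ∏ i : Fin n,
        ((load (large ρ W) m X (σ i) : ℝ) + load (small ρ W) m Y (σ i)) := by
    refine prod_le_of_greedy (K := K) (a := a) (ℓ := ℓ) _ _ _ ?_ ?_ ?_ (fun _ => Nat.cast_nonneg _)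
      (fun _ => Nat.cast_nonneg _) (fun _ => Nat.cast_nonneg _) ?_ ?_ ?_ ?_
    · exact_mod_cast (by omega : 4 ≤ K)
    · exact_mod_cast ha
    · exact_mod_cast hle
    · intro i
      norm_cast
      by_cases hi : load ρ m T i = L + 1
      · have h1 := hhuge hX (σ i) (by rw [hσ, hi])
        nlinarith
      · have h1 := hnonhuge i hi
        have h2 := hmin i i.2
        have h3 := hsplitT i
        nlinarith
    · rw [Equiv.sum_comp σ fun i : Fin n => (load (small ρ W) m Y i : ℝ)]
      norm_cast
      rw [Fin.sum_univ_eq_sum_range (fun i => load (small ρ W) m T i),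
        Fin.sum_univ_eq_sum_range (fun i => load (small ρ W) m Y i), sum_load hT.1, sum_load hY.lt]
    · intro i
      norm_cast
      by_cases h0 : load (small ρ W) m T i = 0
      · rw [h0]; exact Nat.zero_le _
      · have h1 := hsmallT i i.2 h0
        have h2 := hsplitT i
        omega
    · intro i
      norm_cast
      refine (hY.greedy (σ i) (σ i).2).imp id fun h j => ?_
      rw [hsplitY, hsplitY]
      exact h (σ j) (σ j).2
  have hvalY : (∏ i : Fin n, ((load (large ρ W) m X (σ i) : ℝ) + load (small ρ W) m Y (σ i))) =
      value W n m Y := by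
    rw [Equiv.prod_comp σ fun i : Fin n =>
      ((load (large ρ W) m X i : ℝ) + load (small ρ W) m Y i), value,
      ← Fin.prod_univ_eq_prod_range (fun i => load W m Y i)]
    push_cast
    exact prod_congr rfl fun i _ => by rw [← hsplitY]; push_cast; rfl
  rw [hvalY] at hgreedy
  have hprodT' : (K : ℝ) ^ n * value W n m T ≤ (K + 1) ^ n *
      ∏ i : Fin n, ((load (large ρ W) m X (σ i) : ℝ) + load (small ρ W) m T i) := by
    exact_mod_cast hprodT
  have hKr : (0 : ℝ) < K := by exact_mod_cast hK0
  have hkr : (1 : ℝ) ≤ k := by exact_mod_cast hk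
  -- This fixes `K = 33 * k`: the left side is `K + 17 + 16 / K`, at most `K + 33`, which is the
  -- right side.
  have hcomb : (K + 1 : ℝ) * (1 + 16 / K) ≤ K * (1 + 1 / k) := by
    have : (K : ℝ) = 33 * k := by exact_mod_cast hK
    rw [this]
    have e1 : (33 * k + 1 : ℝ) * (1 + 16 / (33 * k)) = 33 * k + 17 + 16 / (33 * k) := by
      field_simp; ring
    have e2 : (33 * k : ℝ) * (1 + 1 / k) = 33 * k + 33 := by field_simp
    have e3 : (16 : ℝ) / (33 * k) ≤ 16 := div_le_self (by norm_num) (by linarith)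
    rw [e1, e2]; linarith
  have hfin : (K : ℝ) ^ n * value W n m T ≤ (K : ℝ) ^ n * ((1 + 1 / k) ^ n * value W n m Y) := by
    calc (K : ℝ) ^ n * value W n m T ≤ (K + 1) ^ n * ((1 + 16 / K) ^ n * value W n m Y) :=
          hprodT'.trans (mul_le_mul_of_nonneg_left hgreedy (by positivity))
      _ = ((K + 1) * (1 + 16 / K)) ^ n * value W n m Y := by rw [mul_pow]; ring
      _ ≤ (K * (1 + 1 / k)) ^ n * value W n m Y := by gcongr
      _ = (K : ℝ) ^ n * ((1 + 1 / k) ^ n * value W n m Y) := by rw [mul_pow]; ring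
  exact le_of_mul_le_mul_left hfin (by positivity)

end Optimal

end FairAuction

/-! ### Evaluation rules for programs -/

namespace RAM

@[simp] theorem Cmd.eval_skip (s : State) : skip.eval s = s := rfl

@[simp] theorem Cmd.eval_assign (x : ℕ) (e : Term) (s : State) :
    (assign x e).eval s = s.setReg x (e.val s) := rfl

@[simp] theorem Cmd.eval_write (a : ℕ) (k e : Term) (s : State) :
    (write a k e).eval s = s.setArr a (k.val s) (e.val s) := rfl

@[simp] theorem Cmd.eval_seq (p q : Cmd) (s : State) : (seq p q).eval s = q.eval (p.eval s) := rfl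

@[simp] theorem Cmd.eval_ite (e : Term) (p q : Cmd) (s : State) :
    (ite e p q).eval s = if e.val s = 0 then q.eval s else p.eval s := rfl

attribute [simp] Term.val

/-- A term whose value is `1` if the terms have the same value, and `0` otherwise. -/
def Term.eq (e f : Term) : Term := .sub (.lit 1) (.add (.sub e f) (.sub f e))

@[simp] theorem Term.val_eq (e f : Term) (s : State) :
    (e.eq f).val s = if e.val s = f.val s then 1 else 0 := by
  simp only [Term.eq, val]
  split <;> omega

end RAM

namespace FairAuction

open RAM

/-! ### The program

Registers: 0 accuracy parameter, 1 number of agents, 2 number of goods, 3 `K`, 4 `K ^ 2`, 5 `L`,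
6 `n + 1`, 7 number of codes, 8 common denominator, 9 `L + 2`, 10 and 11 guess, 12 code, 13 good to
be added, 14 agent, 15 good, 16 unit of rounding, 17 rounded load, 18 rounded weight, 19 new code,
20 best value, 21 product, 22 product under construction, 23 agent of least load, 25 cell,
26 number of cells of a table.

Arrays: 0 to 3 input, 4 integral weights, 5 powers of `n + 1`, 6 rounded weights, 7 codes reached,
8 their allocations, 9 current allocation, 10 its loads, 11 best allocation, 12 and 13 next codes
and their allocations. -/

namespace Search

/-- Cell `h` of the allocation of the current code. -/
def cell : Term := .add (.mul (.reg 2) (.reg 12)) (.reg 15)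

/-- The rounded load of agent 14. -/
def level : Cmd :=
  .seq (.assign 17 (.lit 0)) (.rep 15 2 (.ite (.sub (.reg 13) (.reg 15))
    (.ite (.eq (.read 8 cell) (.reg 14)) (.assign 17 (.add (.reg 17) (.read 6 (.reg 15)))) .skip)
    .skip))

/-- Store the extension of the current allocation that gives good 13 to agent 14. -/
def insert : Cmd :=
  .seq (.assign 19 (.sub (.add (.reg 12) (.read 5 (.add (.reg 17) (.read 6 (.reg 13)))))
    (.read 5 (.reg 17))))
  (.seq (.write 12 (.reg 19) (.lit 1))
  (.seq (.rep 15 2 (.write 13 (.add (.mul (.reg 2) (.reg 19)) (.reg 15)) (.read 8 cell)))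
  (.write 13 (.add (.mul (.reg 2) (.reg 19)) (.reg 13)) (.reg 14))))

/-- Extend the current allocation by giving good 13 to agent 14, if this is admissible. -/
def expand : Cmd :=
  .seq level (.ite (.reg 17) (.ite (.read 6 (.reg 13))
    (.ite (.sub (.add (.reg 17) (.read 6 (.reg 13))) (.reg 5)) .skip insert) insert) insert)

/-- Extend all allocations by good 13. -/
def layer : Cmd :=
  .seq (.rep 12 7 (.write 12 (.reg 12) (.lit 0)))
  (.seq (.rep 12 7 (.ite (.read 7 (.reg 12)) (.rep 14 1 expand) .skip))
  (.seq (.rep 12 7 (.write 7 (.reg 12) (.read 12 (.reg 12))))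
  (.rep 25 26 (.write 8 (.reg 25) (.read 13 (.reg 25))))))

/-- Find allocations of all codes. -/
def table : Cmd :=
  .seq (.rep 12 7 (.write 7 (.reg 12) (.lit 0)))
  (.seq (.write 7 (.reg 1) (.lit 1)) (.rep 13 2 layer))

/-- The conditions that hold throughout the search with a fixed unit of rounding. -/
structure Ctx (n m L : ℕ) (ρ W : ℕ → ℕ) (s : State) : Prop where
  agents : s.reg 1 = n
  goods : s.reg 2 = m
  bound : s.reg 5 = L
  codes : s.reg 7 = (n + 1) ^ (L + 2)
  cells : s.reg 26 = (n + 1) ^ (L + 2) * m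
  pow : ∀ r < L + 2, s.arr 5 r = (n + 1) ^ r
  size : ∀ h < m, s.arr 6 h = ρ h
  weight : ∀ h < m, s.arr 4 h = W h
  size_le : ∀ h < m, ρ h ≤ L + 1

theorem Ctx.agree {n m L : ℕ} {ρ W : ℕ → ℕ} {R A : List ℕ} {s s' : State} (hs : Ctx n m L ρ W s)
    (h : Agree R A s s') (hR : ∀ x ∈ [1, 2, 5, 7, 26], x ∉ R) (hA : ∀ x ∈ [4, 5, 6], x ∉ A) :
    Ctx n m L ρ W s' where
  agents := by rw [h.1 1 (hR _ (by simp))]; exact hs.agents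
  goods := by rw [h.1 2 (hR _ (by simp))]; exact hs.goods
  bound := by rw [h.1 5 (hR _ (by simp))]; exact hs.bound
  codes := by rw [h.1 7 (hR _ (by simp))]; exact hs.codes
  cells := by rw [h.1 26 (hR _ (by simp))]; exact hs.cells
  pow := by rw [h.2 5 (hA _ (by simp))]; exact hs.pow
  size := by rw [h.2 6 (hA _ (by simp))]; exact hs.size
  weight := by rw [h.2 4 (hA _ (by simp))]; exact hs.weight
  size_le := hs.size_le

/-- The part of an array that belongs to code `c`. -/
def row (m : ℕ) (X : ℕ → ℕ) (c : ℕ) : ℕ → ℕ := fun h => X (m * c + h)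

/-- Division with remainder by `m`: the rows of different codes do not overlap. -/
theorem cell_inj {m c d h k : ℕ} (hh : h < m) (hk : k < m) :
    m * c + h = m * d + k ↔ c = d ∧ h = k := by
  refine ⟨fun e => ?_, fun ⟨h1, h2⟩ => by rw [h1, h2]⟩
  have hm : 0 < m := by omega
  have h1 : (m * c + h) / m = c := by
    rw [Nat.mul_add_div hm, Nat.div_eq_of_lt hh, add_zero]
  have h2 : (m * d + k) / m = d := by
    rw [Nat.mul_add_div hm, Nat.div_eq_of_lt hk, add_zero]
  have h3 : c = d := by rw [← h1, e, h2]
  subst h3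
  omega

variable {n m L : ℕ} {ρ W : ℕ → ℕ} {s : State}

theorem level_spec (hs : Ctx n m L ρ W s) (hg : s.reg 13 ≤ m) :
    (level.eval s).reg 17 = load ρ (s.reg 13) (row m (s.arr 8) (s.reg 12)) (s.reg 14) := by
  -- Loop bounds have to be constant, so the loop visits all `m` goods and a test skips those from
  -- `g` on; hence the minimum in the invariant.
  have := Cmd.rep_inv (x := 15) (r := 2) (p := .ite (.sub (.reg 13) (.reg 15))
    (.ite (.eq (.read 8 cell) (.reg 14)) (.assign 17 (.add (.reg 17) (.read 6 (.reg 15)))) .skip)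
    .skip) (s := s.setReg 17 0) (fun j s' => s'.reg 17 =
      load ρ (min j (s.reg 13)) (row m (s.arr 8) (s.reg 12)) (s.reg 14)) (by simp [load]) ?_
  · simp only [State.setReg_reg, hs.goods] at this
    rw [if_neg (by decide), min_eq_right hg] at this
    exact this
  · intro j s' hj hx hA ih
    have e2 := hA.1 2 (by decide)
    have e12 := hA.1 12 (by decide)
    have e13 := hA.1 13 (by decide)
    have e14 := hA.1 14 (by decide)
    have e6 := hA.2 6 (by decide)
    have e8 := hA.2 8 (by decide)
    simp [hs.goods] at hj e2 e12 e13 e14 e6 e8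
    simp only [Cmd.eval_ite, Term.val, Term.val_eq, cell, Cmd.eval_assign, Cmd.eval_skip, hx, e2,
      e12, e13, e14, e6, e8]
    by_cases h1 : j < s.reg 13
    · rw [if_neg (by omega), min_eq_left (by omega), load_succ]
      rw [min_eq_left h1.le] at ih
      by_cases h2 : s.arr 8 (m * s.reg 12 + j) = s.reg 14
      · simp [h2, ih, row, hs.size j hj]
      · simp [h2, ih, row]
    · rw [if_pos (by omega), min_eq_right (by omega)]
      rw [min_eq_right (by omega)] at ih
      simpa using ih

/-- The bound `hl` keeps both exponents below `L + 2`, where array 5 holds the powers of `n + 1`. -/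
theorem insert_spec (hs : Ctx n m L ρ W s) (hg : s.reg 13 < m)
    (hl : s.reg 17 + ρ (s.reg 13) ≤ L + 1) :
    (∀ d, (insert.eval s).arr 12 d =
      if d = s.reg 12 + (n + 1) ^ (s.reg 17 + ρ (s.reg 13)) - (n + 1) ^ s.reg 17 then 1
      else s.arr 12 d) ∧
    ∀ d, ∀ h < m, row m ((insert.eval s).arr 13) d h =
      if d = s.reg 12 + (n + 1) ^ (s.reg 17 + ρ (s.reg 13)) - (n + 1) ^ s.reg 17 then
        if h = s.reg 13 then s.reg 14 else row m (s.arr 8) (s.reg 12) h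
      else row m (s.arr 13) d h := by
  set c' := s.reg 12 + (n + 1) ^ (s.reg 17 + ρ (s.reg 13)) - (n + 1) ^ s.reg 17 with hc'
  have hval : (Term.sub (.add (.reg 12) (.read 5 (.add (.reg 17) (.read 6 (.reg 13)))))
      (.read 5 (.reg 17))).val s = c' := by
    simp only [Term.val]
    rw [hs.size _ hg, hs.pow _ (by omega), hs.pow _ (by omega)]
  set s₁ := (s.setReg 19 c').setArr 12 c' 1 with hs₁
  set body : Cmd := .write 13 (.add (.mul (.reg 2) (.reg 19)) (.reg 15)) (.read 8 cell) with hbody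
  have hev : insert.eval s = (((Cmd.rep 15 2 body).eval s₁).setArr 13
      ((Term.add (.mul (.reg 2) (.reg 19)) (.reg 13)).val ((Cmd.rep 15 2 body).eval s₁))
      (((Cmd.rep 15 2 body).eval s₁).reg 14)) := by
    rw [hs₁, ← hval]; simp [insert, hbody]
  have key := Cmd.rep_inv (x := 15) (r := 2) (p := body) (s := s₁) (fun j s' => ∀ d, ∀ h < m,
    row m (s'.arr 13) d h = if d = c' ∧ h < j then row m (s.arr 8) (s.reg 12) h
      else row m (s.arr 13) d h) (by simp [row, hs₁]) (by
    intro j s' hj hx hA ih d h hh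
    have e2 := hA.1 2 (by decide)
    have e12 := hA.1 12 (by decide)
    have e19 := hA.1 19 (by decide)
    have e8 := hA.2 8 (by decide)
    simp [hs₁, hs.goods, State.setArr_arr_of_ne] at hj e2 e12 e19 e8
    have := ih d h hh
    simp only [row] at this ⊢
    simp only [hbody, Cmd.eval_write, Term.val, cell, hx, e2, e12, e19, e8, State.setReg_arr,
      State.setArr_arr, cell_inj hh hj, true_and]
    by_cases h1 : d = c' ∧ h = j
    · rw [if_pos h1, if_pos ⟨h1.1, by omega⟩, h1.2]
    · rw [if_neg h1, this]
      by_cases h2 : d = c'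
      · simp only [h2, true_and] at h1 ⊢
        have : h < j ↔ h < j + 1 := by omega
        simp only [this]
      · simp [h2])
  have hAg := (Cmd.rep 15 2 body).agree s₁
  set s₂ := (Cmd.rep 15 2 body).eval s₁ with hs₂
  have e2 := hAg.1 2 (by decide)
  have e13 := hAg.1 13 (by decide)
  have e14 := hAg.1 14 (by decide)
  have e19 := hAg.1 19 (by decide)
  have e12 := hAg.2 12 (by decide)
  have e2' : s₁.reg 2 = m := by simp [hs₁, hs.goods]
  simp [hs₁, hs.goods] at e2 e13 e14 e19
  rw [hev]
  simp only [Term.val, e2, e13, e14, e19]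
  constructor
  · intro d
    rw [State.setArr_arr_of_ne _ _ _ (by decide), e12, hs₁]
    simp
  · intro d h hh
    have := key d h hh
    rw [e2'] at this
    simp only [row, State.setArr_arr, cell_inj hh hg, true_and] at this ⊢
    rw [this]
    by_cases h1 : d = c' <;> by_cases h2 : h = s.reg 13 <;> simp [h1, h2, hh]

/-- All allocations stored for the goods `h < g` are admissible and have the right code. -/
def Sound (n m L : ℕ) (ρ F X : ℕ → ℕ) (g : ℕ) : Prop :=
  ∀ c < (n + 1) ^ (L + 2), F c ≠ 0 → Valid ρ L n (row m X c) g ∧ code ρ n (row m X c) g = c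

/-- All codes of admissible allocations of the goods `h < g` are marked. -/
def Complete (n L : ℕ) (ρ F : ℕ → ℕ) (g : ℕ) : Prop :=
  ∀ T, Valid ρ L n T g → F (code ρ n T g) ≠ 0

/-- The condition under which agent `i` may receive good `g`. -/
def CanTake (ρ : ℕ → ℕ) (L : ℕ) (X : ℕ → ℕ) (g i : ℕ) : Prop :=
  load ρ g X i = 0 ∨ ρ g = 0 ∨ load ρ g X i + ρ g ≤ L

/-- Overwriting an earlier representative is harmless, as the new one has the same code. Marks are
only added, so what one extension contributes survives the others. -/
theorem expand_spec (hs : Ctx n m L ρ W s) (hg : s.reg 13 < m) (hi : s.reg 14 < n)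
    (hV : Valid ρ L n (row m (s.arr 8) (s.reg 12)) (s.reg 13))
    (hc : code ρ n (row m (s.arr 8) (s.reg 12)) (s.reg 13) = s.reg 12)
    (hS : Sound n m L ρ (s.arr 12) (s.arr 13) (s.reg 13 + 1)) :
    Sound n m L ρ ((expand.eval s).arr 12) ((expand.eval s).arr 13) (s.reg 13 + 1) ∧
    (∀ d, s.arr 12 d ≠ 0 → (expand.eval s).arr 12 d ≠ 0) ∧
    (CanTake ρ L (row m (s.arr 8) (s.reg 12)) (s.reg 13) (s.reg 14) →
      (expand.eval s).arr 12 (s.reg 12 + (n + 1) ^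
        (load ρ (s.reg 13) (row m (s.arr 8) (s.reg 12)) (s.reg 14) + ρ (s.reg 13)) -
        (n + 1) ^ load ρ (s.reg 13) (row m (s.arr 8) (s.reg 12)) (s.reg 14)) ≠ 0) := by
  classical
  have hlev := level_spec hs hg.le
  have hA := level.agree s
  have hs₁ := hs.agree hA (by decide) (by decide)
  set s₁ := level.eval s
  have e12 := hA.1 12 (by decide)
  have e13 := hA.1 13 (by decide)
  have e14 := hA.1 14 (by decide)
  have a8 := hA.2 8 (by decide)
  have a12 := hA.2 12 (by decide)
  have a13 := hA.2 13 (by decide)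
  set X := row m (s.arr 8) (s.reg 12)
  set g := s.reg 13
  set i := s.reg 14
  have hev : expand.eval s = if CanTake ρ L X g i then insert.eval s₁ else s₁ := by
    have : expand.eval s = if s₁.reg 17 = 0 then insert.eval s₁ else
        if s₁.arr 6 (s₁.reg 13) = 0 then insert.eval s₁ else
        if s₁.reg 17 + s₁.arr 6 (s₁.reg 13) - s₁.reg 5 = 0 then insert.eval s₁ else s₁ := rfl
    rw [this, e13, hs₁.size _ hg, hs₁.bound, hlev]
    unfold CanTake
    split_ifs <;> first | rfl | omega
  rw [hev]
  split
  case isFalse h =>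
    rw [a12, a13]
    exact ⟨hS, fun d h => h, fun h' => absurd h' h⟩
  case isTrue hcan =>
    have hext := fun X' h1 h2 => extension_spec (X' := X') hV hi hcan h1 h2
    have hsz : ∀ h < g + 1, ρ h ≤ L + 1 := fun h hh => hs.size_le h (by omega)
    -- The extended allocation is admissible, so the general bound on its rounded loads applies.
    have hl : load ρ g X i + ρ g ≤ L + 1 := by
      have h1 := hext (Function.update X g i)
        (fun h hh => (Function.update_of_ne hh.ne _ _).symm) (Function.update_self _ _ _)
      have h2 := h1.1.load_le hsz i
      rw [load_succ, Function.update_self, if_pos rfl,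
        load_congr (X' := X) i (fun h hh => Function.update_of_ne hh.ne _ _)
          (fun _ _ _ => rfl)] at h2
      exact h2
    obtain ⟨h12, h13⟩ := insert_spec hs₁ (by rw [e13]; exact hg) (by rw [e13, hlev]; exact hl)
    rw [e12, e13, hlev, a12] at h12
    simp only [e12, e13, e14, hlev, a8, a13] at h13
    set c' := s.reg 12 + (n + 1) ^ (load ρ g X i + ρ g) - (n + 1) ^ load ρ g X i
    refine ⟨fun d hd hFd => ?_, fun d hd => ?_, fun _ => ?_⟩
    · by_cases hdc : d = c'
      · have hrow : ∀ h < m, row m ((insert.eval s₁).arr 13) d h = if h = g then i else X h :=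
          fun h hh => by rw [h13 d h hh, if_pos hdc]
        have h1 := hext (row m ((insert.eval s₁).arr 13) d)
          (fun h hh => by rw [hrow h (by omega), if_neg hh.ne]) (by rw [hrow g hg, if_pos rfl])
        refine ⟨h1.1, ?_⟩
        rw [← h1.2, hc]
        exact hdc.symm
      · have hrow : ∀ h < g + 1, row m (s.arr 13) d h = row m ((insert.eval s₁).arr 13) d h :=
          fun h hh => by rw [h13 d h (by omega), if_neg hdc]
        rw [h12, if_neg hdc] at hFd
        obtain ⟨h1, h2⟩ := hS d hd hFd
        exact ⟨h1.congr hrow, by rw [← code_congr hrow, h2]⟩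
    · rw [h12]
      split
      · exact one_ne_zero
      · exact hd
    · rw [h12, if_pos rfl]
      exact one_ne_zero

end Search

end FairAuction

namespace RAM

/-- Loops that fill an array. -/
theorem Cmd.fill_spec {x r a : ℕ} {e : Term} (s : State) (f : ℕ → ℕ)
    (he : ∀ s', Agree [x] [a] s s' → s'.reg x < s.reg r → e.val s' = f (s'.reg x)) (c : ℕ) :
    ((rep x r (write a (.reg x) e)).eval s).arr a c = if c < s.reg r then f c else s.arr a c := by
  refine Cmd.rep_inv (x := x) (r := r) (p := write a (.reg x) e) (s := s)
    (fun j s' => s'.arr a c = if c < j then f c else s.arr a c) (by simp) ?_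
  intro j s' hj hx hA ih
  have := he s' hA (by rwa [hx])
  simp only [eval_write, Term.val, State.setReg_arr, State.setArr_arr, true_and, this, hx, ih]
  by_cases h : c = j
  · simp [h]
  · have : c < j ↔ c < j + 1 := by omega
    simp [h, this]

end RAM

/-! ### Correctness of the dynamic program over codes -/

namespace FairAuction

open RAM

namespace Search

variable {n m L : ℕ} {ρ W : ℕ → ℕ} {s : State}

theorem expand_all_spec (hs : Ctx n m L ρ W s) (hg : s.reg 13 < m)
    (hV : Valid ρ L n (row m (s.arr 8) (s.reg 12)) (s.reg 13))
    (hc : code ρ n (row m (s.arr 8) (s.reg 12)) (s.reg 13) = s.reg 12)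
    (hS : Sound n m L ρ (s.arr 12) (s.arr 13) (s.reg 13 + 1)) :
    Sound n m L ρ (((Cmd.rep 14 1 expand).eval s).arr 12) (((Cmd.rep 14 1 expand).eval s).arr 13)
      (s.reg 13 + 1) ∧
    (∀ d, s.arr 12 d ≠ 0 → ((Cmd.rep 14 1 expand).eval s).arr 12 d ≠ 0) ∧
    ∀ i < n, CanTake ρ L (row m (s.arr 8) (s.reg 12)) (s.reg 13) i →
      ((Cmd.rep 14 1 expand).eval s).arr 12 (s.reg 12 + (n + 1) ^
        (load ρ (s.reg 13) (row m (s.arr 8) (s.reg 12)) i + ρ (s.reg 13)) -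
        (n + 1) ^ load ρ (s.reg 13) (row m (s.arr 8) (s.reg 12)) i) ≠ 0 := by
  have := Cmd.rep_inv (x := 14) (r := 1) (p := expand) (s := s) (fun j s' =>
    Sound n m L ρ (s'.arr 12) (s'.arr 13) (s.reg 13 + 1) ∧
    (∀ d, s.arr 12 d ≠ 0 → s'.arr 12 d ≠ 0) ∧
    ∀ i < j, CanTake ρ L (row m (s.arr 8) (s.reg 12)) (s.reg 13) i →
      s'.arr 12 (s.reg 12 + (n + 1) ^
        (load ρ (s.reg 13) (row m (s.arr 8) (s.reg 12)) i + ρ (s.reg 13)) -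
        (n + 1) ^ load ρ (s.reg 13) (row m (s.arr 8) (s.reg 12)) i) ≠ 0)
    ⟨hS, fun d h => h, fun i hi => absurd hi (Nat.not_lt_zero i)⟩ ?_
  · rw [hs.agents] at this
    exact this
  · rintro j s' hj hx hA ⟨ih1, ih2, ih3⟩
    rw [hs.agents] at hj
    have hs' := hs.agree hA (by decide) (by decide)
    have e12 := hA.1 12 (by decide)
    have e13 := hA.1 13 (by decide)
    have a8 := hA.2 8 (by decide)
    obtain ⟨h1, h2, h3⟩ := expand_spec hs' (by rw [e13]; exact hg) (by rw [hx]; exact hj)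
      (by rw [e12, e13, a8]; exact hV) (by rw [e12, e13, a8]; exact hc) (by rw [e13]; exact ih1)
    rw [e12, e13, a8, hx] at h3
    rw [e13] at h1
    refine ⟨h1, fun d hd => h2 d (ih2 d hd), fun i hi hcan => ?_⟩
    rcases Nat.lt_succ_iff_lt_or_eq.1 hi with hi | rfl
    · exact h2 _ (ih3 i hi hcan)
    · exact h3 hcan

theorem Sound.congr {F F' X X' : ℕ → ℕ} {g : ℕ} (h : Sound n m L ρ F X g) (hg : g ≤ m)
    (hF : ∀ c < (n + 1) ^ (L + 2), F c = F' c)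
    (hX : ∀ q < (n + 1) ^ (L + 2) * m, X q = X' q) : Sound n m L ρ F' X' g := by
  intro c hc hFc
  rw [← hF c hc] at hFc
  obtain ⟨h1, h2⟩ := h c hc hFc
  have hrow : ∀ k < g, row m X c k = row m X' c k := by
    intro k hk
    refine hX _ ?_
    have := Nat.mul_le_mul_left m (show c + 1 ≤ (n + 1) ^ (L + 2) from hc)
    rw [mul_comm _ m]
    rw [mul_add] at this
    omega
  exact ⟨h1.congr hrow, by rw [← code_congr hrow, h2]⟩

/-- The marks are cleared before each layer; old rows in array 13 do no harm, since `Sound` only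
concerns marked codes. -/
theorem layer_spec (hs : Ctx n m L ρ W s) (hg : s.reg 13 < m)
    (hS : Sound n m L ρ (s.arr 7) (s.arr 8) (s.reg 13))
    (hC : Complete n L ρ (s.arr 7) (s.reg 13)) :
    Sound n m L ρ ((layer.eval s).arr 7) ((layer.eval s).arr 8) (s.reg 13 + 1) ∧
    Complete n L ρ ((layer.eval s).arr 7) (s.reg 13 + 1) := by
  set c1 : Cmd := .rep 12 7 (.write 12 (.reg 12) (.lit 0)) with hc1
  set c2 : Cmd := .rep 12 7 (.ite (.read 7 (.reg 12)) (.rep 14 1 expand) .skip) with hc2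
  set c3 : Cmd := .rep 12 7 (.write 7 (.reg 12) (.read 12 (.reg 12))) with hc3
  set c4 : Cmd := .rep 25 26 (.write 8 (.reg 25) (.read 13 (.reg 25))) with hc4
  have hev : layer.eval s = c4.eval (c3.eval (c2.eval (c1.eval s))) := rfl
  rw [hev]
  -- clearing
  have hA1 := c1.agree s
  have hf1 := Cmd.fill_spec (x := 12) (r := 7) (a := 12) (e := .lit 0) s (fun _ => 0)
    (fun _ _ _ => rfl)
  rw [← hc1, hs.codes] at hf1
  have hs1 := hs.agree hA1 (by decide) (by decide)
  set s1 := c1.eval s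
  have e13 := hA1.1 13 (by decide)
  have a7 := hA1.2 7 (by decide)
  have a8 := hA1.2 8 (by decide)
  -- expanding
  have key := Cmd.rep_inv (x := 12) (r := 7) (p := .ite (.read 7 (.reg 12)) (.rep 14 1 expand) .skip)
    (s := s1) (fun j s' => Sound n m L ρ (s'.arr 12) (s'.arr 13) (s.reg 13 + 1) ∧
      ∀ c < j, s.arr 7 c ≠ 0 → ∀ i < n, CanTake ρ L (row m (s.arr 8) c) (s.reg 13) i →
        s'.arr 12 (c + (n + 1) ^ (load ρ (s.reg 13) (row m (s.arr 8) c) i + ρ (s.reg 13)) -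
          (n + 1) ^ load ρ (s.reg 13) (row m (s.arr 8) c) i) ≠ 0)
    ⟨fun c hc hF => absurd (show s1.arr 12 c = 0 by rw [hf1, if_pos hc]) hF,
      fun c hc => absurd hc (Nat.not_lt_zero c)⟩ (by
      rintro j s' hj hx hA ⟨ih1, ih2⟩
      rw [hs1.codes] at hj
      have hs' := hs1.agree hA (by decide) (by decide)
      have e13' := (hA.1 13 (by decide)).trans e13
      have a7' := (hA.2 7 (by decide)).trans a7
      have a8' := (hA.2 8 (by decide)).trans a8
      simp only [Cmd.eval_ite, Term.val, hx, a7', Cmd.eval_skip]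
      by_cases hF : s.arr 7 j = 0
      · rw [if_pos hF]
        refine ⟨ih1, fun c hc hFc => ?_⟩
        rcases Nat.lt_succ_iff_lt_or_eq.1 hc with hc | rfl
        · exact ih2 c hc hFc
        · exact absurd hF hFc
      · rw [if_neg hF]
        obtain ⟨hV, hcode⟩ := hS j hj hF
        obtain ⟨h1, h2, h3⟩ := expand_all_spec hs' (by rw [e13']; exact hg)
          (by rw [hx, e13', a8']; exact hV) (by rw [hx, e13', a8']; exact hcode)
          (by rw [e13']; exact ih1)
        rw [e13'] at h1
        rw [e13', a8', hx] at h3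
        refine ⟨h1, fun c hc hFc i hi hcan => ?_⟩
        rcases Nat.lt_succ_iff_lt_or_eq.1 hc with hc | rfl
        · exact h2 _ (ih2 c hc hFc i hi hcan)
        · exact h3 i hi hcan)
  rw [← hc2, hs1.codes] at key
  have hs2 := hs1.agree (c2.agree s1) (by decide) (by decide)
  set s2 := c2.eval s1
  -- copying
  have hf3 := Cmd.fill_spec (x := 12) (r := 7) (a := 7) (e := .read 12 (.reg 12)) s2 (s2.arr 12)
    (fun s' h _ => by simp [h.2 12 (by decide)])
  rw [← hc3, hs2.codes] at hf3
  have hA3 := c3.agree s2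
  have hs3 := hs2.agree hA3 (by decide) (by decide)
  have a13 := hA3.2 13 (by decide)
  set s3 := c3.eval s2
  have hf4 := Cmd.fill_spec (x := 25) (r := 26) (a := 8) (e := .read 13 (.reg 25)) s3 (s3.arr 13)
    (fun s' h _ => by simp [h.2 13 (by decide)])
  rw [← hc4, hs3.cells, a13] at hf4
  rw [(c4.agree s3).2 7 (by decide)]
  refine ⟨key.1.congr hg (fun c hc => by rw [hf3, if_pos hc])
    (fun q hq => by rw [hf4, if_pos hq]), fun T hT => ?_⟩
  have hlt := hT.code_lt fun h hh => hs.size_le h (by omega)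
  rw [hf3, if_pos hlt]
  have hT' := (Valid.succ.1 hT).1
  have hlt' := hT'.code_lt fun h hh => hs.size_le h (by omega)
  have hF := hC T hT'
  -- The row stored for the code of `T` before good `g` may differ from `T`, yet it has an extension
  -- whose code is that of `T` after `g`.
  obtain ⟨i, hi, hcan, hcode⟩ := exists_extension hT (hS _ hlt' hF).2
  rw [(hS _ hlt' hF).2] at hcode
  rw [← hcode]
  exact key.2 _ hlt' hF i hi hcan

theorem table_spec (hs : Ctx n m L ρ W s) :
    Sound n m L ρ ((table.eval s).arr 7) ((table.eval s).arr 8) m ∧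
    Complete n L ρ ((table.eval s).arr 7) m := by
  set c1 : Cmd := .rep 12 7 (.write 7 (.reg 12) (.lit 0)) with hc1
  have hev : table.eval s = (Cmd.rep 13 2 layer).eval ((c1.eval s).setArr 7 ((c1.eval s).reg 1) 1) :=
    rfl
  rw [hev]
  have hf1 := Cmd.fill_spec (x := 12) (r := 7) (a := 7) (e := .lit 0) s (fun _ => 0)
    (fun _ _ _ => rfl)
  rw [← hc1, hs.codes] at hf1
  have hs1 := hs.agree (c1.agree s) (by decide) (by decide)
  set s1 := c1.eval s
  have hs2 : Ctx n m L ρ W (s1.setArr 7 (s1.reg 1) 1) :=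
    hs1.agree ((Cmd.write 7 (.reg 1) (.lit 1)).agree s1) (by decide) (by decide)
  have := Cmd.rep_inv (x := 13) (r := 2) (p := layer) (s := s1.setArr 7 (s1.reg 1) 1) (fun j s' =>
    Sound n m L ρ (s'.arr 7) (s'.arr 8) j ∧ Complete n L ρ (s'.arr 7) j) ?_ ?_
  · rw [hs2.goods] at this
    exact this
  · constructor
    · intro c hc hF
      refine ⟨fun h hh => absurd hh (Nat.not_lt_zero h), ?_⟩
      simp only [State.setReg_arr, State.setArr_arr, true_and, hf1, if_pos hc, hs1.agents] at hF
      -- The empty allocation has `n` loads equal to zero, so its code is `n * (n + 1) ^ 0 = n`.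
      have hcn : c = n := by by_contra h; exact hF (if_neg h)
      simp [code, load, hcn]
    · intro T _
      simp [code, load, hs1.agents]
  · rintro j s' hj hx hA ⟨ih1, ih2⟩
    rw [hs2.goods] at hj
    have hs' := hs2.agree hA (by decide) (by decide)
    have := layer_spec hs' (by rw [hx]; exact hj) (by rw [hx]; exact ih1) (by rw [hx]; exact ih2)
    rw [hx] at this
    exact this

end Search

end FairAuction

/-! ### Greedy completion and evaluation of a candidate -/

namespace FairAuction

open RAM Finset

namespace Search

/-- Make the stored allocation of code 12 the current one. -/
def copyRow : Cmd := .rep 15 2 (.write 9 (.reg 15) (.read 8 cell))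

/-- The loads of the current allocation, without the goods of rounded size zero. -/
def loads : Cmd :=
  .seq (.rep 14 1 (.write 10 (.reg 14) (.lit 0)))
  (.rep 15 2 (.ite (.read 6 (.reg 15)) (.write 10 (.read 9 (.reg 15))
    (.add (.read 10 (.read 9 (.reg 15))) (.read 4 (.reg 15)))) .skip))

/-- An agent of least load. -/
def argmin : Cmd :=
  .seq (.assign 23 (.lit 0))
  (.rep 14 1 (.ite (.sub (.read 10 (.reg 23)) (.read 10 (.reg 14))) (.assign 23 (.reg 14)) .skip))

/-- Give good 15 to agent 23. -/
def give : Cmd :=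
  .seq (.write 9 (.reg 15) (.reg 23))
  (.write 10 (.reg 23) (.add (.read 10 (.reg 23)) (.read 4 (.reg 15))))

/-- Give the goods of rounded size zero to agents of least load. -/
def greedy : Cmd := .rep 15 2 (.ite (.read 6 (.reg 15)) .skip (.seq argmin give))

/-- The product of register 21 and the load of agent 14. -/
def mulLoad : Cmd :=
  .seq (.assign 22 (.lit 0))
  (.rep 15 2 (.ite (.eq (.read 9 (.reg 15)) (.reg 14))
    (.assign 22 (.add (.reg 22) (.mul (.read 4 (.reg 15)) (.reg 21)))) .skip))

/-- The value of the current allocation. -/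
def product : Cmd :=
  .seq (.assign 21 (.lit 1)) (.rep 14 1 (.seq mulLoad (.assign 21 (.reg 22))))

/-- Store the current allocation if it is better than the best one so far. -/
def record : Cmd :=
  .ite (.sub (.reg 21) (.reg 20))
    (.seq (.assign 20 (.reg 21)) (.rep 15 2 (.write 11 (.reg 15) (.read 9 (.reg 15))))) .skip

/-- Complete and evaluate the stored allocation of code 12. -/
def evaluate : Cmd := .seq copyRow (.seq loads (.seq greedy (.seq product record)))

variable {n m L : ℕ} {ρ W : ℕ → ℕ} {s : State}

theorem copyRow_spec (hs : Ctx n m L ρ W s) :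
    ∀ h < m, (copyRow.eval s).arr 9 h = row m (s.arr 8) (s.reg 12) h := by
  intro h hh
  have := Cmd.fill_spec (x := 15) (r := 2) (a := 9) (e := .read 8 cell) s
    (row m (s.arr 8) (s.reg 12)) (fun s' hA _ => by
      simp [cell, row, hA.1 2 (by decide), hA.1 12 (by decide), hA.2 8 (by decide), hs.goods]) h
  rwa [hs.goods, if_pos hh] at this

theorem loads_spec (hs : Ctx n m L ρ W s) :
    ∀ i < n, (loads.eval s).arr 10 i = load (large ρ W) m (s.arr 9) i := by
  set c1 : Cmd := .rep 14 1 (.write 10 (.reg 14) (.lit 0)) with hc1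
  have hf1 := Cmd.fill_spec (x := 14) (r := 1) (a := 10) (e := .lit 0) s (fun _ => 0)
    (fun _ _ _ => rfl)
  rw [← hc1, hs.agents] at hf1
  have hA1 := c1.agree s
  have hs1 := hs.agree hA1 (by decide) (by decide)
  have a9 := hA1.2 9 (by decide)
  have key := Cmd.rep_inv (x := 15) (r := 2) (p := .ite (.read 6 (.reg 15))
    (.write 10 (.read 9 (.reg 15)) (.add (.read 10 (.read 9 (.reg 15))) (.read 4 (.reg 15)))) .skip)
    (s := c1.eval s) (fun j s' => ∀ i < n, s'.arr 10 i = load (large ρ W) j (s.arr 9) i)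
    (fun i hi => by simp [hf1, hi, load]) (by
    intro j s' hj hx hA ih i hi
    rw [hs1.goods] at hj
    have hs' := hs1.agree hA (by decide) (by decide)
    have a9' := (hA.2 9 (by decide)).trans a9
    simp only [Cmd.eval_ite, Term.val, Cmd.eval_write, Cmd.eval_skip, hx, hs'.size j hj, a9',
      hs'.weight j hj, load_succ, State.setReg_arr]
    by_cases h0 : ρ j = 0
    · rw [if_pos h0, ih i hi]
      simp [large, h0]
    · rw [if_neg h0, State.setArr_arr]
      by_cases hji : s.arr 9 j = i
      · subst hji
        simp [large, h0, ih _ hi]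
      · rw [if_neg (by simpa using Ne.symm hji), ih i hi, if_neg hji, add_zero])
  rw [hs1.goods] at key
  exact key

theorem argmin_spec (hs : s.reg 1 = n) (hn : 0 < n) :
    (argmin.eval s).reg 23 < n ∧ ∀ k < n, s.arr 10 ((argmin.eval s).reg 23) ≤ s.arr 10 k := by
  have := Cmd.rep_inv (x := 14) (r := 1) (p := .ite (.sub (.read 10 (.reg 23)) (.read 10 (.reg 14)))
    (.assign 23 (.reg 14)) .skip) (s := s.setReg 23 0) (fun j s' => s'.reg 23 < n ∧
      ∀ k < j, s.arr 10 (s'.reg 23) ≤ s.arr 10 k) (by simpa using hn) (by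
    rintro j s' hj hx hA ⟨ih1, ih2⟩
    have a10 := hA.2 10 (by decide)
    simp [hs] at hj a10
    simp only [Cmd.eval_ite, Term.val, hx, a10, Cmd.eval_assign, Cmd.eval_skip]
    split
    · refine ⟨by simpa using ih1, fun k hk => ?_⟩
      simp only [State.setReg_reg]
      rw [if_neg (by decide)]
      rcases Nat.lt_succ_iff_lt_or_eq.1 hk with hk | rfl
      · exact ih2 k hk
      · omega
    · refine ⟨by simpa using hj, fun k hk => ?_⟩
      simp only [State.setReg_reg, if_true]
      rw [if_neg (by decide)]
      rcases Nat.lt_succ_iff_lt_or_eq.1 hk with hk | rfl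
      · exact le_trans (by omega) (ih2 k hk)
      · exact le_rfl)
  have e : (s.setReg 23 0).reg 1 = n := by simpa using hs
  rw [e] at this
  exact this

/-- The state of the greedy completion after the goods `h < j`. -/
structure Partial (K a n m : ℕ) (ρ W X : ℕ → ℕ) (j : ℕ) (Y Z : ℕ → ℕ) : Prop where
  lt : ∀ h < m, Y h < n
  eq : ∀ h < m, (ρ h ≠ 0 ∨ j ≤ h) → Y h = X h
  sum : ∀ i < n, Z i = load (large ρ W) m X i + load (small ρ W) j Y i
  greedy : (∀ h < m, ρ h = 0 → K * W h ≤ a) → ∀ i < n, load (small ρ W) j Y i = 0 ∨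
    ∀ k < n, K * Z i ≤ K * Z k + a ∧ load (large ρ W) m X i ≤ Z k

theorem Partial.skip {K a j : ℕ} {X Y Z : ℕ → ℕ} (h : Partial K a n m ρ W X j Y Z) (hj : ρ j ≠ 0) :
    Partial K a n m ρ W X (j + 1) Y Z := by
  have e : ∀ i, load (small ρ W) (j + 1) Y i = load (small ρ W) j Y i := fun i => by
    rw [load_succ]; simp [small, hj]
  refine ⟨h.lt, fun k hk hk' => h.eq k hk (hk'.imp id fun h => by omega), ?_, ?_⟩
  · simpa only [e] using h.sum
  · simpa only [e] using h.greedy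

/-- Before the step the receiver has least load, so afterwards it exceeds the others by at most `W
j`, and its large load is at most every load. Loads only increase, so the inequalities of earlier
recipients persist. -/
theorem Partial.give {K a j p : ℕ} {X Y Z : ℕ → ℕ} (h : Partial K a n m ρ W X j Y Z) (hj : ρ j = 0)
    (hjm : j < m) (hp : p < n) (hmin : ∀ k < n, Z p ≤ Z k) :
    Partial K a n m ρ W X (j + 1) (Function.update Y j p) (Function.update Z p (Z p + W j)) := by
  have e : ∀ i, load (small ρ W) (j + 1) (Function.update Y j p) i =
      load (small ρ W) j Y i + if p = i then W j else 0 := fun i => by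
    rw [load_succ, Function.update_self, load_congr (X' := Y) i
      (fun k hk => Function.update_of_ne hk.ne _ _) (fun _ _ _ => rfl)]
    simp [small, hj]
  have hZ : ∀ k, Z k ≤ Function.update Z p (Z p + W j) k := fun k => by
    rcases eq_or_ne k p with rfl | hk
    · simp
    · rw [Function.update_of_ne hk]
  refine ⟨fun k hk => ?_, fun k hk hk' => ?_, fun i hi => ?_, fun hsm i hi => ?_⟩
  · rcases eq_or_ne k j with rfl | hkj
    · simpa using hp
    · rw [Function.update_of_ne hkj]; exact h.lt k hk
  · have hkj : k ≠ j := by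
      rintro rfl
      rcases hk' with h' | h'
      · exact h' hj
      · omega
    rw [Function.update_of_ne hkj]
    exact h.eq k hk (hk'.imp id fun h => by omega)
  · rw [e]
    rcases eq_or_ne i p with rfl | hip
    · rw [Function.update_self, if_pos rfl, h.sum i hi]; ring
    · rw [Function.update_of_ne hip, if_neg hip.symm, h.sum i hi, add_zero]
  · rcases eq_or_ne i p with rfl | hip
    · right
      intro k hk
      rw [Function.update_self]
      have h1 := (hmin k hk).trans (hZ k)
      have h2 := hsm j hjm hj
      have h3 := h.sum i hi
      have h4 := Nat.mul_le_mul_left K h1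
      exact ⟨by rw [mul_add]; omega, by omega⟩
    · rw [e, if_neg hip.symm, add_zero]
      refine (h.greedy hsm i hi).imp id fun h' k hk => ?_
      rw [Function.update_of_ne hip]
      obtain ⟨h1, h2⟩ := h' k hk
      have h3 := Nat.mul_le_mul_left K (hZ k)
      exact ⟨by omega, h2.trans (hZ k)⟩

theorem give_spec (s : State) : (give.eval s).arr 9 = Function.update (s.arr 9) (s.reg 15) (s.reg 23) ∧
    (give.eval s).arr 10 =
      Function.update (s.arr 10) (s.reg 23) (s.arr 10 (s.reg 23) + s.arr 4 (s.reg 15)) := by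
  constructor <;> funext k <;> simp [give, Function.update_apply]

theorem greedy_spec {K a : ℕ} {X : ℕ → ℕ} (hs : Ctx n m L ρ W s) (hn : 0 < n)
    (h0 : Partial K a n m ρ W X 0 (s.arr 9) (s.arr 10)) :
    Partial K a n m ρ W X m ((greedy.eval s).arr 9) ((greedy.eval s).arr 10) := by
  have := Cmd.rep_inv (x := 15) (r := 2) (p := .ite (.read 6 (.reg 15)) .skip (.seq argmin give))
    (s := s) (fun j s' => Partial K a n m ρ W X j (s'.arr 9) (s'.arr 10)) h0 (by
    intro j s' hj hx hA ih
    rw [hs.goods] at hj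
    have hs' := hs.agree hA (by decide) (by decide)
    simp only [Cmd.eval_ite, Term.val, hx, hs'.size j hj, Cmd.eval_skip, Cmd.eval_seq,
      State.setReg_arr]
    by_cases hρ : ρ j = 0
    · rw [if_pos hρ]
      obtain ⟨h1, h2⟩ := argmin_spec hs'.agents hn
      have hA' := argmin.agree s'
      have e15 := (hA'.1 15 (by decide)).trans hx
      have a9 := hA'.2 9 (by decide)
      have a10 := hA'.2 10 (by decide)
      have a4 := hA'.2 4 (by decide)
      obtain ⟨g9, g10⟩ := give_spec (argmin.eval s')
      rw [g9, g10, e15, a9, a10, a4, hs'.weight j hj]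
      exact ih.give hρ hj h1 h2
    · rw [if_neg hρ]
      exact ih.skip hρ)
  rw [hs.goods] at this
  exact this

/-- The product is formed by distributivity: neither the load nor register 21 is constant, but the
single weights are. -/
theorem mulLoad_spec (hs : Ctx n m L ρ W s) :
    (mulLoad.eval s).reg 22 = s.reg 21 * load W m (s.arr 9) (s.reg 14) := by
  have := Cmd.rep_inv (x := 15) (r := 2) (p := .ite (.eq (.read 9 (.reg 15)) (.reg 14))
    (.assign 22 (.add (.reg 22) (.mul (.read 4 (.reg 15)) (.reg 21)))) .skip)
    (s := s.setReg 22 0)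
    (fun j s' => s'.reg 22 = s.reg 21 * load W j (s.arr 9) (s.reg 14)) (by simp [load]) (by
    intro j s' hj hx hA ih
    have e14 := hA.1 14 (by decide)
    have e21 := hA.1 21 (by decide)
    have a9 := hA.2 9 (by decide)
    have a4 := hA.2 4 (by decide)
    simp [hs.goods] at hj e14 e21 a9 a4
    simp only [Cmd.eval_ite, Term.val, Term.val_eq, hx, e14, e21, a9, a4, Cmd.eval_skip,
      Cmd.eval_assign, hs.weight j hj, load_succ]
    by_cases h : s.arr 9 j = s.reg 14
    · simp [h, ih]; ring
    · simp [h, ih])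
  have e : (s.setReg 22 0).reg 2 = m := by simpa using hs.goods
  rw [e] at this
  exact this

theorem product_spec (hs : Ctx n m L ρ W s) : (product.eval s).reg 21 = value W n m (s.arr 9) := by
  have := Cmd.rep_inv (x := 14) (r := 1) (p := .seq mulLoad (.assign 21 (.reg 22)))
    (s := s.setReg 21 1) (fun j s' => s'.reg 21 = ∏ i ∈ range j, load W m (s.arr 9) i) (by simp) (by
    intro j s' hj hx hA ih
    have hs' : Ctx n m L ρ W s' := (hs.agree ((Cmd.assign 21 (.lit 1)).agree s) (by decide)
      (by decide)).agree hA (by decide) (by decide)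
    have a9 := hA.2 9 (by decide)
    simp at a9
    have := mulLoad_spec hs'
    simp only [Cmd.eval_seq, Cmd.eval_assign, Term.val, State.setReg_reg]
    rw [if_pos trivial, this, a9, ih, hx, prod_range_succ]
    exact if_neg (by decide))
  have e : (s.setReg 21 1).reg 1 = n := by simpa using hs.agents
  rw [e] at this
  exact this

/-- The best allocation so far is an allocation of at least the recorded value. -/
def Best (W : ℕ → ℕ) (n m : ℕ) (s : State) : Prop :=
  (∀ h < m, s.arr 11 h < n) ∧ s.reg 20 ≤ value W n m (s.arr 11)

theorem value_congr {X X' : ℕ → ℕ} (h : ∀ k < m, X k = X' k) : value W n m X = value W n m X' :=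
  prod_congr rfl fun i _ => load_congr i h fun _ _ _ => rfl

theorem record_spec (hs : s.reg 2 = m) (hB : Best W n m s) (hlt : ∀ h < m, s.arr 9 h < n)
    (hv : s.reg 21 = value W n m (s.arr 9)) :
    Best W n m (record.eval s) ∧ s.reg 20 ≤ (record.eval s).reg 20 ∧
      s.reg 21 ≤ (record.eval s).reg 20 := by
  have hev : record.eval s = if s.reg 21 - s.reg 20 = 0 then s else
    (Cmd.rep 15 2 (.write 11 (.reg 15) (.read 9 (.reg 15)))).eval (s.setReg 20 (s.reg 21)) := rfl
  rw [hev]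
  by_cases hle : s.reg 21 - s.reg 20 = 0
  · rw [if_pos hle]
    exact ⟨hB, le_rfl, by omega⟩
  · rw [if_neg hle]
    have hf := Cmd.fill_spec (x := 15) (r := 2) (a := 11) (e := .read 9 (.reg 15))
      (s.setReg 20 (s.reg 21)) (s.arr 9) (fun s' h _ => by simp [h.2 9 (by decide)])
    have e20 := (Cmd.rep 15 2 (.write 11 (.reg 15) (.read 9 (.reg 15)))).eval_reg
      (s.setReg 20 (s.reg 21)) (x := 20) (by decide)
    simp [hs] at e20 hf
    have h11 : ∀ h < m, ((Cmd.rep 15 2 (.write 11 (.reg 15) (.read 9 (.reg 15)))).eval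
        (s.setReg 20 (s.reg 21))).arr 11 h = s.arr 9 h := fun h hh => by rw [hf, if_pos hh]
    refine ⟨⟨fun h hh => by rw [h11 h hh]; exact hlt h hh, ?_⟩, ?_, ?_⟩
    · rw [e20, value_congr h11, hv]
    · rw [e20]; omega
    · rw [e20]

/-- The greedy guarantee is conditional on small goods being light, which fails for a zero unit of
rounding in the presence of positive weights. That `Best` persists needs no such condition. -/
theorem evaluate_spec (K a : ℕ) (hs : Ctx n m L ρ W s) (hn : 0 < n) (hB : Best W n m s)
    (hlt : ∀ h < m, row m (s.arr 8) (s.reg 12) h < n) :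
    Best W n m (evaluate.eval s) ∧ s.reg 20 ≤ (evaluate.eval s).reg 20 ∧
    ∃ Y, ((∀ h < m, ρ h = 0 → K * W h ≤ a) →
        Completes K a ρ W n m (row m (s.arr 8) (s.reg 12)) Y) ∧
      value W n m Y ≤ (evaluate.eval s).reg 20 := by
  have hev : evaluate.eval s =
    record.eval (product.eval (greedy.eval (loads.eval (copyRow.eval s)))) := rfl
  rw [hev]
  have hrow := copyRow_spec hs
  set X := row m (s.arr 8) (s.reg 12)
  have hA1 := copyRow.agree s
  have hs1 := hs.agree hA1 (by decide) (by decide)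
  have e1 := hA1.1 20 (by decide)
  have b1 := hA1.2 11 (by decide)
  set s1 := copyRow.eval s
  have hl := loads_spec hs1
  have hA2 := loads.agree s1
  have hs2 := hs1.agree hA2 (by decide) (by decide)
  have e2 := (hA2.1 20 (by decide)).trans e1
  have b2 := (hA2.2 11 (by decide)).trans b1
  have a9 := hA2.2 9 (by decide)
  set s2 := loads.eval s1
  have hP : Partial K a n m ρ W X 0 (s2.arr 9) (s2.arr 10) := by
    rw [a9]
    refine ⟨fun h hh => ?_, fun h hh _ => hrow h hh, fun i hi => ?_, fun _ i hi => .inl rfl⟩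
    · rw [hrow h hh]; exact hlt h hh
    · rw [hl i hi]
      exact load_congr i hrow fun _ _ _ => rfl
  replace hP := greedy_spec hs2 hn hP
  have hA3 := greedy.agree s2
  have hs3 := hs2.agree hA3 (by decide) (by decide)
  have e3 := (hA3.1 20 (by decide)).trans e2
  have b3 := (hA3.2 11 (by decide)).trans b2
  set s3 := greedy.eval s2
  have hv := product_spec hs3
  have hA4 := product.agree s3
  have hs4 := hs3.agree hA4 (by decide) (by decide)
  have e4 := (hA4.1 20 (by decide)).trans e3
  have b4 := (hA4.2 11 (by decide)).trans b3
  have a9' := hA4.2 9 (by decide)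
  set s4 := product.eval s3
  obtain ⟨h1, h2, h3⟩ := record_spec hs4.goods (W := W) (n := n) ⟨by rw [b4]; exact hB.1,
    by rw [e4, b4]; exact hB.2⟩ (by rw [a9']; exact hP.lt) (by rw [a9', hv])
  have hload : ∀ i < n, s3.arr 10 i = load W m (s3.arr 9) i := fun i hi => by
    rw [hP.sum i hi, ← load_large_add_small ρ W m (s3.arr 9)]
    congr 1
    refine sum_congr rfl fun g hg => ?_
    by_cases hρ : ρ g = 0
    · simp [large, hρ]
    · rw [hP.eq g (mem_range.1 hg) (.inl hρ)]
  refine ⟨h1, by rw [← e4]; exact h2, s3.arr 9, fun hsm => ⟨hP.lt, fun h hh hρ =>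
    hP.eq h hh (.inl hρ), fun i hi => ?_⟩, hv ▸ h3⟩
  refine (hP.greedy hsm i hi).imp id fun h k hk => ?_
  rw [← hload i hi, ← hload k hk]
  exact h k hk

end Search

end FairAuction

/-! ### Rounding and the search over all units -/

namespace FairAuction

open RAM Finset

namespace Search

/-- Round the weights. -/
def round : Cmd :=
  .rep 15 2 (.seq (.assign 18 (.div (.mul (.reg 4) (.read 4 (.reg 15))) (.reg 16)))
    (.ite (.sub (.reg 3) (.reg 18)) (.write 6 (.reg 15) (.lit 0))
      (.ite (.sub (.reg 18) (.reg 5)) (.write 6 (.reg 15) (.add (.reg 5) (.lit 1)))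
        (.write 6 (.reg 15) (.reg 18)))))

/-- Search with unit of rounding given by registers 10 and 11. -/
def guess : Cmd :=
  .seq (.assign 16 (.mul (.read 4 (.reg 10)) (.add (.reg 11) (.lit 1))))
  (.seq round (.seq table (.rep 12 7 (.ite (.read 7 (.reg 12)) evaluate .skip))))

/-- The search over all units of rounding. -/
def search : Cmd := .rep 10 2 (.rep 11 2 guess)

/-- The conditions that hold throughout the search. -/
structure Base (K n m : ℕ) (W : ℕ → ℕ) (s : State) : Prop where
  agents : s.reg 1 = n
  goods : s.reg 2 = m
  accuracy : s.reg 3 = K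
  accuracy_sq : s.reg 4 = K * K
  bound : s.reg 5 = 4 * (K * K)
  codes : s.reg 7 = (n + 1) ^ (4 * (K * K) + 2)
  cells : s.reg 26 = (n + 1) ^ (4 * (K * K) + 2) * m
  pow : ∀ r < 4 * (K * K) + 2, s.arr 5 r = (n + 1) ^ r
  weight : ∀ h < m, s.arr 4 h = W h

theorem Base.agree {K n m : ℕ} {W : ℕ → ℕ} {R A : List ℕ} {s s' : State} (hs : Base K n m W s)
    (h : Agree R A s s') (hR : ∀ x ∈ [1, 2, 3, 4, 5, 7, 26], x ∉ R) (hA : ∀ x ∈ [4, 5], x ∉ A) :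
    Base K n m W s' where
  agents := by rw [h.1 1 (hR _ (by simp))]; exact hs.agents
  goods := by rw [h.1 2 (hR _ (by simp))]; exact hs.goods
  accuracy := by rw [h.1 3 (hR _ (by simp))]; exact hs.accuracy
  accuracy_sq := by rw [h.1 4 (hR _ (by simp))]; exact hs.accuracy_sq
  bound := by rw [h.1 5 (hR _ (by simp))]; exact hs.bound
  codes := by rw [h.1 7 (hR _ (by simp))]; exact hs.codes
  cells := by rw [h.1 26 (hR _ (by simp))]; exact hs.cells
  pow := by rw [h.2 5 (hA _ (by simp))]; exact hs.pow
  weight := by rw [h.2 4 (hA _ (by simp))]; exact hs.weight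

variable {K n m : ℕ} {W : ℕ → ℕ} {s : State}

theorem round_spec (hs : Base K n m W s) :
    ∀ h < m, (round.eval s).arr 6 h = rounded K (s.reg 16) (W h) := by
  set body : Cmd := .seq (.assign 18 (.div (.mul (.reg 4) (.read 4 (.reg 15))) (.reg 16)))
    (.ite (.sub (.reg 3) (.reg 18)) (.write 6 (.reg 15) (.lit 0))
      (.ite (.sub (.reg 18) (.reg 5)) (.write 6 (.reg 15) (.add (.reg 5) (.lit 1)))
        (.write 6 (.reg 15) (.reg 18)))) with hbody
  have := Cmd.rep_inv (x := 15) (r := 2) (p := body) (s := s) (fun j s' => ∀ h < j,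
    s'.arr 6 h = rounded K (s.reg 16) (W h)) (fun h hh => absurd hh (Nat.not_lt_zero h)) (by
    intro j s' hj hx hA ih h hh
    rw [hs.goods] at hj
    have hs' := hs.agree hA (by decide) (by decide)
    have e16 := hA.1 16 (by decide)
    have hev : (body.eval s').arr 6 = Function.update (s'.arr 6) j (rounded K (s.reg 16) (W j)) := by
      have : body.eval s' =
          if s'.reg 3 - s'.reg 4 * s'.arr 4 (s'.reg 15) / s'.reg 16 = 0 then
            if s'.reg 4 * s'.arr 4 (s'.reg 15) / s'.reg 16 - s'.reg 5 = 0 then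
              (s'.setReg 18 (s'.reg 4 * s'.arr 4 (s'.reg 15) / s'.reg 16)).setArr 6 (s'.reg 15)
                (s'.reg 4 * s'.arr 4 (s'.reg 15) / s'.reg 16)
            else (s'.setReg 18 (s'.reg 4 * s'.arr 4 (s'.reg 15) / s'.reg 16)).setArr 6 (s'.reg 15)
              (s'.reg 5 + 1)
          else (s'.setReg 18 (s'.reg 4 * s'.arr 4 (s'.reg 15) / s'.reg 16)).setArr 6 (s'.reg 15)
            0 := rfl
      rw [this, hs'.accuracy, hs'.accuracy_sq, hs'.bound, hx, hs'.weight j hj, e16, rounded,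
        mul_comm (W j)]
      funext k
      split_ifs <;> first | omega | simp [Function.update_apply]
    rw [State.setReg_arr, hev]
    rcases Nat.lt_succ_iff_lt_or_eq.1 hh with hh | rfl
    · rw [Function.update_of_ne hh.ne, ih h hh]
    · rw [Function.update_self])
  rw [hs.goods] at this
  exact this

/-- Every admissible allocation for rounding unit `a` has a candidate of the same code and of value
at most `v`. -/
def Covers (K n m : ℕ) (W : ℕ → ℕ) (a v : ℕ) : Prop :=
  ∀ T, Valid (fun h => rounded K a (W h)) (4 * (K * K)) n T m → ∃ X Y,
    Valid (fun h => rounded K a (W h)) (4 * (K * K)) n X m ∧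
    code (fun h => rounded K a (W h)) n X m = code (fun h => rounded K a (W h)) n T m ∧
    Completes K a (fun h => rounded K a (W h)) W n m X Y ∧ value W n m Y ≤ v

/-- For a good of weight zero the unit is zero, division by it yields zero, and all weights are
rounded to zero. Such a guess only has to leave the best allocation intact. -/
theorem guess_spec (hs : Base K n m W s) (hn : 0 < n) (hK : 0 < K) (hB : Best W n m s)
    (hg : s.reg 10 < m) :
    Best W n m (guess.eval s) ∧ s.reg 20 ≤ (guess.eval s).reg 20 ∧
    (0 < W (s.reg 10) * (s.reg 11 + 1) →
      Covers K n m W (W (s.reg 10) * (s.reg 11 + 1)) ((guess.eval s).reg 20)) := by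
  set a := W (s.reg 10) * (s.reg 11 + 1) with ha
  set c4 : Cmd := .rep 12 7 (.ite (.read 7 (.reg 12)) evaluate .skip) with hc4
  have hev : guess.eval s = c4.eval (table.eval (round.eval (s.setReg 16 a))) := by
    rw [ha, ← hs.weight _ hg]; rfl
  rw [hev]
  have hA1 : Agree [16] [] s (s.setReg 16 a) := agree_setReg (by simp) s a
  have hs1 := hs.agree hA1 (by decide) (by decide)
  have hB1 : Best W n m (s.setReg 16 a) := hB
  have hr := round_spec hs1
  have e16 : (s.setReg 16 a).reg 16 = a := by simp
  have e20 : (s.setReg 16 a).reg 20 = s.reg 20 := by simp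
  rw [e16] at hr
  rw [← e20]
  set s1 := s.setReg 16 a
  have hA2 := round.agree s1
  have hs2 := hs1.agree hA2 (by decide) (by decide)
  have hB2 : Best W n m (round.eval s1) := by
    unfold Best; rw [hA2.1 20 (by decide), hA2.2 11 (by decide)]; exact hB1
  have hctx : Ctx n m (4 * (K * K)) (fun h => rounded K a (W h)) W (round.eval s1) :=
    ⟨hs2.agents, hs2.goods, hs2.bound, hs2.codes, hs2.cells, hs2.pow, hr, hs2.weight,
      fun h _ => rounded_le K a (W h)⟩
  rw [← hA2.1 20 (by decide)]
  set s2 := round.eval s1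
  obtain ⟨hS, hC⟩ := table_spec hctx
  have hA3 := table.agree s2
  have hctx3 := hctx.agree hA3 (by decide) (by decide)
  have hB3 : Best W n m (table.eval s2) := by
    unfold Best; rw [hA3.1 20 (by decide), hA3.2 11 (by decide)]; exact hB2
  rw [← hA3.1 20 (by decide)]
  set s3 := table.eval s2
  set ρ : ℕ → ℕ := fun h => rounded K a (W h) with hρ
  have key := Cmd.rep_inv (x := 12) (r := 7) (p := .ite (.read 7 (.reg 12)) evaluate .skip)
    (s := s3) (fun j s' => Best W n m s' ∧ s3.reg 20 ≤ s'.reg 20 ∧ ∀ c < j, s3.arr 7 c ≠ 0 →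
      ∃ Y, ((∀ h < m, ρ h = 0 → K * W h ≤ a) → Completes K a ρ W n m (row m (s3.arr 8) c) Y) ∧
        value W n m Y ≤ s'.reg 20) ⟨hB3, le_rfl, fun c hc => absurd hc (Nat.not_lt_zero c)⟩ (by
    rintro j s' hj hx hA ⟨ih1, ih2, ih3⟩
    rw [hctx3.codes] at hj
    have hs' := hctx3.agree hA (by decide) (by decide)
    have a7 := hA.2 7 (by decide)
    have a8 := hA.2 8 (by decide)
    have hev' : (Cmd.ite (.read 7 (.reg 12)) evaluate .skip).eval s' =
      if s'.arr 7 (s'.reg 12) = 0 then s' else evaluate.eval s' := rfl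
    rw [hev', hx, a7]
    by_cases hF : s3.arr 7 j = 0
    · rw [if_pos hF]
      refine ⟨ih1, ih2, fun c hc hFc => ?_⟩
      rcases Nat.lt_succ_iff_lt_or_eq.1 hc with hc | rfl
      · exact ih3 c hc hFc
      · exact absurd hF hFc
    · rw [if_neg hF]
      have hV := (hS j hj hF).1
      obtain ⟨h1, h2, Y, h3, h4⟩ := evaluate_spec K a hs' hn ih1 (by
        rw [hx, a8]; exact fun h hh => (hV h hh).1)
      rw [hx, a8] at h3
      refine ⟨h1, ih2.trans h2, fun c hc hFc => ?_⟩
      rcases Nat.lt_succ_iff_lt_or_eq.1 hc with hc | rfl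
      · obtain ⟨Y, h5, h6⟩ := ih3 c hc hFc
        exact ⟨Y, h5, h6.trans h2⟩
      · exact ⟨Y, h3, h4⟩)
  rw [hctx3.codes] at key
  refine ⟨key.1, key.2.1, fun ha0 T hT => ?_⟩
  have hlt := hT.code_lt fun h _ => rounded_le K a (W h)
  have hF := hC T hT
  obtain ⟨hV, hcode⟩ := hS _ hlt hF
  obtain ⟨Y, h1, h2⟩ := key.2.2 _ hlt hF
  exact ⟨_, Y, hV, hcode, h1 fun h _ hh => (mul_lt_of_rounded_eq_zero ha0 hK hh).le, h2⟩

theorem Covers.mono {a v v' : ℕ} (h : Covers K n m W a v) (hv : v ≤ v') : Covers K n m W a v' := by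
  intro T hT
  obtain ⟨X, Y, h1, h2, h3, h4⟩ := h T hT
  exact ⟨X, Y, h1, h2, h3, h4.trans hv⟩

theorem search_spec (hs : Base K n m W s) (hn : 0 < n) (hK : 0 < K) (hB : Best W n m s) :
    Best W n m (search.eval s) ∧ ∀ g < m, ∀ t < m, 0 < W g * (t + 1) →
      Covers K n m W (W g * (t + 1)) ((search.eval s).reg 20) := by
  have inner : ∀ s, Base K n m W s → Best W n m s → s.reg 10 < m →
      Best W n m ((Cmd.rep 11 2 guess).eval s) ∧ s.reg 20 ≤ ((Cmd.rep 11 2 guess).eval s).reg 20 ∧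
      ∀ t < m, 0 < W (s.reg 10) * (t + 1) → Covers K n m W (W (s.reg 10) * (t + 1))
        (((Cmd.rep 11 2 guess).eval s).reg 20) := by
    intro s hs hB hg
    have := Cmd.rep_inv (x := 11) (r := 2) (p := guess) (s := s) (fun j s' => Best W n m s' ∧
      s.reg 20 ≤ s'.reg 20 ∧ ∀ t < j, 0 < W (s.reg 10) * (t + 1) →
        Covers K n m W (W (s.reg 10) * (t + 1)) (s'.reg 20))
      ⟨hB, le_rfl, fun t ht => absurd ht (Nat.not_lt_zero t)⟩ (by
      rintro j s' hj hx hA ⟨ih1, ih2, ih3⟩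
      have hs' := hs.agree hA (by decide) (by decide)
      have e10 := hA.1 10 (by decide)
      obtain ⟨h1, h2, h3⟩ := guess_spec hs' hn hK ih1 (by rw [e10]; exact hg)
      rw [e10, hx] at h3
      refine ⟨h1, ih2.trans h2, fun t ht hpos => ?_⟩
      rcases Nat.lt_succ_iff_lt_or_eq.1 ht with ht | rfl
      · exact (ih3 t ht hpos).mono h2
      · exact h3 hpos)
    rw [hs.goods] at this
    exact this
  have := Cmd.rep_inv (x := 10) (r := 2) (p := .rep 11 2 guess) (s := s) (fun j s' =>
    Best W n m s' ∧ ∀ g < j, ∀ t < m, 0 < W g * (t + 1) →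
      Covers K n m W (W g * (t + 1)) (s'.reg 20))
    ⟨hB, fun g hg => absurd hg (Nat.not_lt_zero g)⟩ (by
    rintro j s' hj hx hA ⟨ih1, ih2⟩
    rw [hs.goods] at hj
    obtain ⟨h1, h2, h3⟩ := inner s' (hs.agree hA (by decide) (by decide)) ih1 (by rw [hx]; exact hj)
    rw [hx] at h3
    refine ⟨h1, fun g hg t ht hpos => ?_⟩
    rcases Nat.lt_succ_iff_lt_or_eq.1 hg with hg | rfl
    · exact (ih2 g hg t ht hpos).mono h2
    · exact h3 t ht hpos)
  rw [hs.goods] at this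
  exact this

theorem exists_isOptimal (W : ℕ → ℕ) {n : ℕ} (hn : 0 < n) (m : ℕ) : ∃ T, IsOptimal W n m T := by
  have : Nonempty (Fin n) := ⟨⟨0, hn⟩⟩
  obtain ⟨S, hS⟩ := Finite.exists_max fun S : Allocation n m =>
    value W n m (toArray fun g => (S g : ℕ))
  refine ⟨toArray fun g => (S g : ℕ), fun h hh => ?_, fun T' hT' => ?_⟩
  · simp [toArray, hh]
  · refine le_of_eq_of_le (value_congr fun h hh => ?_) (hS fun g => ⟨T' g, hT' g g.2⟩)
    simp [toArray, hh]

/-- The best allocation found by the search is nearly optimal. -/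
theorem search_approx {k : ℕ} (hk : 0 < k) (hs : Base (33 * k) n m W s) (hn : 0 < n)
    (hB : Best W n m s) :
    (∀ h < m, (search.eval s).arr 11 h < n) ∧ ∀ T, (∀ h < m, T h < n) →
      (value W n m T : ℝ) ≤ (1 + 1 / k) ^ n * value W n m ((search.eval s).arr 11) := by
  obtain ⟨⟨h1, h2⟩, h3⟩ := search_spec hs hn (by omega) hB
  refine ⟨h1, fun T hT => ?_⟩
  obtain ⟨T₀, hT₀⟩ := exists_isOptimal W hn m
  refine (Nat.cast_le.2 (hT₀.2 T hT)).trans ?_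
  rcases Nat.eq_zero_or_pos (value W n m T₀) with h0 | hpos
  -- If the optimum is zero, any allocation will do; otherwise the exchange arguments are available.
  · rw [h0, Nat.cast_zero]
    positivity
  obtain ⟨g, hg, t, ht, j, hj, hmin, ha, hle, hlt⟩ := hT₀.exists_guess hpos hn
  obtain ⟨X, Y, hX, hcode, hY, hv⟩ := h3 g hg t ht ha T₀ (hT₀.valid hpos hj hlt)
  refine (hT₀.value_le hpos hk rfl hj hmin ha hle hlt hX hcode hY).trans ?_
  gcongr
  exact hv.trans h2

end Search

end FairAuction

/-! ### Preparation of the input, output, and the whole program -/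

namespace FairAuction

open RAM Finset

namespace Search

/-- Erase the bids. -/
def eraseBids : Cmd :=
  .seq (.rep 14 1 (.write 2 (.reg 14) (.lit 0))) (.rep 14 1 (.write 3 (.reg 14) (.lit 0)))

/-- Compute the parameters of the search and the common denominator. -/
def parameters : Cmd :=
  .seq (.assign 3 (.mul (.lit 33) (.reg 0)))
  -- `1089 = 33 ^ 2`. Register 3 is written in this stage, so it could not serve as the constant
  -- factor of its own square.
  (.seq (.assign 4 (.mul (.lit 1089) (.mul (.reg 0) (.reg 0))))
  (.seq (.assign 5 (.mul (.lit 4) (.reg 4)))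
  (.seq (.assign 9 (.add (.reg 5) (.lit 2)))
  (.seq (.assign 6 (.add (.reg 1) (.lit 1)))
  (.seq (.assign 8 (.lit 1)) (.rep 15 2 (.assign 8 (.mul (.read 1 (.reg 15)) (.reg 8)))))))))

/-- Compute the integral weights and the powers of `n + 1`. -/
def scale : Cmd :=
  .seq (.rep 15 2 (.write 4 (.reg 15)
    (.mul (.read 0 (.reg 15)) (.div (.reg 8) (.read 1 (.reg 15))))))
  (.seq (.assign 7 (.lit 1))
  (.seq (.rep 17 9 (.seq (.write 5 (.reg 17) (.reg 7)) (.assign 7 (.mul (.reg 6) (.reg 7)))))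
  (.assign 26 (.mul (.reg 2) (.reg 7)))))

/-- Write the best allocation and vanishing payments. -/
def output : Cmd :=
  .seq (.rep 15 2 (.write 0 (.reg 15) (.read 11 (.reg 15))))
  (.seq (.rep 14 1 (.write 1 (.reg 14) (.lit 0))) (.rep 14 1 (.write 2 (.reg 14) (.lit 1))))

/-- The computations before the scaling of the weights. -/
def prepare : Cmd := .seq eraseBids parameters

/-- The search and the output. -/
def solve : Cmd := .seq search output

/-- The program. -/
def program : Prog := .seq prepare.toProg (.seq scale.toProg solve.toProg)

variable {n m : ℕ}

/-- Independence of the bids becomes an equality of entire memories, after which nothing need be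
known about the rest of the computation. -/
theorem eraseBids_input (k : ℕ) (w : Fin m → ℚ≥0) (b b' : Fin n → ℚ≥0) :
    eraseBids.eval (input k w b) = eraseBids.eval (input k w b') := by
  have hreg : ∀ (b : Fin n → ℚ≥0) x, (eraseBids.eval (input k w b)).reg x =
      if x = 14 then n else (input k w b').reg x := by
    intro b x
    by_cases hx : x = 14
    · rw [if_pos hx, hx]
      have h2 : ((Cmd.rep 14 1 (.write 2 (.reg 14) (.lit 0))).eval (input k w b)).reg 1 = n :=
        Cmd.eval_reg _ _ (by decide)
      exact (Cmd.rounds_counter 14 _ _ _).trans h2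
    · rw [if_neg hx, Cmd.eval_reg _ _ (by simpa [eraseBids, Cmd.wr] using hx)]
      rfl
  have harr : ∀ (b : Fin n → ℚ≥0) a, (eraseBids.eval (input k w b)).arr a =
      if a = 2 ∨ a = 3 then fun _ => 0 else (input k w b').arr a := by
    intro b a
    have hzero : ∀ (s : State) (a c : ℕ), s.reg 1 = n → (n ≤ c → s.arr a c = 0) →
        ((Cmd.rep 14 1 (.write a (.reg 14) (.lit 0))).eval s).arr a c = 0 := by
      intro s a c hs hc
      rw [Cmd.fill_spec s (fun _ => 0) (fun _ _ _ => rfl), hs]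
      split
      · rfl
      · exact hc (by omega)
    by_cases h2 : a = 2
    · subst h2
      rw [if_pos (.inl rfl)]
      funext c
      have : (eraseBids.eval (input k w b)).arr 2 =
          ((Cmd.rep 14 1 (.write 2 (.reg 14) (.lit 0))).eval (input k w b)).arr 2 :=
        Cmd.eval_arr (.rep 14 1 (.write 3 (.reg 14) (.lit 0))) _ (by decide)
      rw [this]
      refine hzero _ 2 c rfl fun hc => ?_
      simp [input, toArray, hc]
    by_cases h3 : a = 3
    · subst h3
      rw [if_pos (.inr rfl)]
      funext c
      refine hzero _ 3 c (Cmd.eval_reg _ _ (by decide)) fun hc => ?_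
      rw [Cmd.eval_arr _ _ (by decide)]
      simp [input, toArray, hc]
    · rw [if_neg (by simp [h2, h3]), Cmd.eval_arr _ _ (by simp [eraseBids, Cmd.wa, h2, h3])]
      simp only [input]
      split <;> simp_all
  have ext : ∀ s s' : State, s.reg = s'.reg → s.arr = s'.arr → s = s' := by
    rintro ⟨_, _⟩ ⟨_, _⟩ rfl rfl
    rfl
  refine ext _ _ ?_ ?_
  · funext x; rw [hreg b, hreg b']
  · funext a; rw [harr b, harr b']

/-- The memory after the computation. -/
def final (k : ℕ) (w : Fin m → ℚ≥0) (b : Fin n → ℚ≥0) : State :=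
  solve.eval (scale.eval (prepare.eval (input k w b)))

theorem final_eq (k : ℕ) (w : Fin m → ℚ≥0) (b b' : Fin n → ℚ≥0) : final k w b = final k w b' := by
  have : prepare.eval (input k w b) = prepare.eval (input k w b') :=
    congrArg parameters.eval (eraseBids_input k w b b')
  rw [final, final, this]

/-- The common denominator of the weights. -/
def commonDen (w : Fin m → ℚ≥0) : ℕ := ∏ g, (w g).den

/-- The weights, multiplied by their common denominator. -/
def intWeight (w : Fin m → ℚ≥0) : ℕ → ℕ := toArray fun g => (w g).num * (commonDen w / (w g).den)

theorem prepare_spec (k : ℕ) (w : Fin m → ℚ≥0) (b : Fin n → ℚ≥0) :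
    let s := prepare.eval (input k w b)
    s.reg 1 = n ∧ s.reg 2 = m ∧ s.reg 3 = 33 * k ∧ s.reg 4 = 33 * k * (33 * k) ∧
      s.reg 5 = 4 * (33 * k * (33 * k)) ∧ s.reg 6 = n + 1 ∧ s.reg 8 = commonDen w ∧
      s.reg 9 = 4 * (33 * k * (33 * k)) + 2 ∧ s.reg 20 = 0 ∧
      (∀ h : Fin m, s.arr 0 h = (w h).num) ∧ (∀ h : Fin m, s.arr 1 h = (w h).den) ∧
      ∀ h, s.arr 11 h = 0 := by
  intro s
  have a1 : s.arr 1 = (input k w b).arr 1 := Cmd.eval_arr _ _ (by decide)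
  have a0 : s.arr 0 = (input k w b).arr 0 := Cmd.eval_arr _ _ (by decide)
  have a11 : s.arr 11 = (input k w b).arr 11 := Cmd.eval_arr _ _ (by decide)
  have hE := eraseBids.agree (input k w b)
  have x0 : (eraseBids.eval (input k w b)).reg 0 = k := hE.1 0 (by decide)
  have x1 : (eraseBids.eval (input k w b)).reg 1 = n := hE.1 1 (by decide)
  have x2 : (eraseBids.eval (input k w b)).reg 2 = m := hE.1 2 (by decide)
  have y1 := hE.2 1 (by decide)
  set c0 : Cmd := .seq (.assign 3 (.mul (.lit 33) (.reg 0)))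
    (.seq (.assign 4 (.mul (.lit 1089) (.mul (.reg 0) (.reg 0))))
    (.seq (.assign 5 (.mul (.lit 4) (.reg 4)))
    (.seq (.assign 9 (.add (.reg 5) (.lit 2)))
    (.seq (.assign 6 (.add (.reg 1) (.lit 1))) (.assign 8 (.lit 1)))))) with hc0
  set c1 : Cmd := .rep 15 2 (.assign 8 (.mul (.read 1 (.reg 15)) (.reg 8))) with hc1
  have hs : s = c1.eval (c0.eval (eraseBids.eval (input k w b))) := rfl
  set s0 := c0.eval (eraseBids.eval (input k w b)) with hs0
  have hA := c1.agree s0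
  rw [← hs] at hA
  have z2 : s0.reg 2 = m := by simp [hs0, hc0, x2]
  have z8 : s0.reg 8 = 1 := by simp [hs0, hc0]
  have z1 : s0.arr 1 = (input k w b).arr 1 := y1
  refine ⟨Cmd.eval_reg prepare _ (by decide), Cmd.eval_reg prepare _ (by decide), ?_, ?_, ?_, ?_, ?_,
    ?_, Cmd.eval_reg prepare _ (by decide), fun h => ?_, fun h => ?_, fun h => ?_⟩
  · rw [hA.1 3 (by decide)]; simp [hs0, hc0, x0]
  · rw [hA.1 4 (by decide)]; simp [hs0, hc0, x0]; ring
  · rw [hA.1 5 (by decide)]; simp [hs0, hc0, x0]; ring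
  · rw [hA.1 6 (by decide)]; simp [hs0, hc0, x1]
  · have key := Cmd.rep_inv (x := 15) (r := 2) (p := .assign 8 (.mul (.read 1 (.reg 15)) (.reg 8)))
      (s := s0) (fun j s' => s'.reg 8 = ∏ h ∈ range j, (input k w b).arr 1 h) (by simpa using z8) (by
      intro j s' hj hx hA' ih
      have := (hA'.2 1 (by decide)).trans z1
      simp [hx, this, ih, prod_range_succ, mul_comm])
    rw [z2] at key
    rw [hs, key, commonDen, ← Fin.prod_univ_eq_prod_range]
    exact prod_congr rfl fun g _ => by simp [input, toArray]
  · rw [hA.1 9 (by decide)]; simp [hs0, hc0, x0]; ring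
  · rw [a0]; simp [input, toArray]
  · rw [a1]; simp [input, toArray]
  · rw [a11]; rfl

theorem scale_spec (k : ℕ) (w : Fin m → ℚ≥0) (b : Fin n → ℚ≥0) :
    Base (33 * k) n m (intWeight w) (scale.eval (prepare.eval (input k w b))) := by
  obtain ⟨h1, h2, h3, h4, h5, h6, h8, h9, -, ha0, ha1, -⟩ := prepare_spec k w b
  set s := prepare.eval (input k w b)
  set L := 4 * (33 * k * (33 * k)) with hL
  set c1 : Cmd := .rep 15 2 (.write 4 (.reg 15)
    (.mul (.read 0 (.reg 15)) (.div (.reg 8) (.read 1 (.reg 15))))) with hc1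
  set c2 : Cmd := .rep 17 9
    (.seq (.write 5 (.reg 17) (.reg 7)) (.assign 7 (.mul (.reg 6) (.reg 7)))) with hc2
  have hev : scale.eval s = (c2.eval ((c1.eval s).setReg 7 1)).setReg 26
    ((c2.eval ((c1.eval s).setReg 7 1)).reg 2 * (c2.eval ((c1.eval s).setReg 7 1)).reg 7) := rfl
  have hf1 := Cmd.fill_spec (x := 15) (r := 2) (a := 4)
    (e := .mul (.read 0 (.reg 15)) (.div (.reg 8) (.read 1 (.reg 15)))) s (intWeight w)
    (fun s' hA hlt => by
      rw [h2] at hlt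
      have e0 := ha0 ⟨_, hlt⟩
      have e1 := ha1 ⟨_, hlt⟩
      simp only at e0 e1
      simp only [Term.val, hA.1 8 (by decide), hA.2 0 (by decide), hA.2 1 (by decide), h8, e0, e1,
        intWeight, toArray, dif_pos hlt])
  rw [← hc1, h2] at hf1
  set s1 := (c1.eval s).setReg 7 1 with hs1
  have e9 : s1.reg 9 = L + 2 := by
    simp [hs1, (c1.agree s).1 9 (by decide), h9]
  have e6 : s1.reg 6 = n + 1 := by
    simp [hs1, (c1.agree s).1 6 (by decide), h6]
  have key := Cmd.rep_inv (x := 17) (r := 9)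
    (p := .seq (.write 5 (.reg 17) (.reg 7)) (.assign 7 (.mul (.reg 6) (.reg 7)))) (s := s1)
    (fun j s' => s'.reg 7 = (n + 1) ^ j ∧ ∀ r < j, s'.arr 5 r = (n + 1) ^ r) (by simp [hs1]) (by
    rintro j s' hj hx hA ⟨ih1, ih2⟩
    have e6' := (hA.1 6 (by decide)).trans e6
    refine ⟨by simp [e6', ih1, pow_succ, mul_comm], fun r hr => ?_⟩
    simp only [Cmd.eval_seq, Cmd.eval_write, Cmd.eval_assign, Term.val, State.setReg_arr,
      State.setArr_arr, hx, ih1, true_and]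
    by_cases hrj : r = j
    · rw [if_pos hrj, hrj]
    · rw [if_neg hrj]; exact ih2 r (by omega))
  rw [← hc2, e9] at key
  have hA2 := c2.agree s1
  have hA : Agree scale.wr scale.wa s (scale.eval s) := scale.agree s
  have z2 : (c2.eval s1).reg 2 = m := by
    rw [hA2.1 2 (by decide)]; simp [hs1, (c1.agree s).1 2 (by decide), h2]
  refine ⟨?_, ?_, ?_, ?_, ?_, ?_, ?_, ?_, ?_⟩
  · rw [hA.1 1 (by decide), h1]
  · rw [hA.1 2 (by decide), h2]
  · rw [hA.1 3 (by decide), h3]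
  · rw [hA.1 4 (by decide), h4]
  · rw [hA.1 5 (by decide), h5]
  · rw [hev]; exact key.1
  · rw [hev]
    change (c2.eval s1).reg 2 * (c2.eval s1).reg 7 = _
    rw [key.1, z2, mul_comm]
  · rw [hev]; exact key.2
  · intro h hh
    rw [hev]
    change (c2.eval s1).arr 4 h = _
    rw [hA2.2 4 (by decide)]
    change (c1.eval s).arr 4 h = _
    rw [hf1, if_pos hh]

theorem final_spec {k : ℕ} (hk : 0 < k) (hn : 0 < n) (w : Fin m → ℚ≥0) (b : Fin n → ℚ≥0) :
    (∀ h < m, (final k w b).arr 0 h < n) ∧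
    (∀ i < n, (final k w b).arr 1 i = 0 ∧ (final k w b).arr 2 i = 1) ∧
    ∀ T, (∀ h < m, T h < n) → (value (intWeight w) n m T : ℝ) ≤
      (1 + 1 / k) ^ n * value (intWeight w) n m ((final k w b).arr 0) := by
  have hbase := scale_spec k w b
  obtain ⟨-, -, -, -, -, -, -, -, h20, -, -, h11⟩ := prepare_spec k w b
  have hA := scale.agree (prepare.eval (input k w b))
  have hB : Best (intWeight w) n m (scale.eval (prepare.eval (input k w b))) := by
    unfold Best
    rw [hA.1 20 (by decide), hA.2 11 (by decide), h20]
    -- Array 11 is still zero and gives all goods to agent 0; the recorded value 0 is only a lower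
    -- bound for its value.
    exact ⟨fun h _ => by rw [h11]; exact hn, Nat.zero_le _⟩
  obtain ⟨h1, h2⟩ := search_approx hk hbase hn hB
  have hbase' := hbase.agree (search.agree _) (by decide) (by decide)
  set s := search.eval (scale.eval (prepare.eval (input k w b))) with hs
  have hfin : final k w b = output.eval s := rfl
  rw [hfin]
  set c1 : Cmd := .rep 15 2 (.write 0 (.reg 15) (.read 11 (.reg 15))) with hc1
  set c2 : Cmd := .rep 14 1 (.write 1 (.reg 14) (.lit 0)) with hc2
  set c3 : Cmd := .rep 14 1 (.write 2 (.reg 14) (.lit 1)) with hc3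
  have hev : output.eval s = c3.eval (c2.eval (c1.eval s)) := rfl
  have f1 := Cmd.fill_spec (x := 15) (r := 2) (a := 0) (e := .read 11 (.reg 15)) s (s.arr 11)
    (fun s' h _ => by simp [h.2 11 (by decide)])
  have hb1 := hbase'.agree (c1.agree s) (by decide) (by decide)
  have hb2 := hb1.agree (c2.agree _) (by decide) (by decide)
  have f2 := Cmd.fill_spec (x := 14) (r := 1) (a := 1) (e := .lit 0) (c1.eval s) (fun _ => 0)
    (fun _ _ _ => rfl)
  have f3 := Cmd.fill_spec (x := 14) (r := 1) (a := 2) (e := .lit 1) (c2.eval (c1.eval s))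
    (fun _ => 1) (fun _ _ _ => rfl)
  rw [← hc1, hbase'.goods] at f1
  rw [← hc2, hb1.agents] at f2
  rw [← hc3, hb2.agents] at f3
  have e0 : (output.eval s).arr 0 = (c1.eval s).arr 0 := by
    rw [hev, Cmd.eval_arr c3 _ (by decide), Cmd.eval_arr c2 _ (by decide)]
  have e1 : (output.eval s).arr 1 = (c2.eval (c1.eval s)).arr 1 := by
    rw [hev, Cmd.eval_arr c3 _ (by decide)]
  have hO : ∀ h < m, (output.eval s).arr 0 h = s.arr 11 h := fun h hh => by
    rw [e0, f1, if_pos hh]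
  refine ⟨fun h hh => by rw [hO h hh]; exact h1 h hh, fun i hi => ?_, fun T hT => ?_⟩
  · rw [e1, f2, if_pos hi, hev, f3, if_pos hi]
    exact ⟨rfl, rfl⟩
  · rw [value_congr hO]
    exact h2 T hT

/-! ### Running time -/

theorem input_lt (k : ℕ) (w : Fin m → ℚ≥0) (b : Fin n → ℚ≥0) :
    (input k w b).Lt (inputSize w b + k) := by
  have small : ∀ {v : ℕ}, v ≤ inputSize w b + k → v < 2 ^ (inputSize w b + k) := fun h =>
    h.trans_lt Nat.lt_two_pow_self
  have arr : ∀ {l : ℕ} (f : Fin l → ℕ), (∀ j, (f j).size ≤ inputSize w b + k) →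
      ∀ j, toArray f j < 2 ^ (inputSize w b + k) := by
    intro l f hf j
    unfold toArray
    split
    · exact Nat.size_le.1 (hf _)
    · exact Nat.two_pow_pos _
  have hw : ∀ g, (w g).num.size + (w g).den.size ≤ inputSize w b := fun g => by
    have := single_le_sum (f := fun g => (w g).num.size + (w g).den.size)
      (fun _ _ => Nat.zero_le _) (mem_univ g)
    unfold inputSize
    omega
  have hb : ∀ i, (b i).num.size + (b i).den.size ≤ inputSize w b := fun i => by
    have := single_le_sum (f := fun i => (b i).num.size + (b i).den.size)
      (fun _ _ => Nat.zero_le _) (mem_univ i)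
    unfold inputSize
    omega
  have hnm : n + m ≤ inputSize w b := by unfold inputSize; omega
  constructor
  · intro x
    simp only [input]
    split
    · exact small (by omega)
    · exact small (by omega)
    · exact small (by omega)
    · exact Nat.two_pow_pos _
  · intro a j
    simp only [input]
    split
    · exact arr _ (fun g => by have := hw g; omega) j
    · exact arr _ (fun g => by have := hw g; omega) j
    · exact arr _ (fun i => by have := hb i; omega) j
    · exact arr _ (fun i => by have := hb i; omega) j
    · exact Nat.two_pow_pos _

/-- The program has three stages because registers computed by one stage, such as 4, 6, 7, 9 and 26,
are constant factors or loop bounds in a later one, where they are no longer written. -/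
theorem program_exec (k : ℕ) : ∃ q : Polynomial ℕ, ∀ (n m : ℕ) (w : Fin m → ℚ≥0) (b : Fin n → ℚ≥0),
    ∃ t, Exec program (input k w b) t (final k w b) ∧ t ≤ q.eval (inputSize w b) := by
  set L := 4 * (33 * k * (33 * k)) with hL
  -- The summands bound the numbers of agents and goods, the number `L + 2` of powers, the number of
  -- codes, and the number of cells. The exponent depends on `k` only.
  let V : Polynomial ℕ := Polynomial.X + Polynomial.C (L + 2) +
    ((Polynomial.X + 1) ^ (L + 2) + (Polynomial.X + 1) ^ (L + 2) * Polynomial.X)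
  let S : Cmd → Polynomial ℕ := fun c => c.steps.comp V
  let B₁ : Polynomial ℕ := Polynomial.X + Polynomial.C k
  let next : Polynomial ℕ → Cmd → Polynomial ℕ := fun B c => B + S c * (B + 1)
  let time : Polynomial ℕ → Cmd → Polynomial ℕ := fun B c => S c * (2 * next B c + 2)
  refine ⟨time B₁ prepare + (time (next B₁ prepare) scale +
    time (next (next B₁ prepare) scale) solve), fun n m w b => ?_⟩
  set x := inputSize w b with hx
  have hnm : n + m ≤ x := by rw [hx]; unfold inputSize; omega
  have run : ∀ (c : Cmd) (B : Polynomial ℕ) (s : State), c.ok c.wr c.wa = true →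
      s.Lt (B.eval x) → (∀ r ∈ c.bounds, s.reg r ≤ V.eval x) →
      (c.eval s).Lt ((next B c).eval x) ∧ ∃ t, Exec c.toProg s t (c.eval s) ∧
        t ≤ (time B c).eval x := by
    intro c B s hok hs hV
    have := c.exec_self hok hs hV
    simpa [next, time, S, bits, Polynomial.eval_comp] using this
  have hVn : n ≤ V.eval x := by simp [V]; omega
  have hVm : m ≤ V.eval x := by simp [V]; omega
  have hVL : L + 2 ≤ V.eval x := by simp [V]; omega
  have hpow : (n + 1) ^ (L + 2) ≤ (x + 1) ^ (L + 2) := Nat.pow_le_pow_left (by omega) _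
  have hVN : (n + 1) ^ (L + 2) ≤ V.eval x := by simp [V]; omega
  have hVM : (n + 1) ^ (L + 2) * m ≤ V.eval x := by
    have := Nat.mul_le_mul hpow (show m ≤ x by omega)
    simp [V]; omega
  obtain ⟨p1, p2, -, -, -, -, -, p9, -⟩ := prepare_spec k w b
  have hbase := scale_spec k w b
  obtain ⟨hL1, t₁, ht₁, hle₁⟩ := run prepare B₁ (input k w b) (by decide)
    (by simpa [B₁] using input_lt k w b) (by
      intro r hr
      have hr' : r = 1 ∨ r = 2 := by
        revert r; decide
      rcases hr' with rfl | rfl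
      · exact hVn
      · exact hVm)
  obtain ⟨hL2, t₂, ht₂, hle₂⟩ := run scale (next B₁ prepare) _ (by decide) hL1 (by
      intro r hr
      have hr' : r = 2 ∨ r = 9 := by
        revert r; decide
      rcases hr' with rfl | rfl
      · rw [p2]; exact hVm
      · rw [p9]; exact hVL)
  obtain ⟨-, t₃, ht₃, hle₃⟩ := run solve (next (next B₁ prepare) scale) _ (by decide) hL2 (by
      intro r hr
      have hr' : r = 1 ∨ r = 2 ∨ r = 7 ∨ r = 26 := by
        revert r; decide
      rcases hr' with rfl | rfl | rfl | rfl
      · rw [hbase.agents]; exact hVn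
      · rw [hbase.goods]; exact hVm
      · rw [hbase.codes]; exact hVN
      · rw [hbase.cells]; exact hVM)
  refine ⟨_, .seq ht₁ (.seq ht₂ ht₃), ?_⟩
  rw [Polynomial.eval_add, Polynomial.eval_add]
  omega

end Search

/-! ### The mechanism -/

/-- The allocation computed by the program. -/
def computed (k n : ℕ) {m : ℕ} [NeZero n] (w : Fin m → ℚ≥0) : Allocation n m := fun g =>
  Fin.ofNat n ((Search.final k w fun _ : Fin n => 0).arr 0 g)

theorem load_toArray {n m : ℕ} (w : Fin m → ℚ≥0) (S : Allocation n m) (i : Fin n) :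
    (load (Search.intWeight w) m (toArray fun g => (S g : ℕ)) i : ℝ) =
      Search.commonDen w * weight (fun g => (w g : ℝ≥0)) (S.bundle i) := by
  have hw : ∀ g, (((w g).num * (Search.commonDen w / (w g).den) : ℕ) : ℝ) =
      Search.commonDen w * ((w g : ℝ≥0) : ℝ) := by
    intro g
    have hd : ((w g).den : ℝ) ≠ 0 := by exact_mod_cast (w g).den_ne_zero
    have hdvd : (w g).den ∣ Search.commonDen w :=
      dvd_prod_of_mem (fun g => (w g).den) (mem_univ g)
    rw [Nat.cast_mul, Nat.cast_div hdvd hd]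
    have : ((w g : ℝ≥0) : ℝ) = (w g).num / (w g).den := by
      rw [NNRat.cast_def (w g)]; push_cast; rfl
    rw [this]
    field_simp
  unfold load weight Allocation.bundle
  rw [← Fin.sum_univ_eq_sum_range
    (fun h => if toArray (fun g => (S g : ℕ)) h = i then Search.intWeight w h else 0), sum_filter]
  push_cast
  rw [mul_sum]
  refine sum_congr rfl fun g _ => ?_
  have h1 : toArray (fun g => (S g : ℕ)) g = S g := by simp [toArray]
  have h2 : Search.intWeight w g = (w g).num * (Search.commonDen w / (w g).den) := by
    simp [Search.intWeight, toArray]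
  rw [h1, h2]
  by_cases h : S g = i
  · rw [if_pos (by rw [h]), if_pos h]; exact hw g
  · rw [if_neg (fun h' => h (Fin.ext h')), if_neg h]; simp

theorem value_toArray {n m : ℕ} (w : Fin m → ℚ≥0) (S : Allocation n m) :
    (value (Search.intWeight w) n m (toArray fun g => (S g : ℕ)) : ℝ) =
      (Search.commonDen w : ℝ) ^ n *
        ((∏ i, weight (fun g => (w g : ℝ≥0)) (S.bundle i) : ℝ≥0) : ℝ) := by
  unfold value
  rw [← Fin.prod_univ_eq_prod_range
    (fun i => load (Search.intWeight w) m (toArray fun g => (S g : ℕ)) i)]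
  push_cast
  simp only [load_toArray, prod_mul_distrib, prod_const, card_univ, Fintype.card_fin]

/-- The factor of the bids is common to both sides, and the `n`-th root turns `c ^ n` into `c`. -/
theorem nsw_le {n m : ℕ} [NeZero n] {w : Fin m → ℝ≥0} (b : Fin n → ℝ≥0) {S T : Allocation n m}
    {c : ℝ≥0} (h : ∏ i, weight w (T.bundle i) ≤ c ^ n * ∏ i, weight w (S.bundle i)) :
    nsw w b T ≤ c * nsw w b S := by
  have h1 := NNReal.rpow_le_rpow h (z := 1 / (n : ℝ)) (by positivity)
  rw [NNReal.mul_rpow, one_div, NNReal.pow_rpow_inv_natCast _ (NeZero.ne n)] at h1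
  unfold nsw
  rw [one_div]
  calc _ ≤ _ := mul_le_mul_right h1 _
    _ = _ := by ring

theorem computed_approx {k n m : ℕ} [NeZero n] (hk : 0 < k) (w : Fin m → ℚ≥0) (T : Allocation n m) :
    ∏ i, weight (fun g => (w g : ℝ≥0)) (T.bundle i) ≤
      (1 + 1 / k : ℝ≥0) ^ n *
        ∏ i, weight (fun g => (w g : ℝ≥0)) ((computed k n w).bundle i) := by
  have hn : 0 < n := NeZero.pos n
  obtain ⟨h1, -, h3⟩ := Search.final_spec hk hn w fun _ : Fin n => 0
  have h4 := h3 (toArray fun g => (T g : ℕ)) fun h hh => by simp [toArray, hh]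
  have h5 : value (Search.intWeight w) n m ((Search.final k w fun _ : Fin n => 0).arr 0) =
      value (Search.intWeight w) n m (toArray fun g => (computed k n w g : ℕ)) :=
    Search.value_congr fun h hh => by simp [toArray, hh, computed, Nat.mod_eq_of_lt (h1 h hh)]
  rw [h5, value_toArray, value_toArray] at h4
  have hD : (0 : ℝ) < (Search.commonDen w : ℝ) ^ n := by
    have : 0 < Search.commonDen w := prod_pos fun g _ => (w g).den_pos
    positivity
  rw [mul_left_comm] at h4
  rw [← NNReal.coe_le_coe]
  have h6 := le_of_mul_le_mul_left h4 hD
  push_cast at h6 ⊢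
  exact h6

theorem exists_best {n m : ℕ} [NeZero n] (w : Fin m → ℝ≥0) : ∃ S : Allocation n m,
    ∀ T : Allocation n m, ∏ i, weight w (T.bundle i) ≤ ∏ i, weight w (S.bundle i) :=
  Finite.exists_max _

open Classical in
/-- An allocation of the goods: for rational weights the one that the program computes, and
otherwise an optimal one. -/
noncomputable def chosen (k n : ℕ) {m : ℕ} [NeZero n] (w : Fin m → ℝ≥0) : Allocation n m :=
  if h : ∃ w' : Fin m → ℚ≥0, w = fun g => (w' g : ℝ≥0) then computed k n h.choose
  else (exists_best w).choose

theorem chosen_cast (k n : ℕ) {m : ℕ} [NeZero n] (w : Fin m → ℚ≥0) :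
    chosen k n (fun g => (w g : ℝ≥0)) = computed k n w := by
  have h : ∃ w' : Fin m → ℚ≥0, (fun g => (w g : ℝ≥0)) = fun g => (w' g : ℝ≥0) := ⟨w, rfl⟩
  have : h.choose = w := by
    funext g
    -- Rational weights are determined by their real values, so the chosen preimage is `w` itself.
    exact NNRat.cast_injective (congrFun h.choose_spec g).symm
  rw [chosen, dif_pos h, this]

theorem chosen_approx {k n m : ℕ} [NeZero n] (hk : 0 < k) (w : Fin m → ℝ≥0) (T : Allocation n m) :
    ∏ i, weight w (T.bundle i) ≤ (1 + 1 / k : ℝ≥0) ^ n * ∏ i, weight w ((chosen k n w).bundle i) := by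
  by_cases h : ∃ w' : Fin m → ℚ≥0, w = fun g => (w' g : ℝ≥0)
  · obtain ⟨w', rfl⟩ := h
    rw [chosen_cast]
    exact computed_approx hk w' T
  · rw [chosen, dif_neg h]
    refine ((exists_best w).choose_spec T).trans (le_mul_of_one_le_left (zero_le) ?_)
    exact one_le_pow₀ (by simp)

/-- Since the bids only scale the objective, the allocation ignores them and nothing is paid. -/
noncomputable def mechanism (ε : ℝ) : MechanismFamily := fun n _ _ w =>
  { alloc := fun _ => chosen ⌈1 / ε⌉₊ n w
    pay := fun _ _ => 0 }

end FairAuction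

/-- There is a mechanism with accuracy parameter `ε`, run by a single program `P` that receives
`⌈1 / ε⌉` with the instance, which for every `ε > 0` is DSIC, returns a `(1 + ε)`-approximate
solution of FA-NSW, and is computed in polynomial time for that fixed `ε`. -/
theorem theorem3 :
    ∃ (M : ℝ → FairAuction.MechanismFamily) (P : RAM.Prog), ∀ ε : ℝ, 0 < ε →
      (∀ (n m : ℕ) [NeZero n] (w : Fin m → ℝ≥0),
        (M ε n m w).IsDSIC w ∧ (M ε n m w).IsApproxNSW w (1 + ε)) ∧
      FairAuction.ComputesInPolyTime P ⌈1 / ε⌉₊ (M ε) := by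
  refine ⟨FairAuction.mechanism, FairAuction.Search.program, fun ε hε => ?_⟩
  have hk : 0 < ⌈1 / ε⌉₊ := Nat.ceil_pos.2 (by positivity)
  -- The outcome does not depend on the bids, so truthful and other bids give equal utility.
  refine ⟨fun n m _ w => ⟨fun i v b => ⟨le_rfl, ?_⟩, fun b T => ?_⟩, ?_⟩
  · simp only [FairAuction.Mechanism.utility, FairAuction.mechanism, NNReal.coe_zero, sub_zero]
    positivity
  · have h1 := FairAuction.nsw_le b (FairAuction.chosen_approx hk w T)
    rw [← NNReal.coe_le_coe] at h1
    refine h1.trans ?_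
    push_cast
    refine mul_le_mul_of_nonneg_right ?_ (NNReal.coe_nonneg _)
    have h2 : 1 / ε ≤ ⌈1 / ε⌉₊ := Nat.le_ceil _
    have h3 : 1 / (⌈1 / ε⌉₊ : ℝ) ≤ ε := by
      rw [div_le_comm₀ (by exact_mod_cast hk) hε]
      exact h2
    linarith
  · obtain ⟨q, hq⟩ := FairAuction.Search.program_exec ⌈1 / ε⌉₊
    refine ⟨q, fun n m _ w b => ?_⟩
    obtain ⟨t, ht, hle⟩ := hq n m w b
    obtain ⟨h1, h2, -⟩ := FairAuction.Search.final_spec hk (NeZero.pos n) w b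
    refine ⟨t, _, ht, hle, fun g => ?_, fun i => ?_⟩
    · simp only [FairAuction.mechanism]
      -- The mechanism is defined by the run with zero bids, which ends in the same memory as the
      -- run with bids `b`.
      rw [FairAuction.chosen_cast, FairAuction.computed, Fin.val_ofNat,
        FairAuction.Search.final_eq _ w (fun _ => 0) b, Nat.mod_eq_of_lt (h1 g g.2)]
    · obtain ⟨h3, h4⟩ := h2 i i.2
      rw [h3, h4]
      simp [FairAuction.mechanism]
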